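/- Let $\mathbb{T}^2=(\mathbb{R}/2\pi\mathbb{Z})^2$, $|\mathbf{k}|=(k_1^2+k_2^2)^{1/2}$ for $\mathbf{k}=(k_1,k_2)\in\mathbb{Z}^2$, and for $s\in\mathbb{R}$ let $H^s_p(\mathbb{T}^2)$ be the space of (complex) periodic distributions $u=\sum_{\mathbf{k}}\widehat u(\mathbf{k})e^{i\mathbf{k}\cdot\mathbf{x}}$ with $\|u\|_{H^s_p}^2:=(2\pi)^2\sum_{\mathbf{k}\in\mathbb{Z}^2}(1+|\mathbf{k}|)^{2s}|\widehat u(\mathbf{k})|^2<\infty$. Let $r\ge 1$ and let $\mathcal{L}$ be a Fourier multiplier, $\widehat{\mathcal{L}u}(\mathbf{k})=b(\mathbf{k})\widehat u(\mathbf{k})$, with a real symbol $b:\mathbb{Z}^2\to\mathbb{R}$ such that $|b(\mathbf{k})|\le C|\mathbf{k}|^{r-1}$ for all $|\mathbf{k}|\ge N_0$, for some $C>0$ and $N_0\ge 0$. Then $\partial_x\mathcal{L}e^{i\mathbf{k}\cdot\mathbf{x}}=i\lambda_{\mathbf{k}}e^{i\mathbf{k}\cdot\mathbf{x}}$ with $\lambda_{\mathbf{k}}=k_1b(\mathbf{k})$.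 Assume that for all $\mathbf{k}=(k_1,k_2)\in\mathbb{Z}^2$: * $\lambda_{(-k_1,k_2)}=\lambda_{(k_1,k_2)}$ and $\lambda_{(k_1,-k_2)}=-\lambda_{(k_1,k_2)}$; * if $k_1\ne0$, the only $j_2\in\mathbb{Z}$ with $\lambda_{(k_1,j_2)}=\lambda_{(k_1,k_2)}$ is $j_2=k_2$; * if $k_2\neq 0$, the only $j_1\in\mathbb{Z}$ with $\lambda_{(j_1,k_2)}=\lambda_{(k_1,k_2)}$ are $j_1=\pm k_1$. Let $\mathbb{J}\subset\mathbb{Z}^2$ be a maximal set such that the $\lambda_{\mathbf{k}}$, $\mathbf{k}\in\mathbb{J}$, are pairwise distinct. Suppose that $$\gamma:=\inf_{\mathbf{k},\mathbf{k}'\in\mathbb{J},\ \mathbf{k}\ne\mathbf{k}'}|\lambda_{\mathbf{k}}-\lambda_{\mathbf{k}'}|>0,\qquad\text{and put}\qquad \gamma':=\sup_{S\subset\mathbb{J},\ S\text{ finite}}\ \inf_{\mathbf{k},\mathbf{k}'\in\mathbb{J}\setminus S,\ \mathbf{k}\ne\mathbf{k}'}|\lambda_{\mathbf{k}}-\lambda_{\mathbf{k}'}|\in(0,\infty].$$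 Let $g_1,g_2\in C^\infty(\mathbb{R}/2\pi\mathbb{Z})$ be non-negative real-valued functions with integral $1$, each positive exactly on an open interval of the circle, and define $$G(\phi)(x,y)=g_2(y)\Big(\tfrac1{2\pi}\phi(x,y)-\tfrac1{(2\pi)^2}\int_0^{2\pi}\phi(x',y)\,dx'\Big)+g_1(x)\Big(\tfrac1{2\pi}\phi(x,y)-\tfrac1{(2\pi)^2}\int_0^{2\pi}\phi(x,y')\,dy'\Big).$$ Let $s\ge0$ and $T>2\pi/\gamma'$ (with $2\pi/\infty=0$). Then there is a constant $\nu>0$, depending for the given operator $\mathcal{L}$ only on $s$, $g_1$ and $T$, such that for all $u_0,u_1\in H^s_p(\mathbb{T}^2)$ with $\widehat{u_0}(0,0)=\widehat{u_1}(0,0)$ there is $h\in L^2([0,T];H^s_p(\mathbb{T}^2))$ with $$\|h\|_{L^2([0,T];H^s_p)}\le\nu\big(\|u_0\|_{H^s_p}+\|u_1\|_{H^s_p}\big)$$ for which the problem $$u\in C([0,T];H^s_p(\mathbb{T}^2)),\qquad \partial_tu=\partial_x\mathcal{L}u+G(h)(t)\in H^{s-r}_p(\mathbb{T}^2),\ t\in(0,T),\qquad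 u(0)=u_0,$$ has a unique solution $u$, and this solution satisfies $u(T)=u_1$. Here the equation is understood in integrated form: $\partial_x\mathcal{L}u+G(h)$ is an integrable function of $t\in(0,T)$ with values in $H^{s-r}_p(\mathbb{T}^2)$ and $u(t)=u_0+\int_0^t\big(\partial_x\mathcal{L}u+G(h)\big)(\tau)\,d\tau$ in $H^{s-r}_p(\mathbb{T}^2)$ for all $t\in[0,T]$. -/

import Mathlib

open MeasureTheory Set
open scoped ENNReal ContDiff

noncomputable section

namespace TorusControl

instance factTwoPiPos : Fact (0 < 2 * Real.pi) := ⟨Real.two_pi_pos⟩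

/-- The circle `ℝ / 2πℤ`, with its Lebesgue measure `volume` of total mass `2π`. -/
abbrev Circ : Type := AddCircle (2 * Real.pi)

/-- The two-dimensional torus `(ℝ / 2πℤ)²`, with Lebesgue measure of total mass `(2π)²`. -/
abbrev Torus : Type := Circ × Circ

/-- The Euclidean length `|k| = (k₁² + k₂²)^{1/2}` of a frequency. -/
def freqNorm (k : ℤ × ℤ) : ℝ := Real.sqrt ((k.1 : ℝ) ^ 2 + (k.2 : ℝ) ^ 2)

/-- The exponential `e^{i k·x}` on the torus. -/
def expMode (k : ℤ × ℤ) (p : Torus) : ℂ := fourier k.1 p.1 * fourier k.2 p.2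

/-- The Fourier coefficient `(2π)⁻² ∫ e^{-i k·x} φ(x) dx` of a function on the torus. -/
def torusCoeff (φ : Torus → ℂ) (k : ℤ × ℤ) : ℂ :=
  ((2 * Real.pi : ℝ) ^ 2 : ℂ)⁻¹ * ∫ p : Torus, expMode (-k) p * φ p

/-! ### Periodic Sobolev spaces -/

/-- The weight `(1 + |k|)^s`. -/
def sobolevWeight (s : ℝ) (k : ℤ × ℤ) : ℝ := (1 + freqNorm k) ^ s

theorem freqNorm_nonneg (k : ℤ × ℤ) : 0 ≤ freqNorm k := Real.sqrt_nonneg _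

theorem sobolevWeight_pos (s : ℝ) (k : ℤ × ℤ) : 0 < sobolevWeight s k :=
  Real.rpow_pos_of_pos (by linarith [freqNorm_nonneg k]) s

theorem sobolevWeight_sq (s : ℝ) (k : ℤ × ℤ) :
    sobolevWeight s k ^ 2 = (1 + freqNorm k) ^ (2 * s) := by
  rw [sobolevWeight, mul_comm, Real.rpow_mul (by linarith [freqNorm_nonneg k])]
  norm_cast

/-- The factor `2π (1 + |k|)^s`, as a complex number. -/
def scaleFactor (s : ℝ) (k : ℤ × ℤ) : ℂ := ((2 * Real.pi * sobolevWeight s k : ℝ) : ℂ)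

theorem scaleFactor_ne_zero (s : ℝ) (k : ℤ × ℤ) : scaleFactor s k ≠ 0 := by
  have h := mul_pos Real.two_pi_pos (sobolevWeight_pos s k)
  exact Complex.ofReal_ne_zero.2 h.ne'

theorem norm_scaleFactor_mul_sq (s : ℝ) (k : ℤ × ℤ) (z : ℂ) :
    ‖scaleFactor s k * z‖ ^ 2
      = (2 * Real.pi) ^ 2 * ((1 + freqNorm k) ^ (2 * s) * ‖z‖ ^ 2) := by
  have h := mul_pos Real.two_pi_pos (sobolevWeight_pos s k)
  rw [norm_mul, scaleFactor, Complex.norm_real, Real.norm_eq_abs, abs_of_pos h, mul_pow, mul_pow,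
    sobolevWeight_sq, mul_assoc]

theorem memlp_scale_iff (s : ℝ) (a : ℤ × ℤ → ℂ) :
    Memℓp (fun k => scaleFactor s k * a k) 2 ↔
      Summable fun k => (1 + freqNorm k) ^ (2 * s) * ‖a k‖ ^ 2 := by
  rw [memℓp_gen_iff (by norm_num)]
  have h : (fun k => ‖scaleFactor s k * a k‖ ^ (2 : ℝ≥0∞).toReal)
      = fun k => (2 * Real.pi) ^ 2 * ((1 + freqNorm k) ^ (2 * s) * ‖a k‖ ^ 2) := by
    funext k
    rw [← norm_scaleFactor_mul_sq]
    norm_num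
  rw [h, summable_mul_left_iff (pow_ne_zero 2 Real.two_pi_pos.ne')]

/-- The coefficient families `(û(k))` with `∑ (1 + |k|)^{2s} |û(k)|² < ∞`. -/
def sobolevCoeffs (s : ℝ) : Submodule ℂ (ℤ × ℤ → ℂ) where
  carrier := {a | Summable fun k => (1 + freqNorm k) ^ (2 * s) * ‖a k‖ ^ 2}
  zero_mem' := by simp [summable_zero]
  add_mem' := by
    intro a b ha hb
    rw [mem_ofPred_eq, ← memlp_scale_iff] at ha hb ⊢
    convert ha.add hb using 1
    funext k
    simp [mul_add]
  smul_mem' := by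
    intro c a ha
    rw [mem_ofPred_eq, ← memlp_scale_iff] at ha ⊢
    convert ha.const_smul c using 1
    funext k
    simp [mul_left_comm]

/-- The periodic Sobolev space `H^s_p(𝕋²)`, for any real `s`: the periodic distributions
`u = ∑ û(k) e^{i k·x}` with `∑ (1 + |k|)^{2s} |û(k)|² < ∞`. A periodic distribution is determined
by, and is represented here by, the family `(û(k))` of its Fourier coefficients. -/
def SobolevSpace (s : ℝ) : Type := ↥(sobolevCoeffs s)

namespace SobolevSpace

variable {s : ℝ}

/-- The Fourier coefficients `û(k)`. -/
def coeff (u : SobolevSpace s) : ℤ × ℤ → ℂ := Subtype.val u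

instance : AddCommGroup (SobolevSpace s) := inferInstanceAs (AddCommGroup ↥(sobolevCoeffs s))

instance : Module ℂ (SobolevSpace s) := inferInstanceAs (Module ℂ ↥(sobolevCoeffs s))

theorem summable_coeff (u : SobolevSpace s) :
    Summable fun k => (1 + freqNorm k) ^ (2 * s) * ‖u.coeff k‖ ^ 2 := Subtype.property u

/-- The identification of `H^s_p(𝕋²)` with `ℓ²(ℤ²)`, `u ↦ (2π (1 + |k|)^s û(k))`. -/
def equivl2 (s : ℝ) : SobolevSpace s ≃ₗ[ℂ] lp (fun _ : ℤ × ℤ => ℂ) 2 where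
  toFun u := ⟨fun k => scaleFactor s k * u.coeff k, (memlp_scale_iff s u.coeff).2 u.summable_coeff⟩
  map_add' u v := by
    ext k
    exact mul_add _ _ _
  map_smul' c u := by
    ext k
    exact mul_left_comm _ _ _
  invFun a := ⟨fun k => (scaleFactor s k)⁻¹ * a k, by
    rw [sobolevCoeffs, Submodule.mem_mk]
    refine (memlp_scale_iff s _).1 ?_
    convert lp.memℓp a using 1
    funext k
    exact mul_inv_cancel_left₀ (scaleFactor_ne_zero s k) _⟩
  left_inv u := by
    refine Subtype.ext (funext fun k => ?_)
    exact inv_mul_cancel_left₀ (scaleFactor_ne_zero s k) _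
  right_inv a := by
    ext k
    exact mul_inv_cancel_left₀ (scaleFactor_ne_zero s k) _

/-- The norm of `H^s_p(𝕋²)`; see `norm_sq` for the explicit formula. -/
instance : NormedAddCommGroup (SobolevSpace s) :=
  NormedAddCommGroup.induced _ _ (equivl2 s).toLinearMap (equivl2 s).injective

instance : NormedSpace ℂ (SobolevSpace s) :=
  NormedSpace.induced ℂ _ _ (equivl2 s).toLinearMap

/-- `equivl2` as an isometry. -/
def isometryl2 (s : ℝ) : SobolevSpace s ≃ₗᵢ[ℂ] lp (fun _ : ℤ × ℤ => ℂ) 2 where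
  toLinearEquiv := equivl2 s
  norm_map' _ := rfl

instance : CompleteSpace (SobolevSpace s) :=
  (isometryl2 s).toIsometryEquiv.completeSpace

theorem norm_sq (u : SobolevSpace s) :
    ‖u‖ ^ 2 = (2 * Real.pi) ^ 2 * ∑' k, (1 + freqNorm k) ^ (2 * s) * ‖u.coeff k‖ ^ 2 := by
  have h := lp.norm_rpow_eq_tsum (p := 2) (by norm_num) (equivl2 s u)
  have h2 : ‖u‖ = ‖equivl2 s u‖ := rfl
  have h3 : ∀ k, equivl2 s u k = scaleFactor s k * u.coeff k := fun _ => rfl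
  rw [← tsum_mul_left, h2]
  simp only [← norm_scaleFactor_mul_sq, ← h3]
  simpa using h

end SobolevSpace

/-! ### Elements of `H^s_p(𝕋²)`, `s ≥ 0`, as square integrable functions -/

theorem continuous_expMode (k : ℤ × ℤ) : Continuous (expMode k) := by
  unfold expMode
  fun_prop

theorem norm_expMode (k : ℤ × ℤ) (p : Torus) : ‖expMode k p‖ = 1 := by
  rw [expMode, norm_mul, fourier_apply, fourier_apply, Circle.norm_coe, Circle.norm_coe, mul_one]

theorem memLp_expMode (k : ℤ × ℤ) : MemLp (expMode k) 2 (volume : Measure Torus) :=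
  MemLp.of_bound (continuous_expMode k).aestronglyMeasurable 1
    (Filter.Eventually.of_forall fun p => (norm_expMode k p).le)

/-- The exponential `e^{i k·x}` as an element of `L²(𝕋²)`. -/
def modeL2 (k : ℤ × ℤ) : Lp ℂ 2 (volume : Measure Torus) := (memLp_expMode k).toLp (expMode k)

/-- For `s ≥ 0`, the function `∑ û(k) e^{i k·x}` represented by `u ∈ H^s_p(𝕋²)`; the series
converges in `L²(𝕋²)`. -/
def SobolevSpace.toL2 {s : ℝ} (u : SobolevSpace s) : Lp ℂ 2 (volume : Measure Torus) :=
  ∑' k, u.coeff k • modeL2 k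

theorem integral_fourier_circ (n : ℤ) :
    ∫ x : Circ, fourier n x = if n = 0 then ((2 * Real.pi : ℝ) : ℂ) else 0 := by
  have h := congrFun (fourierCoeff_fourier (T := 2 * Real.pi) n) 0
  rw [fourierCoeff, AddCircle.integral_haarAddCircle] at h
  simp only [neg_zero, fourier_zero, one_smul] at h
  have h2 : ∫ x : Circ, fourier n x = ((2 * Real.pi : ℝ) : ℂ) * Pi.single (M := fun _ => ℂ) n 1 0 := by
    rw [← h, Complex.real_smul, ← mul_assoc, ← Complex.ofReal_mul,
      mul_inv_cancel₀ Real.two_pi_pos.ne', Complex.ofReal_one, one_mul]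
  rw [h2, Pi.single_apply]
  by_cases hn : n = 0
  · simp [hn]
  · simp [hn, Ne.symm hn]

theorem integral_expMode (k : ℤ × ℤ) :
    ∫ p : Torus, expMode k p = if k = 0 then ((2 * Real.pi : ℝ) : ℂ) ^ 2 else 0 := by
  have h : ∫ p : Torus, expMode k p = (∫ x : Circ, fourier k.1 x) * ∫ y : Circ, fourier k.2 y :=
    integral_prod_mul (fun x : Circ => fourier k.1 x) (fun y : Circ => fourier k.2 y)
  rw [h, integral_fourier_circ, integral_fourier_circ]
  by_cases h1 : k.1 = 0 <;> by_cases h2 : k.2 = 0 <;> simp [h1, h2, Prod.ext_iff, sq]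

theorem expMode_neg_mul (j k : ℤ × ℤ) (p : Torus) :
    expMode (-k) p * expMode j p = expMode (j - k) p := by
  rw [sub_eq_add_neg]
  simp only [expMode, Prod.fst_neg, Prod.snd_neg, Prod.fst_add, Prod.snd_add, fourier_add]
  ring

theorem torusCoeff_eq_inner (φ : Lp ℂ 2 (volume : Measure Torus)) (k : ℤ × ℤ) :
    torusCoeff φ k = ((2 * Real.pi : ℝ) ^ 2 : ℂ)⁻¹ * inner ℂ (modeL2 k) φ := by
  rw [torusCoeff, L2.inner_def]
  congr 1
  refine integral_congr_ae ?_
  filter_upwards [(memLp_expMode k).coeFn_toLp] with p hp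
  rw [modeL2, hp, RCLike.inner_apply, mul_comm, expMode, expMode, map_mul, Prod.fst_neg,
    Prod.snd_neg, fourier_neg, fourier_neg]

theorem torusCoeff_modeL2 (j k : ℤ × ℤ) : torusCoeff (modeL2 j) k = if j = k then 1 else 0 := by
  have h : ∫ p : Torus, expMode (-k) p * modeL2 j p = ∫ p : Torus, expMode (j - k) p := by
    refine integral_congr_ae ?_
    filter_upwards [(memLp_expMode j).coeFn_toLp] with p hp
    rw [modeL2, hp, expMode_neg_mul]
  rw [torusCoeff, h, integral_expMode]
  have h0 : ((2 * Real.pi : ℝ) : ℂ) ^ 2 ≠ 0 :=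
    pow_ne_zero 2 (Complex.ofReal_ne_zero.2 Real.two_pi_pos.ne')
  by_cases hjk : j = k
  · rw [if_pos (sub_eq_zero.2 hjk), if_pos hjk, inv_mul_cancel₀ h0]
  · rw [if_neg (fun h => hjk (sub_eq_zero.1 h)), if_neg hjk, mul_zero]

theorem inner_modeL2 (j k : ℤ × ℤ) :
    inner ℂ (modeL2 k) (modeL2 j) = if j = k then ((2 * Real.pi : ℝ) : ℂ) ^ 2 else 0 := by
  have h0 : ((2 * Real.pi : ℝ) : ℂ) ^ 2 ≠ 0 :=
    pow_ne_zero 2 (Complex.ofReal_ne_zero.2 Real.two_pi_pos.ne')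
  have h := torusCoeff_eq_inner (modeL2 j) k
  rw [torusCoeff_modeL2, eq_inv_mul_iff_mul_eq₀ h0] at h
  rw [← h]
  split_ifs <;> simp

theorem orthonormal_modeL2 :
    Orthonormal ℂ fun k : ℤ × ℤ => (((2 * Real.pi : ℝ) : ℂ)⁻¹ • modeL2 k) := by
  have h0 : ((2 * Real.pi : ℝ) : ℂ) ≠ 0 := Complex.ofReal_ne_zero.2 Real.two_pi_pos.ne'
  rw [orthonormal_iff_ite]
  intro i j
  rw [inner_smul_left, inner_smul_right, inner_modeL2, map_inv₀, Complex.conj_ofReal]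
  by_cases h : i = j
  · rw [if_pos h.symm, if_pos h]
    field_simp
  · rw [if_neg (Ne.symm h), if_neg h, mul_zero, mul_zero]

/-- For `s ≥ 0` the series that defines `u.toL2` converges in `L²(𝕋²)`. -/
theorem SobolevSpace.summable_toL2 {s : ℝ} (hs : 0 ≤ s) (u : SobolevSpace s) :
    Summable fun k => u.coeff k • modeL2 k := by
  have h0 : ((2 * Real.pi : ℝ) : ℂ) ≠ 0 := Complex.ofReal_ne_zero.2 Real.two_pi_pos.ne'
  have h1 : Summable fun k => ‖u.coeff k‖ ^ 2 := by
    refine Summable.of_nonneg_of_le (fun k => sq_nonneg _) (fun k => ?_) u.summable_coeff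
    exact le_mul_of_one_le_left (sq_nonneg _)
      (Real.one_le_rpow (by linarith [freqNorm_nonneg k]) (by linarith))
  have h2 : Summable fun k => ‖((2 * Real.pi : ℝ) : ℂ) * u.coeff k‖ ^ 2 := by
    simp only [norm_mul, mul_pow]
    exact h1.mul_left _
  have h3 := (orthonormal_modeL2.orthogonalFamily.summable_iff_norm_sq_summable
    (fun k => ((2 * Real.pi : ℝ) : ℂ) * u.coeff k)).2 h2
  convert h3 using 1
  funext k
  rw [LinearIsometry.toSpanSingleton_apply, smul_smul, mul_right_comm, mul_inv_cancel₀ h0, one_mul]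

/-- For `s ≥ 0` the function `u.toL2` has the Fourier coefficients of `u`. -/
theorem SobolevSpace.torusCoeff_toL2 {s : ℝ} (hs : 0 ≤ s) (u : SobolevSpace s) (k : ℤ × ℤ) :
    torusCoeff u.toL2 k = u.coeff k := by
  have h0 : ((2 * Real.pi : ℝ) : ℂ) ^ 2 ≠ 0 :=
    pow_ne_zero 2 (Complex.ofReal_ne_zero.2 Real.two_pi_pos.ne')
  have h := ((u.summable_toL2 hs).hasSum.mapL (innerSL ℂ (modeL2 k))).tsum_eq
  rw [torusCoeff_eq_inner, inv_mul_eq_iff_eq_mul₀ h0]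
  change innerSL ℂ (modeL2 k) (∑' j, u.coeff j • modeL2 j) = _
  rw [← h, tsum_eq_single k]
  · rw [innerSL_apply_apply, inner_smul_right, inner_modeL2, if_pos rfl, mul_comm]
  · intro j hj
    rw [innerSL_apply_apply, inner_smul_right, inner_modeL2, if_neg hj, mul_zero]

/-! ### The control operator -/

/-- `g` is a non-negative smooth function on the circle with integral `1` which is positive exactly
on an open interval, that is, on a connected open subset of the circle. -/
structure IsBump (g : Circ → ℝ) : Prop where
  smooth : ContDiff ℝ ∞ fun x : ℝ => g (x : Circ)
  nonneg : ∀ x, 0 ≤ g x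
  integral_eq_one : ∫ x, g x = 1
  arc : IsConnected {x | 0 < g x}

/-- `G₁φ (x, y) = (2π)⁻¹ φ(x, y) - (2π)⁻² ∫ φ(x', y) dx'`. -/
def opG₁ (φ : Torus → ℂ) (p : Torus) : ℂ :=
  (1 / (2 * Real.pi : ℝ) : ℂ) * φ p - (1 / (2 * Real.pi : ℝ) ^ 2 : ℂ) * ∫ x' : Circ, φ (x', p.2)

/-- `G₂φ (x, y) = (2π)⁻¹ φ(x, y) - (2π)⁻² ∫ φ(x, y') dy'`. -/
def opG₂ (φ : Torus → ℂ) (p : Torus) : ℂ :=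
  (1 / (2 * Real.pi : ℝ) : ℂ) * φ p - (1 / (2 * Real.pi : ℝ) ^ 2 : ℂ) * ∫ y' : Circ, φ (p.1, y')

/-- `Gφ (x, y) = g₂(y) G₁φ (x, y) + g₁(x) G₂φ (x, y)`. -/
def opG (g₁ g₂ : Circ → ℝ) (φ : Torus → ℂ) (p : Torus) : ℂ :=
  (g₂ p.2 : ℂ) * opG₁ φ p + (g₁ p.1 : ℂ) * opG₂ φ p

/-! ### The dispersive operator and its eigenvalues -/

/-- `b` is the symbol of a Fourier multiplier `𝓛` of order `r - 1`. -/
def IsSymbolOfOrder (b : ℤ × ℤ → ℝ) (r : ℝ) : Prop :=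
  ∃ C > 0, ∃ N₀ ≥ 0, ∀ k, N₀ ≤ freqNorm k → |b k| ≤ C * freqNorm k ^ (r - 1)

/-- `λ_k = k₁ b(k)`: the operator `∂ₓ𝓛`, with `∂ₓ` of symbol `i k₁` and `𝓛` of symbol `b`, acts by
`∂ₓ𝓛 e^{i k·x} = i λ_k e^{i k·x}`. -/
def eigenvalue (b : ℤ × ℤ → ℝ) (k : ℤ × ℤ) : ℝ := k.1 * b k

/-- The symmetry and uniqueness hypothesis on the eigenvalues. -/
structure EvenOddSpectrum (b : ℤ × ℤ → ℝ) : Prop where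
  even_fst : ∀ k₁ k₂ : ℤ, eigenvalue b (k₁, k₂) = eigenvalue b (-k₁, k₂)
  odd_snd : ∀ k₁ k₂ : ℤ, eigenvalue b (k₁, -k₂) = -eigenvalue b (k₁, k₂)
  unique_snd : ∀ k₁ k₂ : ℤ, k₁ ≠ 0 →
    ∀ j₂ : ℤ, eigenvalue b (k₁, j₂) = eigenvalue b (k₁, k₂) ↔ j₂ = k₂
  unique_fst : ∀ k₁ k₂ : ℤ, k₂ ≠ 0 →
    ∀ j₁ : ℤ, eigenvalue b (j₁, k₂) = eigenvalue b (k₁, k₂) ↔ j₁ = k₁ ∨ j₁ = -k₁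

/-- `J` is a maximal set of frequencies with pairwise distinct eigenvalues. -/
def IsDistinctIndexSet (b : ℤ × ℤ → ℝ) (J : Set (ℤ × ℤ)) : Prop :=
  Maximal (fun A : Set (ℤ × ℤ) => InjOn (eigenvalue b) A) J

/-- `inf { |λ_k - λ_k'| : k, k' ∈ A, k ≠ k' }`, in `[0, ∞]`. -/
def spectralGap (b : ℤ × ℤ → ℝ) (A : Set (ℤ × ℤ)) : ℝ≥0∞ :=
  ⨅ k ∈ A, ⨅ k' ∈ A, ⨅ _ : k ≠ k', ENNReal.ofReal |eigenvalue b k - eigenvalue b k'|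

/-- The asymptotic gap: the supremum, in `[0, ∞]`, over the finite `S ⊆ J` of the gap
of `J \ S`. -/
def asymptoticGap (b : ℤ × ℤ → ℝ) (J : Set (ℤ × ℤ)) : ℝ≥0∞ :=
  ⨆ S : Set (ℤ × ℤ), ⨆ _ : S ⊆ J, ⨆ _ : S.Finite, spectralGap b (J \ S)

/-! ### The control system -/

/-- `u ∈ C([0,T]; H^s)` solves `∂ₜu = ∂ₓ𝓛u + G(h)` in `H^{s-r}` on `(0,T)`, `u(0) = u₀`.
As `h` is only square integrable in time, the equation is understood in the usual sense: the
right-hand side `F(t) = ∂ₓ𝓛u(t) + G(h)(t)` lies in `H^{s-r}` for almost every `t`, is (Bochner)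
integrable in time with values in `H^{s-r}`, and `u(t) = u₀ + ∫₀ᵗ F(τ) dτ` in `H^{s-r}`. The
elements of `H^s` and `H^{s-r}` are compared as distributions, that is, by their Fourier
coefficients. -/
structure IsSolution (b : ℤ × ℤ → ℝ) (r : ℝ) (g₁ g₂ : Circ → ℝ) {s : ℝ} (T : ℝ)
    (h : ℝ → SobolevSpace s) (u₀ : SobolevSpace s) (u : ℝ → SobolevSpace s) : Prop where
  continuousOn : ContinuousOn u (Icc 0 T)
  initial : u 0 = u₀
  equation : ∃ F : ℝ → SobolevSpace (s - r),
    (∀ᵐ t, t ∈ Ioo 0 T → ∀ k, (F t).coeff k =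
      Complex.I * (eigenvalue b k : ℂ) * (u t).coeff k + torusCoeff (opG g₁ g₂ (h t).toL2) k) ∧
    IntervalIntegrable F volume 0 T ∧
    ∀ t ∈ Icc 0 T, ∀ k, (u t).coeff k = u₀.coeff k + (∫ τ in (0 : ℝ)..t, F τ).coeff k

end TorusControl

end

/-! The method of moments. In Fourier variables Duhamel's formula reads `û(k)(T) = e^{iλ_k T} (û₀(k)
+ ∫₀ᵀ e^{-iλ_k τ} (G h(τ))^(k) dτ)`, so `u(T) = u₁` means that for every `k` the moment of `G(h)`
against `e^{-iλ_k τ}` equals `d(k)`, where `d = e^{-T∂ₓ𝓛} u₁ - u₀`.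

The control is sought in the form `ĥ(k)(τ) = ψ(k) q_{λ_k}(τ)`, where `(q_λ)` is bounded in `L²(0,T)`
and biorthogonal to the exponentials `e^{iλt}`, with `λ` running over the distinct eigenvalues.
Integrating `h` against `e^{-iλ_k τ}` leaves exactly the part of `ψ` on the eigenspace of `λ_k`, and
`G`, being bounded on `H^s`, commutes with this integral. What remains is to invert `G` compressed
to each eigenspace, with a bound independent of the eigenspace.

The biorthogonal family comes from Ingham's lower bound for exponential sums
(`inghamBelow_of_hasGap`). Haraux's averaging argument (`InghamBelow.insert_point`) adds finitely
many exponents at the cost of an arbitrarily small time. Hence only the asymptotic gap enters the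
condition on `T`, while the plain gap need only be positive. The lower bound keeps each exponential
at a fixed distance from the closed span of the others, and projection gives `q_λ`
(`InghamBelow.exists_biorthogonal`).

The compression of `G` is almost diagonal (`torusCoeff_opG_eigenspace`). The `g₂` term couples
frequencies in one column `k₁ ≠ 0`, where an eigenvalue occurs once; the `g₁` term couples
frequencies in one row `k₂ ≠ 0`, where it occurs only at `±k₁`. So even the infinite-dimensional
kernel splits into blocks of size at most two. Since `|ĝ₁| ≤ ĝ₁(0)`, the 2×2 determinants are
bounded below (`exists_control_profile`). The frequency `(0,0)` is not controlled, which is why the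
means of `u₀` and `u₁` must agree. -/

namespace TorusControl

/-! ### A window function with nearly optimal Poincaré constant -/

/-- A smooth approximation of the positive part: it vanishes below `ε` and has slope in `[0, 1]`. -/
noncomputable def softPos (ε c : ℝ) : ℝ := ∫ x in (0 : ℝ)..c, Real.smoothTransition (x / ε - 1)

theorem hasDerivAt_softPos (ε c : ℝ) :
    HasDerivAt (softPos ε) (Real.smoothTransition (c / ε - 1)) c := by
  have h : Continuous fun x : ℝ => Real.smoothTransition (x / ε - 1) :=
    Real.smoothTransition.continuous.comp (by fun_prop)
  exact intervalIntegral.integral_hasDerivAt_right (h.intervalIntegrable _ _)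
    (h.stronglyMeasurableAtFilter _ _) h.continuousAt

theorem contDiff_softPos (ε : ℝ) : ContDiff ℝ ∞ (softPos ε) := by
  rw [contDiff_infty_iff_deriv]
  refine ⟨fun c => (hasDerivAt_softPos ε c).differentiableAt, ?_⟩
  have h : deriv (softPos ε) = fun c => Real.smoothTransition (c / ε - 1) :=
    funext fun c => (hasDerivAt_softPos ε c).deriv
  rw [h]
  exact Real.smoothTransition.contDiff.comp (by fun_prop)

theorem softPos_of_nonpos {ε c : ℝ} (hε : 0 < ε) (hc : c ≤ ε) : softPos ε c = 0 := by
  rw [softPos, intervalIntegral.integral_zero_ae]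
  refine Filter.Eventually.of_forall fun x hx => Real.smoothTransition.zero_of_nonpos ?_
  have h : x ≤ ε := by
    rcases mem_uIoc.1 hx with h | h <;> linarith [h.1, h.2]
  rw [sub_nonpos, div_le_one hε]
  exact h

theorem softPos_mono (ε : ℝ) : Monotone (softPos ε) :=
  monotone_of_deriv_nonneg (contDiff_softPos ε |>.differentiable (by simp)) fun c => by
    rw [(hasDerivAt_softPos ε c).deriv]
    exact Real.smoothTransition.nonneg _

/-- Beyond `2ε` the slope is exactly one, so the difference with the identity no longer changes;
before that point nonnegativity suffices. -/
theorem sub_le_softPos {ε c : ℝ} (hε : 0 < ε) : c - 2 * ε ≤ softPos ε c := by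
  rcases le_total c (2 * ε) with h | h
  · have := softPos_mono ε (min_le_left c 0)
    rw [softPos_of_nonpos hε ((min_le_right c 0).trans hε.le)] at this
    linarith
  · have hm : MonotoneOn (fun x => softPos ε x - x) (Ici (2 * ε)) := by
      refine monotoneOn_of_deriv_nonneg (convex_Ici _) ?_ ?_ fun x hx => ?_
      · exact ((contDiff_softPos ε).continuous.sub continuous_id).continuousOn
      · exact fun x _ => ((hasDerivAt_softPos ε x).sub (hasDerivAt_id x)).differentiableAt
          |>.differentiableWithinAt
      · rw [interior_Ici] at hx
        have := ((hasDerivAt_softPos ε x).sub (hasDerivAt_id x)).deriv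
        change 0 ≤ deriv (softPos ε - id) x
        rw [this, Real.smoothTransition.one_of_one_le, sub_self]
        rw [le_sub_iff_add_le, le_div_iff₀ hε]
        have := mem_Ioi.1 hx
        linarith
    have h1 := hm (mem_Ici.2 le_rfl) (mem_Ici.2 h) h
    have h2 := softPos_mono ε (show (0 : ℝ) ≤ 2 * ε by linarith)
    rw [softPos_of_nonpos hε hε.le] at h2
    simp only at h1
    linarith

theorem integral_cos_sq_half {γ : ℝ} (hγ : 0 < γ) :
    ∫ x in (-(γ / 2))..(γ / 2), Real.cos (Real.pi / γ * x) ^ 2 = γ / 2 := by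
  have hp := Real.pi_pos
  rw [intervalIntegral.integral_comp_mul_left (fun x => Real.cos x ^ 2) (by positivity),
    integral_cos_sq]
  have h1 : Real.pi / γ * (γ / 2) = Real.pi / 2 := by field_simp
  have h2 : Real.pi / γ * (-(γ / 2)) = -(Real.pi / 2) := by field_simp
  rw [h1, h2]
  simp
  field_simp

theorem integral_sin_sq_half {γ : ℝ} (hγ : 0 < γ) :
    ∫ x in (-(γ / 2))..(γ / 2), Real.sin (Real.pi / γ * x) ^ 2 = γ / 2 := by
  have hp := Real.pi_pos
  rw [intervalIntegral.integral_comp_mul_left (fun x => Real.sin x ^ 2) (by positivity),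
    integral_sin_sq]
  have h1 : Real.pi / γ * (γ / 2) = Real.pi / 2 := by field_simp
  have h2 : Real.pi / γ * (-(γ / 2)) = -(Real.pi / 2) := by field_simp
  rw [h1, h2]
  simp
  field_simp

theorem cos_nonpos_of_half_le {γ x : ℝ} (hγ : 0 < γ) (h1 : γ / 2 ≤ |x|) (h2 : |x| ≤ γ) :
    Real.cos (Real.pi / γ * x) ≤ 0 := by
  have hp := Real.pi_pos
  rw [← Real.cos_abs, abs_mul, abs_of_pos (by positivity : 0 < Real.pi / γ)]
  refine Real.cos_nonpos_of_pi_div_two_le_of_le ?_ ?_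
  · calc Real.pi / 2 = Real.pi / γ * (γ / 2) := by field_simp
      _ ≤ _ := by gcongr
  · calc Real.pi / γ * |x| ≤ Real.pi / γ * γ := by gcongr
      _ = Real.pi := by field_simp
      _ ≤ _ := by linarith

/-- The first Dirichlet eigenfunction `cos(πx/γ)` of `[-γ/2, γ/2]` has Rayleigh quotient `(π/γ)²`,
but its extension by zero is not smooth. Composing it with `softPos ε` makes it vanish near the
endpoints, does not increase the derivative, and costs at most `4ε` pointwise in the square. The
sharp constant `π/γ` is what produces the threshold `2π/γ` for the time. -/
theorem exists_window {γ R : ℝ} (hγ : 0 < γ) (hR : Real.pi / γ < R) :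
    ∃ H : ℝ → ℂ, ContDiff ℝ ∞ H ∧ (∀ x, γ / 2 ≤ |x| → H x = 0) ∧
      (∀ x, γ / 2 ≤ |x| → deriv H x = 0) ∧
      ∫ x, ‖deriv H x‖ ^ 2 < R ^ 2 * ∫ x, ‖H x‖ ^ 2 := by
  have hp := Real.pi_pos
  have hpγ : 0 < Real.pi / γ := by positivity
  have hR2 : (Real.pi / γ) ^ 2 < R ^ 2 := by gcongr
  obtain ⟨ε, hε, hεR⟩ : ∃ ε : ℝ, 0 < ε ∧ (Real.pi / γ) ^ 2 * (γ / 2) < R ^ 2 * (γ / 2 - 4 * ε * γ) := by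
    have hRp : 0 < R ^ 2 := (sq_nonneg _).trans_lt hR2
    have hR0 : R ≠ 0 := fun h => by simp [h] at hRp
    -- With this `ε` the loss `4εγR²` is a quarter of `(R² - (π/γ)²)γ`, while the available margin
    -- is half of it.
    refine ⟨(1 / 16) * (R ^ 2 - (Real.pi / γ) ^ 2) / R ^ 2, by
      apply div_pos _ hRp; linarith, ?_⟩
    have : R ^ 2 * (γ / 2 - 4 * ((1 / 16) * (R ^ 2 - (Real.pi / γ) ^ 2) / R ^ 2) * γ)
        = R ^ 2 * (γ / 2) - (1 / 4) * (R ^ 2 - (Real.pi / γ) ^ 2) * γ := by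
      field_simp
      ring
    rw [this]
    nlinarith
  -- The cutoff equals one on the window and removes the other positive arches of the cosine; on
  -- `γ/2 ≤ |x| ≤ γ`, where it varies, the cosine is nonpositive and `F` already vanishes.
  let B : ContDiffBump (0 : ℝ) := ⟨γ / 2, γ, by positivity, by linarith⟩
  let F : ℝ → ℝ := fun x => softPos ε (Real.cos (Real.pi / γ * x))
  have hFc : ContDiff ℝ ∞ F := (contDiff_softPos ε).comp (by fun_prop)
  have hFd : ∀ x, HasDerivAt F (Real.smoothTransition (Real.cos (Real.pi / γ * x) / ε - 1) *
      (-Real.sin (Real.pi / γ * x) * (Real.pi / γ))) x := by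
    intro x
    have h1 : HasDerivAt (fun x : ℝ => Real.cos (Real.pi / γ * x))
        (-Real.sin (Real.pi / γ * x) * (Real.pi / γ)) x := by
      simpa using ((hasDerivAt_id x).const_mul (Real.pi / γ)).cos
    exact (hasDerivAt_softPos ε _).comp x h1
  let K : ℝ → ℝ := fun x => B x * F x
  have hKc : ContDiff ℝ ∞ K := B.contDiff.mul hFc
  have hK0 : ∀ x, γ / 2 ≤ |x| → K =ᶠ[nhds x] 0 := by
    intro x hx
    rcases le_or_gt |x| γ with h | h
    · have hc : Real.cos (Real.pi / γ * x) < ε := (cos_nonpos_of_half_le hγ hx h).trans_lt hε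
      have : ∀ᶠ y in nhds x, Real.cos (Real.pi / γ * y) < ε :=
        (show Continuous fun y : ℝ => Real.cos (Real.pi / γ * y) by fun_prop).continuousAt.eventually
          (Iio_mem_nhds hc)
      filter_upwards [this] with y hy
      simp [K, F, softPos_of_nonpos hε hy.le]
    · have : ∀ᶠ y in nhds x, γ < |y| := continuous_abs.continuousAt.eventually (Ioi_mem_nhds h)
      filter_upwards [this] with y hy
      have : B y = 0 := B.zero_of_le_dist (by simpa [B] using hy.le)
      simp [K, this]
  have hK1 : ∀ x, |x| < γ / 2 → K =ᶠ[nhds x] F := by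
    intro x hx
    have : ∀ᶠ y in nhds x, |y| < γ / 2 := continuous_abs.continuousAt.eventually (Iio_mem_nhds hx)
    filter_upwards [this] with y hy
    have : B y = 1 := B.one_of_mem_closedBall (by simpa [B] using hy.le)
    simp [K, this]
  have hKd : ∀ x, |deriv K x| ≤ Real.pi / γ * |Real.sin (Real.pi / γ * x)| := by
    intro x
    rcases le_or_gt (γ / 2) |x| with h | h
    · rw [(hK0 x h).deriv_eq]
      simp only [deriv_zero, Pi.zero_apply, abs_zero]
      positivity
    · rw [(hK1 x h).deriv_eq, (hFd x).deriv, abs_mul, abs_mul, abs_neg, abs_of_pos hpγ,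
        abs_of_nonneg (Real.smoothTransition.nonneg _)]
      have := Real.smoothTransition.le_one (Real.cos (Real.pi / γ * x) / ε - 1)
      have h0 : 0 ≤ |Real.sin (Real.pi / γ * x)| * (Real.pi / γ) := by positivity
      nlinarith
  have hKd0 : ∀ x, γ / 2 ≤ |x| → deriv K x = 0 := by
    intro x h
    rw [(hK0 x h).deriv_eq]
    simp
  have hHd : ∀ x, deriv (fun x => (K x : ℂ)) x = ((deriv K x : ℝ) : ℂ) := fun x =>
    (((hKc.differentiable (by simp)) x).hasDerivAt.ofReal_comp).deriv
  have hsub : ∀ f : ℝ → ℝ, (∀ x, γ / 2 ≤ |x| → f x = 0) →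
      ∫ x, f x = ∫ x in (-(γ / 2))..(γ / 2), f x := by
    intro f hf
    rw [intervalIntegral.integral_of_le (by linarith), setIntegral_eq_integral_of_forall_compl_eq_zero]
    intro x hx
    apply hf
    by_contra hlt
    have := abs_lt.1 (not_le.1 hlt)
    exact hx ⟨this.1, this.2.le⟩
  refine ⟨fun x => (K x : ℂ), Complex.ofRealCLM.contDiff.comp hKc, fun x hx => ?_, fun x hx => ?_, ?_⟩
  · simpa using (hK0 x hx).eq_of_nhds
  · rw [hHd, hKd0 x hx, Complex.ofReal_zero]
  · simp only [hHd, Complex.norm_real, Real.norm_eq_abs, sq_abs]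
    rw [hsub (fun x => deriv K x ^ 2) (fun x hx => by simp [hKd0 x hx]),
      hsub (fun x => K x ^ 2) (fun x hx => by simp [(hK0 x hx).eq_of_nhds])]
    have hcd : Continuous (deriv K) := hKc.continuous_deriv (by simp)
    have hle : -(γ / 2) ≤ γ / 2 := by linarith
    have h1 : ∫ x in (-(γ / 2))..(γ / 2), deriv K x ^ 2 ≤ (Real.pi / γ) ^ 2 * (γ / 2) := by
      have hs := integral_sin_sq_half hγ
      rw [← mul_right_inj' (pow_ne_zero 2 hpγ.ne'), ← intervalIntegral.integral_const_mul] at hs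
      rw [← hs]
      refine intervalIntegral.integral_mono_on hle ((hcd.pow 2).intervalIntegrable (μ := volume) _ _)
        ((show Continuous fun x : ℝ => (Real.pi / γ) ^ 2 * Real.sin (Real.pi / γ * x) ^ 2 by
          fun_prop).intervalIntegrable _ _) fun x _ => ?_
      rw [← sq_abs, ← sq_abs (Real.sin _), ← mul_pow]
      gcongr
      exact hKd x
    have h2 : γ / 2 - 4 * ε * γ ≤ ∫ x in (-(γ / 2))..(γ / 2), K x ^ 2 := by
      have h3 : γ / 2 - 4 * ε * γ
          = ∫ x in (-(γ / 2))..(γ / 2), (Real.cos (Real.pi / γ * x) ^ 2 - 4 * ε) := by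
        have hi : Continuous fun x : ℝ => Real.cos (Real.pi / γ * x) ^ 2 := by fun_prop
        rw [intervalIntegral.integral_sub (hi.intervalIntegrable _ _) (by simp),
          integral_cos_sq_half hγ, intervalIntegral.integral_const, smul_eq_mul]
        ring
      rw [h3]
      refine intervalIntegral.integral_mono_on hle
        ((show Continuous fun x : ℝ => Real.cos (Real.pi / γ * x) ^ 2 - 4 * ε by
          fun_prop).intervalIntegrable _ _)
        ((hKc.continuous.pow 2).intervalIntegrable _ _) fun x hx => ?_
      have hx' : |x| ≤ γ / 2 := abs_le.2 hx
      have hB : B x = 1 := B.one_of_mem_closedBall (by simpa [B] using hx')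
      have hKx : K x = F x := by simp [K, hB]
      rw [hKx]
      have hF0 : Real.cos (Real.pi / γ * x) - 2 * ε ≤ F x := sub_le_softPos hε
      have hc := Real.cos_le_one (Real.pi / γ * x)
      rcases le_total (2 * ε) (Real.cos (Real.pi / γ * x)) with h | h
      · nlinarith
      · have hc0 : 0 ≤ Real.cos (Real.pi / γ * x) := by
          refine Real.cos_nonneg_of_mem_Icc ?_
          have e : Real.pi / γ * (γ / 2) = Real.pi / 2 := by field_simp
          constructor
          · rw [← e]; nlinarith [hx.1]
          · rw [← e]; nlinarith [hx.2]
        nlinarith [sq_nonneg (F x)]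
    nlinarith [sq_nonneg R]

/-! ### Ingham's inequalities -/

/-- The finite exponential sum `∑_{λ ∈ s} a_λ e^{iλt}`. -/
noncomputable def trigSum (s : Finset ℝ) (a : ℝ → ℂ) (t : ℝ) : ℂ :=
  ∑ l ∈ s, a l * Complex.exp (Complex.I * l * t)

theorem continuous_trigSum (s : Finset ℝ) (a : ℝ → ℂ) : Continuous (trigSum s a) := by
  unfold trigSum
  fun_prop

/-- Distinct points of `A` are at distance at least `γ`. -/
def HasGap (A : Set ℝ) (γ : ℝ) : Prop := ∀ l ∈ A, ∀ m ∈ A, l ≠ m → γ ≤ |l - m|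

theorem HasGap.mono {A B : Set ℝ} {γ δ : ℝ} (h : HasGap B γ) (hAB : A ⊆ B) (hδ : δ ≤ γ) :
    HasGap A δ := fun l hl m hm hne => hδ.trans (h l (hAB hl) m (hAB hm) hne)

theorem hasCompactSupport_of_window {E : Type*} [Zero E] {f : ℝ → E} {γ : ℝ} (hf0 : ∀ x, γ / 2 ≤ |x| → f x = 0) :
    HasCompactSupport f := by
  refine HasCompactSupport.intro (isCompact_Icc (a := -(γ / 2)) (b := γ / 2)) fun x hx => hf0 x ?_
  by_contra h
  exact hx (abs_le.1 (not_le.1 h).le)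

/-- The translates live on open intervals of length `γ` whose centres are at least `γ` apart, so at
most one term is nonzero at each point and the cross terms disappear. -/
theorem norm_sq_sum_translates {f : ℝ → ℂ} {γ : ℝ} (hf0 : ∀ x, γ / 2 ≤ |x| → f x = 0)
    {s : Finset ℝ} (hs : HasGap s γ) (a : ℝ → ℂ) (x : ℝ) :
    ‖∑ l ∈ s, a l * f (x - l)‖ ^ 2 = ∑ l ∈ s, ‖a l‖ ^ 2 * ‖f (x - l)‖ ^ 2 := by
  by_cases h : ∃ l ∈ s, f (x - l) ≠ 0
  · obtain ⟨l, hl, hne⟩ := h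
    have hz : ∀ m ∈ s, m ≠ l → f (x - m) = 0 := by
      intro m hm hml
      apply hf0
      have h1 : |x - l| < γ / 2 := by
        by_contra h
        exact hne (hf0 _ (not_lt.1 h))
      have h2 := hs m hm l hl hml
      have h3 : |m - l| ≤ |x - l| + |x - m| := by
        have := abs_sub (x - l) (x - m)
        rwa [show x - l - (x - m) = m - l by ring] at this
      linarith
    rw [Finset.sum_eq_single_of_mem l hl fun m hm hml => by rw [hz m hm hml, mul_zero],
      Finset.sum_eq_single_of_mem l hl fun m hm hml => by simp [hz m hm hml], norm_mul, mul_pow]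
  · push Not at h
    rw [Finset.sum_eq_zero fun l hl => by rw [h l hl, mul_zero],
      Finset.sum_eq_zero fun l hl => by simp [h l hl]]
    simp

open FourierTransform in
-- Translation becomes modulation: `𝓕 f` times the exponential sum is the transform of `∑ a_l f(x -
-- l)`. Plancherel and the disjointness of the translates then give an exact identity for the
-- weighted norm.
theorem fourier_mul_trigSum {f : ℝ → ℂ} (hf : ContDiff ℝ ∞ f) {γ : ℝ}
    (hf0 : ∀ x, γ / 2 ≤ |x| → f x = 0) {s : Finset ℝ} (hs : HasGap s γ) (a : ℝ → ℂ) :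
    Integrable (fun t => ‖𝓕 f t‖ ^ 2 * ‖trigSum s a (-(2 * Real.pi * t))‖ ^ 2) ∧
      ∫ t, ‖𝓕 f t‖ ^ 2 * ‖trigSum s a (-(2 * Real.pi * t))‖ ^ 2
        = (∑ l ∈ s, ‖a l‖ ^ 2) * ∫ x, ‖f x‖ ^ 2 := by
  have hfc := hasCompactSupport_of_window hf0
  have hfi : Integrable f := hf.continuous.integrable_of_hasCompactSupport hfc
  let Φ : ℝ → ℂ := fun x => ∑ l ∈ s, a l * f (x - l)
  have hΦ : ContDiff ℝ ∞ Φ := by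
    refine ContDiff.sum fun l _ => contDiff_const.mul (hf.comp (contDiff_id.sub contDiff_const))
  have hΦc : HasCompactSupport Φ := by
    obtain ⟨M, hM⟩ : ∃ M, ∀ l ∈ s, |l| ≤ M := by
      refine ⟨∑ l ∈ s, |l|, fun l hl => ?_⟩
      exact Finset.single_le_sum (f := fun l => |l|) (fun l _ => abs_nonneg l) hl
    refine hasCompactSupport_of_window (γ := γ + 2 * M) fun x hx => ?_
    refine Finset.sum_eq_zero fun l hl => ?_
    rw [hf0, mul_zero]
    have := abs_sub_abs_le_abs_sub x l
    have := hM l hl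
    linarith
  let S : SchwartzMap ℝ ℂ := hΦc.toSchwartzMap hΦ
  have hSΦ : (S : ℝ → ℂ) = Φ := rfl
  have hF : ∀ t, (𝓕 S) t = trigSum s a (-(2 * Real.pi * t)) * 𝓕 f t := by
    intro t
    rw [SchwartzMap.fourier_coe, hSΦ, Real.fourier_real_eq_integral_exp_smul,
      Real.fourier_real_eq_integral_exp_smul]
    simp only [Φ, trigSum, smul_eq_mul, Finset.mul_sum, Finset.sum_mul]
    have hint : ∀ l : ℝ, Integrable fun x : ℝ =>
        Complex.exp (↑(-2 * Real.pi * x * t) * Complex.I) * (a l * f (x - l)) := by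
      intro l
      refine ((hfi.comp_sub_right l).const_mul (a l)).bdd_mul (c := 1)
        (by fun_prop) (Filter.Eventually.of_forall fun x => ?_)
      rw [Complex.norm_exp_ofReal_mul_I]
    rw [integral_finsetSum _ fun l _ => hint l]
    refine Finset.sum_congr rfl fun l _ => ?_
    rw [← integral_add_right_eq_self _ l, ← integral_const_mul]
    refine integral_congr_ae (Filter.Eventually.of_forall fun x => ?_)
    simp only [add_sub_cancel_right]
    have : Complex.exp (↑(-2 * Real.pi * (x + l) * t) * Complex.I)
        = Complex.exp (Complex.I * l * ↑(-(2 * Real.pi * t))) *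
          Complex.exp (↑(-2 * Real.pi * x * t) * Complex.I) := by
      rw [← Complex.exp_add]
      congr 1
      push_cast
      ring
    rw [this]
    ring
  have hSq : ∀ t, ‖𝓕 f t‖ ^ 2 * ‖trigSum s a (-(2 * Real.pi * t))‖ ^ 2 = ‖(𝓕 S) t‖ ^ 2 := by
    intro t
    rw [hF, norm_mul, mul_pow, mul_comm]
  simp only [hSq]
  constructor
  · have := (𝓕 S).memLp 2 volume
    exact this.integrable_norm_pow (by norm_num)
  · rw [SchwartzMap.integral_norm_sq_fourier, Finset.sum_mul]
    change ∫ x, ‖Φ x‖ ^ 2 = _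
    simp only [Φ, norm_sq_sum_translates hf0 hs]
    have hfi2 : Integrable fun x => ‖f x‖ ^ 2 :=
      (hf.continuous.norm.pow 2).integrable_of_hasCompactSupport
        (hasCompactSupport_of_window (γ := γ) fun x hx => by simp [hf0 x hx])
    rw [integral_finsetSum _ fun l _ => (hfi2.comp_sub_right l).const_mul _]
    refine Finset.sum_congr rfl fun l _ => ?_
    rw [integral_const_mul, integral_sub_right_eq_self (fun x => ‖f x‖ ^ 2)]

/-- Exponential sums over `A` are bounded below in `L²(0, T)` by the `ℓ²` norm of their
coefficients. -/
def InghamBelow (A : Set ℝ) (T : ℝ) : Prop :=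
  ∃ c > 0, ∀ s : Finset ℝ, ↑s ⊆ A → ∀ a : ℝ → ℂ,
    c * ∑ l ∈ s, ‖a l‖ ^ 2 ≤ ∫ t in (0 : ℝ)..T, ‖trigSum s a t‖ ^ 2

/-- Exponential sums over `A` are bounded above in `L²(0, T)` by the `ℓ²` norm of their
coefficients. -/
def InghamAbove (A : Set ℝ) (T : ℝ) : Prop :=
  ∃ C > 0, ∀ s : Finset ℝ, ↑s ⊆ A → ∀ a : ℝ → ℂ,
    ∫ t in (0 : ℝ)..T, ‖trigSum s a t‖ ^ 2 ≤ C * ∑ l ∈ s, ‖a l‖ ^ 2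

theorem trigSum_add (s : Finset ℝ) (a : ℝ → ℂ) (t d : ℝ) :
    trigSum s a (t + d) = trigSum s (fun l => a l * Complex.exp (Complex.I * l * d)) t := by
  refine Finset.sum_congr rfl fun l _ => ?_
  dsimp only
  rw [mul_assoc (a l), ← Complex.exp_add]
  congr 2
  push_cast
  ring

theorem norm_mul_exp (l d : ℝ) (z : ℂ) : ‖z * Complex.exp (Complex.I * l * d)‖ = ‖z‖ := by
  rw [norm_mul, show Complex.I * l * d = ((l * d : ℝ) : ℂ) * Complex.I by push_cast; ring,
    Complex.norm_exp_ofReal_mul_I, mul_one]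

theorem integral_trigSum_window (s : Finset ℝ) (a : ℝ → ℂ) (T : ℝ) :
    ∫ t in (0 : ℝ)..T, ‖trigSum s a t‖ ^ 2 = 2 * Real.pi *
      ∫ t in (-(T / (4 * Real.pi)))..(T / (4 * Real.pi)), ‖trigSum s
        (fun l => a l * Complex.exp (Complex.I * l * ↑(T / 2))) (-(2 * Real.pi * t))‖ ^ 2 := by
  have hp := Real.pi_pos
  simp only [← trigSum_add]
  have h := intervalIntegral.integral_comp_sub_mul (fun t => ‖trigSum s a t‖ ^ 2)
    (a := -(T / (4 * Real.pi))) (b := T / (4 * Real.pi)) (c := 2 * Real.pi) (by positivity) (T / 2)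
  have e1 : T / 2 - 2 * Real.pi * (T / (4 * Real.pi)) = 0 := by field_simp; ring
  have e2 : T / 2 - 2 * Real.pi * -(T / (4 * Real.pi)) = T := by field_simp; ring
  rw [e1, e2] at h
  have e3 : ∀ t, -(2 * Real.pi * t) + T / 2 = T / 2 - 2 * Real.pi * t := fun t => by ring
  simp only [e3]
  rw [h, smul_eq_mul]
  field_simp

open FourierTransform in
-- The weight `(ρ² - t²)|𝓕 H(t)|²` is positive only for `|t| < ρ`, so the integral over `[-ρ, ρ]`
-- dominates, up to a constant, the weighted integral over the line. The latter is `D ∑ |a_l|²` by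
-- two applications of Plancherel, to `H` and to `H'`, since `t` times `𝓕 H` is a multiple of `𝓕
-- H'`. Positivity of `D` is exactly the Rayleigh quotient bound of the window with `R = T/2`.
theorem inghamBelow_of_hasGap {A : Set ℝ} {γ T : ℝ} (hγ : 0 < γ) (hA : HasGap A γ)
    (hT : 2 * Real.pi / γ < T) : InghamBelow A T := by
  have hp := Real.pi_pos
  have hT0 : 0 < T := lt_trans (by positivity) hT
  obtain ⟨H, hH, hH0, hH1, hlt⟩ := exists_window (R := T / 2) hγ (by
    rw [lt_div_iff₀ two_pos]; calc _ = 2 * Real.pi / γ := by ring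
      _ < T := hT)
  have hHc := hasCompactSupport_of_window hH0
  have hHi : Integrable H := hH.continuous.integrable_of_hasCompactSupport hHc
  have hH'i : Integrable (deriv H) :=
    (hH.continuous_deriv (by simp)).integrable_of_hasCompactSupport hHc.deriv
  set ρ : ℝ := T / (4 * Real.pi) with hρ
  have hρ0 : 0 < ρ := by positivity
  -- The added one only ensures that `M`, which appears in a denominator, is positive.
  set M : ℝ := (∫ x, ‖H x‖) ^ 2 + 1 with hM
  have hM0 : 0 < M := by positivity
  have hHM : ∀ t, ‖𝓕 H t‖ ^ 2 ≤ M := by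
    intro t
    have : ‖𝓕 H t‖ ≤ ∫ x, ‖H x‖ := by
      rw [Real.fourier_real_eq_integral_exp_smul]
      refine (norm_integral_le_integral_norm _).trans_eq ?_
      simp only [norm_smul, Complex.norm_exp_ofReal_mul_I, one_mul]
    have := pow_le_pow_left₀ (norm_nonneg _) this 2
    linarith
  set D : ℝ := ρ ^ 2 * (∫ x, ‖H x‖ ^ 2) - (2 * Real.pi)⁻¹ ^ 2 * ∫ x, ‖deriv H x‖ ^ 2 with hD
  have hD0 : 0 < D := by
    have : D = (2 * Real.pi)⁻¹ ^ 2 *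
        ((T / 2) ^ 2 * (∫ x, ‖H x‖ ^ 2) - ∫ x, ‖deriv H x‖ ^ 2) := by
      rw [hD, hρ]; field_simp; ring
    rw [this]
    have := sub_pos.2 hlt
    positivity
  refine ⟨2 * Real.pi * (D / (ρ ^ 2 * M)), by positivity, fun s hs a => ?_⟩
  have hsγ : HasGap s γ := hA.mono hs le_rfl
  rw [integral_trigSum_window, mul_assoc]
  refine mul_le_mul_of_nonneg_left ?_ (by positivity)
  set a' : ℝ → ℂ := fun l => a l * Complex.exp (Complex.I * l * ↑(T / 2)) with ha'
  have hnorm : ∑ l ∈ s, ‖a l‖ ^ 2 = ∑ l ∈ s, ‖a' l‖ ^ 2 :=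
    Finset.sum_congr rfl fun l _ => by rw [ha']; simp only [norm_mul_exp]
  rw [hnorm]
  obtain ⟨hi0, he0⟩ := fourier_mul_trigSum hH hH0 hsγ a'
  obtain ⟨hi1, he1⟩ := fourier_mul_trigSum (f := deriv H)
    (contDiff_infty_iff_deriv.1 hH).2 hH1 hsγ a'
  set p : ℝ → ℝ := fun t => ‖trigSum s a' (-(2 * Real.pi * t))‖ ^ 2 with hpdef
  have hd : ∀ t, ‖𝓕 (deriv H) t‖ ^ 2 = (2 * Real.pi) ^ 2 * t ^ 2 * ‖𝓕 H t‖ ^ 2 := by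
    intro t
    rw [Real.fourier_deriv hHi (hH.differentiable (by simp)) hH'i]
    simp only [smul_eq_mul, norm_mul, Complex.norm_I, Complex.norm_real, mul_pow,
      Real.norm_eq_abs, sq_abs, Complex.norm_ofNat]
    ring
  have hsplit : ∀ t, (ρ ^ 2 - t ^ 2) * ‖𝓕 H t‖ ^ 2 * p t = ρ ^ 2 * (‖𝓕 H t‖ ^ 2 * p t)
      - (2 * Real.pi)⁻¹ ^ 2 * (‖𝓕 (deriv H) t‖ ^ 2 * p t) := by
    intro t
    rw [hd]
    field_simp
  have hkey : ∫ t, (ρ ^ 2 - t ^ 2) * ‖𝓕 H t‖ ^ 2 * p t = D * ∑ l ∈ s, ‖a' l‖ ^ 2 := by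
    simp only [hsplit]
    rw [integral_sub (hi0.const_mul _) (hi1.const_mul _), integral_const_mul, integral_const_mul,
      he0, he1, hD]
    ring
  have hpc : Continuous p := by
    have := continuous_trigSum s a'
    fun_prop
  have hle : ∫ t, (ρ ^ 2 - t ^ 2) * ‖𝓕 H t‖ ^ 2 * p t ≤ ρ ^ 2 * M * ∫ t in (-ρ)..ρ, p t := by
    have h1 : ∫ t, (ρ ^ 2 - t ^ 2) * ‖𝓕 H t‖ ^ 2 * p t
        ≤ ∫ t, (Ioc (-ρ) ρ).indicator (fun t => ρ ^ 2 * M * p t) t := by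
      have hl : Integrable fun t => (ρ ^ 2 - t ^ 2) * ‖𝓕 H t‖ ^ 2 * p t := by
        simp only [hsplit]
        exact (hi0.const_mul _).sub (hi1.const_mul _)
      have hr : Integrable ((Ioc (-ρ) ρ).indicator fun t => ρ ^ 2 * M * p t) :=
        ((continuous_const.mul hpc).integrableOn_Icc.mono_set
          Ioc_subset_Icc_self).integrable_indicator measurableSet_Ioc
      refine integral_mono hl hr fun t => ?_
      have hp0 : 0 ≤ p t := sq_nonneg _
      by_cases ht : t ∈ Ioc (-ρ) ρ
      · simp only [indicator_of_mem ht]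
        gcongr
        · nlinarith [sq_nonneg t]
        · exact hHM t
      · simp only [indicator_of_notMem ht]
        have : ρ ^ 2 ≤ t ^ 2 := by
          rw [← sq_abs t]
          gcongr
          by_contra hlt
          have := abs_lt.1 (not_le.1 hlt)
          exact ht ⟨this.1, this.2.le⟩
        have : 0 ≤ ‖𝓕 H t‖ ^ 2 * p t := by positivity
        nlinarith
    rw [integral_indicator measurableSet_Ioc, integral_const_mul,
      ← intervalIntegral.integral_of_le (by linarith)] at h1
    exact h1
  rw [hkey] at hle
  rw [div_mul_eq_mul_div, div_le_iff₀ (by positivity)]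
  linarith

open FourierTransform in
-- For the upper bound a weight bounded below on `[-ρ, ρ]` is enough. A narrow bump of integral one
-- has transform close to one there.
theorem inghamAbove_of_hasGap {A : Set ℝ} {γ T : ℝ} (hγ : 0 < γ) (hA : HasGap A γ)
    (hT0 : 0 < T) : InghamAbove A T := by
  have hp := Real.pi_pos
  -- Lowering the gap to `2/T` makes the bump so narrow that the phase `2π|x||t|` is at most `εT/4 ≤
  -- 1/2` on its support.
  set ε : ℝ := min γ (2 / T) with hε
  have hε0 : 0 < ε := by positivity
  have hεT : ε * T ≤ 2 := by
    rw [← le_div_iff₀ hT0]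
    exact min_le_right _ _
  let B : ContDiffBump (0 : ℝ) := ⟨ε / 4, ε / 2, by positivity, by linarith⟩
  let f : ℝ → ℂ := fun x => (B.normed volume x : ℂ)
  have hf : ContDiff ℝ ∞ f := Complex.ofRealCLM.contDiff.comp B.contDiff_normed
  have hB0 : ∀ x, ε / 2 ≤ |x| → B.normed volume x = 0 := by
    intro x hx
    have : B x = 0 := B.zero_of_le_dist (by simpa [B] using hx)
    simp [ContDiffBump.normed, this]
  have hf0 : ∀ x, ε / 2 ≤ |x| → f x = 0 := fun x hx => by simp [f, hB0 x hx]
  have hBi : Integrable (B.normed volume) := B.integrable_normed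
  have hfi : Integrable f := hBi.ofReal
  set ρ : ℝ := T / (4 * Real.pi) with hρ
  have hρ0 : 0 < ρ := by positivity
  have hlow : ∀ t, |t| ≤ ρ → 1 / 4 ≤ ‖𝓕 f t‖ ^ 2 := by
    intro t ht
    have h1 : ‖𝓕 f t - 1‖ ≤ 1 / 2 := by
      have e1 : (1 : ℂ) = ∫ x, f x := by
        simp only [f]
        rw [integral_complex_ofReal, B.integral_normed, Complex.ofReal_one]
      have hi : Integrable fun x : ℝ => Complex.exp (↑(-2 * Real.pi * x * t) * Complex.I) * f x := by
        refine hfi.bdd_mul (c := 1) (by fun_prop) (Filter.Eventually.of_forall fun x => ?_)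
        rw [Complex.norm_exp_ofReal_mul_I]
      rw [Real.fourier_real_eq_integral_exp_smul, e1]
      simp only [smul_eq_mul]
      rw [← integral_sub hi hfi]
      have e2 : (1 / 2 : ℝ) = ∫ x, 1 / 2 * B.normed volume x := by
        rw [integral_const_mul, B.integral_normed, mul_one]
      rw [e2]
      refine norm_integral_le_of_norm_le (hBi.const_mul _) (Filter.Eventually.of_forall fun x => ?_)
      rw [← sub_one_mul, norm_mul]
      have hfx : ‖f x‖ = B.normed volume x := by
        rw [Complex.norm_real, Real.norm_eq_abs, abs_of_nonneg (B.nonneg_normed x)]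
      rw [hfx]
      rcases le_or_gt (ε / 2) |x| with hx | hx
      · rw [hB0 x hx]
        simp
      · refine mul_le_mul_of_nonneg_right ?_ (B.nonneg_normed x)
        rw [mul_comm (Complex.ofReal _)]
        refine (Real.norm_exp_I_mul_ofReal_sub_one_le).trans ?_
        rw [Real.norm_eq_abs, abs_mul, abs_mul, abs_mul, abs_neg, abs_two, abs_of_pos hp]
        calc 2 * Real.pi * |x| * |t| ≤ 2 * Real.pi * (ε / 2) * ρ := by gcongr
          _ = ε * T / 4 := by rw [hρ]; field_simp
          _ ≤ 1 / 2 := by linarith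
    have h2 : 1 / 2 ≤ ‖𝓕 f t‖ := by
      have := norm_sub_norm_le (1 : ℂ) (1 - 𝓕 f t)
      rw [norm_one, sub_sub_cancel, norm_sub_rev] at this
      linarith
    nlinarith
  have hJ : 0 ≤ ∫ x, ‖f x‖ ^ 2 := integral_nonneg fun x => sq_nonneg ‖f x‖
  refine ⟨2 * Real.pi * (4 * ((∫ x, ‖f x‖ ^ 2) + 1)), by positivity, fun s hs a => ?_⟩
  have hsγ : HasGap s ε := hA.mono hs (min_le_left _ _)
  rw [integral_trigSum_window, mul_assoc (2 * Real.pi) (4 * _)]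
  refine mul_le_mul_of_nonneg_left ?_ (by positivity)
  set a' : ℝ → ℂ := fun l => a l * Complex.exp (Complex.I * l * ↑(T / 2)) with ha'
  have hnorm : ∑ l ∈ s, ‖a l‖ ^ 2 = ∑ l ∈ s, ‖a' l‖ ^ 2 :=
    Finset.sum_congr rfl fun l _ => by rw [ha']; simp only [norm_mul_exp]
  rw [hnorm]
  obtain ⟨hi0, he0⟩ := fourier_mul_trigSum hf hf0 hsγ a'
  set p : ℝ → ℝ := fun t => ‖trigSum s a' (-(2 * Real.pi * t))‖ ^ 2 with hpdef
  have hpc : Continuous p := by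
    have := continuous_trigSum s a'
    fun_prop
  have h1 : ∫ t in (-ρ)..ρ, p t ≤ 4 * ∫ t, ‖𝓕 f t‖ ^ 2 * p t := by
    rw [← integral_const_mul, intervalIntegral.integral_of_le (by linarith),
      ← integral_indicator measurableSet_Ioc]
    refine integral_mono ((hpc.integrableOn_Icc.mono_set
      Ioc_subset_Icc_self).integrable_indicator measurableSet_Ioc) (hi0.const_mul 4) fun t => ?_
    have hp0 : 0 ≤ p t := sq_nonneg _
    by_cases ht : t ∈ Ioc (-ρ) ρ
    · simp only [indicator_of_mem ht]
      have := hlow t (abs_le.2 ⟨ht.1.le, ht.2⟩)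
      nlinarith
    · simp only [indicator_of_notMem ht]
      positivity
  refine h1.trans ?_
  rw [he0]
  have : 0 ≤ ∑ l ∈ s, ‖a' l‖ ^ 2 := Finset.sum_nonneg fun l _ => sq_nonneg _
  nlinarith

/-! ### Adding finitely many exponents -/

/-- The symbol `1 - δ⁻¹ ∫₀^δ e^{ixε} dε` of subtracting an average. -/
noncomputable def avgSymbol (δ x : ℝ) : ℂ :=
  1 - (δ : ℂ)⁻¹ * ∫ ε in (0 : ℝ)..δ, Complex.exp (Complex.I * x * ε)

theorem avgSymbol_zero {δ : ℝ} (hδ : 0 < δ) : avgSymbol δ 0 = 0 := by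
  have : (δ : ℂ) ≠ 0 := Complex.ofReal_ne_zero.2 hδ.ne'
  simp [avgSymbol, this]

theorem re_avgSymbol {δ x : ℝ} (hδ : 0 < δ) (hx : x ≠ 0) :
    (avgSymbol δ x).re = 1 - Real.sin (x * δ) / (x * δ) := by
  have hx' : (x : ℂ) ≠ 0 := Complex.ofReal_ne_zero.2 hx
  have hδ' : (δ : ℂ) ≠ 0 := Complex.ofReal_ne_zero.2 hδ.ne'
  have : avgSymbol δ x
      = 1 - (((x * δ : ℝ) : ℂ))⁻¹ * (-Complex.I * (Complex.exp ((x * δ : ℝ) * Complex.I) - 1)) := by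
    rw [avgSymbol, integral_exp_mul_complex (mul_ne_zero Complex.I_ne_zero hx'),
      show Complex.I * x * δ = (x * δ : ℝ) * Complex.I by push_cast; ring]
    simp only [Complex.ofReal_zero, mul_zero, Complex.exp_zero]
    push_cast
    field_simp
    linear_combination (1 - Complex.exp (↑δ * ↑x * Complex.I)) * Complex.I_sq
  rw [this, Complex.sub_re, Complex.one_re, ← Complex.ofReal_inv, Complex.re_ofReal_mul]
  rw [neg_mul, Complex.neg_re, Complex.I_mul_re, neg_neg, Complex.sub_im, Complex.one_im, sub_zero,
    Complex.exp_ofReal_mul_I_im, inv_mul_eq_div]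

/-- The real part is `1 - sin y / y` with `y = xδ`, even in `y`. For `y ≥ 2` the quotient is at most
`1/2`; for smaller `y` the duplication formula bounds it by `cos(y/2)`, which stays away from one
once `y` stays away from zero. -/
theorem exists_le_norm_avgSymbol {δ γ : ℝ} (hδ : 0 < δ) (hγ : 0 < γ) :
    ∃ κ > 0, ∀ x, γ ≤ |x| → κ ≤ ‖avgSymbol δ x‖ := by
  set y₁ : ℝ := min (γ * δ) 2 with hy₁
  have hy0 : 0 < y₁ := by positivity
  have hy2 : y₁ ≤ 2 := min_le_right _ _
  have hpi := Real.pi_gt_three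
  have hcos : Real.cos (y₁ / 2) < 1 := by
    rw [← Real.cos_zero]
    exact Real.cos_lt_cos_of_nonneg_of_le_pi le_rfl (by linarith) (by linarith)
  set q : ℝ := max (1 / 2) (Real.cos (y₁ / 2)) with hq
  have hq1 : q < 1 := max_lt (by norm_num) hcos
  have hsin : ∀ y, y₁ ≤ y → Real.sin y / y ≤ q := by
    intro y hy
    have hy' : 0 < y := hy0.trans_le hy
    rw [div_le_iff₀ hy']
    rcases le_total 2 y with h | h
    · calc Real.sin y ≤ 1 := Real.sin_le_one y
        _ ≤ 1 / 2 * y := by linarith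
        _ ≤ q * y := by gcongr; exact le_max_left _ _
    · have hc : Real.cos (y / 2) ≤ Real.cos (y₁ / 2) :=
        Real.cos_le_cos_of_nonneg_of_le_pi (by linarith) (by linarith) (by linarith)
      have hc0 : 0 ≤ Real.cos (y / 2) :=
        Real.cos_nonneg_of_mem_Icc ⟨by linarith, by linarith⟩
      calc Real.sin y = 2 * Real.sin (y / 2) * Real.cos (y / 2) := by
            rw [← Real.sin_two_mul]; congr 1; ring
        _ ≤ 2 * (y / 2) * Real.cos (y / 2) := by
            gcongr; exact Real.sin_le (by linarith)
        _ = Real.cos (y / 2) * y := by ring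
        _ ≤ q * y := by gcongr; exact hc.trans (le_max_right _ _)
  refine ⟨1 - q, by linarith, fun x hx => ?_⟩
  have hx0 : x ≠ 0 := by
    rintro rfl
    simp at hx
    linarith
  refine le_trans ?_ (Complex.re_le_norm _)
  rw [re_avgSymbol hδ hx0]
  have : Real.sin (x * δ) / (x * δ) = Real.sin (|x| * δ) / (|x| * δ) := by
    rcases abs_choice x with h | h <;> rw [h]
    rw [neg_mul, Real.sin_neg, neg_div_neg_eq]
  rw [this]
  have := hsin (|x| * δ) ((min_le_left _ _).trans (by gcongr))
  linarith

/-- Subtracting the demodulated average acts diagonally on exponentials, and annihilates `e^{imt}`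
because `avgSymbol` vanishes at zero. -/
theorem trigSum_sub_average {δ : ℝ} (s : Finset ℝ) (a : ℝ → ℂ) (m t : ℝ) :
    trigSum s a t - (δ : ℂ)⁻¹ *
        ∫ ε in (0 : ℝ)..δ, Complex.exp (Complex.I * ↑(-m) * ε) * trigSum s a (t + ε)
      = trigSum s (fun l => a l * avgSymbol δ (l - m)) t := by
  have h : ∀ ε : ℝ, Complex.exp (Complex.I * ↑(-m) * ε) * trigSum s a (t + ε)
      = ∑ l ∈ s, a l * Complex.exp (Complex.I * l * t) *
        Complex.exp (Complex.I * ↑(l - m) * ε) := by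
    intro ε
    rw [trigSum, Finset.mul_sum]
    refine Finset.sum_congr rfl fun l _ => ?_
    rw [mul_left_comm, mul_assoc (a l), ← Complex.exp_add, ← Complex.exp_add]
    congr 2
    push_cast
    ring
  simp only [h]
  rw [intervalIntegral.integral_finsetSum fun l _ =>
    (Continuous.intervalIntegrable (by fun_prop) _ _), trigSum, trigSum, Finset.mul_sum,
    ← Finset.sum_sub_distrib]
  refine Finset.sum_congr rfl fun l _ => ?_
  rw [intervalIntegral.integral_const_mul, avgSymbol]
  ring

/-- The difference of the two sides is a variance. -/
theorem sq_average_le {δ : ℝ} (hδ : 0 < δ) {u : ℝ → ℝ} (hu : Continuous u) :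
    (δ⁻¹ * ∫ ε in (0 : ℝ)..δ, u ε) ^ 2 ≤ δ⁻¹ * ∫ ε in (0 : ℝ)..δ, u ε ^ 2 := by
  set m : ℝ := δ⁻¹ * ∫ ε in (0 : ℝ)..δ, u ε with hm
  have hI : ∫ ε in (0 : ℝ)..δ, u ε = δ * m := by rw [hm]; field_simp
  have h0 : 0 ≤ ∫ ε in (0 : ℝ)..δ, (u ε - m) ^ 2 :=
    intervalIntegral.integral_nonneg hδ.le fun _ _ => sq_nonneg _
  have h1 : ∫ ε in (0 : ℝ)..δ, (u ε - m) ^ 2 = (∫ ε in (0 : ℝ)..δ, u ε ^ 2) - δ * m ^ 2 := by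
    have : ∀ ε, (u ε - m) ^ 2 = u ε ^ 2 - 2 * m * u ε + m ^ 2 := fun ε => by ring
    simp only [this]
    have i1 : IntervalIntegrable (fun ε => u ε ^ 2) volume 0 δ := (hu.pow 2).intervalIntegrable _ _
    have i2 : IntervalIntegrable (fun ε => 2 * m * u ε) volume 0 δ :=
      (continuous_const.mul hu).intervalIntegrable _ _
    rw [intervalIntegral.integral_add (i1.sub i2) (by simp), intervalIntegral.integral_sub i1 i2,
      intervalIntegral.integral_const_mul, hI, intervalIntegral.integral_const, smul_eq_mul]
    ring
  rw [h1] at h0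
  rw [inv_mul_eq_div, le_div_iff₀ hδ]
  linarith

theorem InghamBelow.mono_right {A : Set ℝ} {T₁ T₂ : ℝ} (h : InghamBelow A T₁) (h0 : 0 ≤ T₁)
    (hT : T₁ ≤ T₂) : InghamBelow A T₂ := by
  obtain ⟨c, hc, h⟩ := h
  refine ⟨c, hc, fun s hs a => (h s hs a).trans ?_⟩
  have hi : ∀ x y, IntervalIntegrable (fun t => ‖trigSum s a t‖ ^ 2) volume x y := fun x y =>
    ((continuous_trigSum s a).norm.pow 2).intervalIntegrable x y
  exact intervalIntegral.integral_mono_interval le_rfl h0 hT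
    (Filter.Eventually.of_forall fun t => sq_nonneg _) (hi _ _)

theorem integral_norm_sq_add_le {f g : ℝ → ℂ} (hf : Continuous f) (hg : Continuous g) {T : ℝ}
    (hT : 0 ≤ T) : ∫ t in (0 : ℝ)..T, ‖f t + g t‖ ^ 2
      ≤ 2 * (∫ t in (0 : ℝ)..T, ‖f t‖ ^ 2) + 2 * ∫ t in (0 : ℝ)..T, ‖g t‖ ^ 2 := by
  have hf2 : Continuous fun t => 2 * ‖f t‖ ^ 2 := by fun_prop
  have hg2 : Continuous fun t => 2 * ‖g t‖ ^ 2 := by fun_prop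
  rw [← intervalIntegral.integral_const_mul, ← intervalIntegral.integral_const_mul,
    ← intervalIntegral.integral_add (hf2.intervalIntegrable _ _) (hg2.intervalIntegrable _ _)]
  refine intervalIntegral.integral_mono_on hT
    (((hf.add hg).norm.pow 2).intervalIntegrable (μ := volume) _ _)
    ((hf2.add hg2).intervalIntegrable _ _) fun t _ => ?_
  have h1 := norm_add_le (f t) (g t)
  have h2 := pow_le_pow_left₀ (norm_nonneg _) h1 2
  change ‖f t + g t‖ ^ 2 ≤ 2 * ‖f t‖ ^ 2 + 2 * ‖g t‖ ^ 2
  nlinarith [sq_nonneg (‖f t‖ - ‖g t‖)]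

theorem integral_norm_sq_average_le {δ T : ℝ} (hδ : 0 < δ) (hT : 0 ≤ T) {f : ℝ → ℂ}
    (hf : Continuous f) (m : ℝ) :
    ∫ t in (0 : ℝ)..T, ‖(δ : ℂ)⁻¹ *
        ∫ ε in (0 : ℝ)..δ, Complex.exp (Complex.I * ↑(-m) * ε) * f (t + ε)‖ ^ 2
      ≤ T * (δ⁻¹ * ∫ t in (0 : ℝ)..(T + δ), ‖f t‖ ^ 2) := by
  have hb : ∀ t ∈ Icc (0 : ℝ) T, ‖(δ : ℂ)⁻¹ *
      ∫ ε in (0 : ℝ)..δ, Complex.exp (Complex.I * ↑(-m) * ε) * f (t + ε)‖ ^ 2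
      ≤ δ⁻¹ * ∫ t in (0 : ℝ)..(T + δ), ‖f t‖ ^ 2 := by
    intro t ht
    have hn : ∀ ε : ℝ, ‖Complex.exp (Complex.I * ↑(-m) * ε) * f (t + ε)‖ = ‖f (t + ε)‖ := by
      intro ε
      rw [mul_comm, norm_mul_exp]
    have hu : Continuous fun ε => ‖f (t + ε)‖ := by fun_prop
    calc _ ≤ (δ⁻¹ * ∫ ε in (0 : ℝ)..δ, ‖f (t + ε)‖) ^ 2 := by
          rw [norm_mul, norm_inv, Complex.norm_real, Real.norm_eq_abs, abs_of_pos hδ]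
          gcongr
          refine (intervalIntegral.norm_integral_le_integral_norm hδ.le).trans_eq ?_
          simp only [hn]
      _ ≤ δ⁻¹ * ∫ ε in (0 : ℝ)..δ, ‖f (t + ε)‖ ^ 2 := sq_average_le hδ hu
      _ ≤ _ := by
          gcongr
          rw [intervalIntegral.integral_comp_add_left (fun x => ‖f x‖ ^ 2)]
          exact intervalIntegral.integral_mono_interval (by linarith [ht.1]) (by linarith)
            (by linarith [ht.2]) (Filter.Eventually.of_forall fun t => sq_nonneg _)
            ((hf.norm.pow 2).intervalIntegrable _ _)
  refine (le_abs_self _).trans ?_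
  have := intervalIntegral.norm_integral_le_of_norm_le_const (a := 0) (b := T)
    (f := fun t => ‖(δ : ℂ)⁻¹ *
      ∫ ε in (0 : ℝ)..δ, Complex.exp (Complex.I * ↑(-m) * ε) * f (t + ε)‖ ^ 2)
    (C := δ⁻¹ * ∫ t in (0 : ℝ)..(T + δ), ‖f t‖ ^ 2) fun t ht => by
      rw [uIoc_of_le hT] at ht
      rw [Real.norm_eq_abs, abs_of_nonneg (sq_nonneg _)]
      exact hb t ⟨ht.1.le, ht.2⟩
  rwa [sub_zero, abs_of_nonneg hT, mul_comm _ T, Real.norm_eq_abs] at this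

/-- Haraux's argument: subtracting the average over `[t, t + δ]` removes the exponent `m` and
multiplies the other coefficients by factors bounded below, so the inequality on `[0, T₁]` controls
those coefficients. The average looks ahead by `δ`, which is why the time grows to `T₂ = T₁ + δ`. -/
theorem InghamBelow.insert_point {A : Set ℝ} {γ T₁ T₂ m : ℝ} (h : InghamBelow A T₁) (hγ : 0 < γ)
    (hT₁ : 0 < T₁) (hT : T₁ < T₂) (hgap : HasGap (insert m A) γ) (hm : m ∉ A) :
    InghamBelow (insert m A) T₂ := by
  obtain ⟨c, hc, hlow⟩ := h
  set δ : ℝ := T₂ - T₁ with hδ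
  have hδ0 : 0 < δ := sub_pos.2 hT
  have hT₂ : 0 < T₂ := hT₁.trans hT
  obtain ⟨κ, hκ, hκle⟩ := exists_le_norm_avgSymbol hδ0 hγ
  obtain ⟨C, hC, hup⟩ := inghamAbove_of_hasGap hγ (hgap.mono (subset_insert m A) le_rfl) hT₂
  set C₁ : ℝ := (2 + 2 * (T₁ * δ⁻¹)) / (c * κ ^ 2) with hC₁
  have hC₁0 : 0 < C₁ := by positivity
  set C₂ : ℝ := C₁ + (2 + 2 * (C * C₁)) / T₂ with hC₂
  have hC₂0 : 0 < C₂ := by positivity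
  have main : ∀ s : Finset ℝ, ↑s ⊆ A → ∀ a : ℝ → ℂ, ∑ l ∈ insert m s, ‖a l‖ ^ 2
      ≤ C₂ * ∫ t in (0 : ℝ)..T₂, ‖trigSum (insert m s) a t‖ ^ 2 := by
    intro s hs a
    have hms : m ∉ s := fun h => hm (hs h)
    set f : ℝ → ℂ := trigSum (insert m s) a with hf
    have hfc : Continuous f := continuous_trigSum _ _
    set N : ℝ := ∫ t in (0 : ℝ)..T₂, ‖f t‖ ^ 2 with hN
    have hN0 : 0 ≤ N := intervalIntegral.integral_nonneg hT₂.le fun _ _ => sq_nonneg _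
    have hg : ∀ t, trigSum s (fun l => a l * avgSymbol δ (l - m)) t = f t + -((δ : ℂ)⁻¹ *
        ∫ ε in (0 : ℝ)..δ, Complex.exp (Complex.I * ↑(-m) * ε) * f (t + ε)) := by
      intro t
      rw [← sub_eq_add_neg, hf, trigSum_sub_average, trigSum, trigSum, Finset.sum_insert hms,
        sub_self, avgSymbol_zero hδ0]
      simp
    have hac : Continuous fun t : ℝ => -((δ : ℂ)⁻¹ *
        ∫ ε in (0 : ℝ)..δ, Complex.exp (Complex.I * ↑(-m) * ε) * f (t + ε)) := by
      have : (fun t : ℝ => -((δ : ℂ)⁻¹ *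
        ∫ ε in (0 : ℝ)..δ, Complex.exp (Complex.I * ↑(-m) * ε) * f (t + ε)))
          = fun t => trigSum s (fun l => a l * avgSymbol δ (l - m)) t - f t := by
        funext t
        rw [hg]
        ring
      rw [this]
      exact (continuous_trigSum _ _).sub hfc
    have hgN : ∫ t in (0 : ℝ)..T₁, ‖trigSum s (fun l => a l * avgSymbol δ (l - m)) t‖ ^ 2
        ≤ (2 + 2 * (T₁ * δ⁻¹)) * N := by
      simp only [hg]
      refine (integral_norm_sq_add_le hfc hac hT₁.le).trans ?_
      simp only [norm_neg]
      have h1 := integral_norm_sq_average_le hδ0 hT₁.le hfc m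
      rw [show T₁ + δ = T₂ by rw [hδ]; ring] at h1
      have h2 : ∫ t in (0 : ℝ)..T₁, ‖f t‖ ^ 2 ≤ N :=
        intervalIntegral.integral_mono_interval le_rfl hT₁.le hT.le
          (Filter.Eventually.of_forall fun t => sq_nonneg _)
          ((hfc.norm.pow 2).intervalIntegrable _ _)
      calc _ ≤ 2 * N + 2 * (T₁ * (δ⁻¹ * N)) := by gcongr
        _ = _ := by ring
    have hs1 : ∑ l ∈ s, ‖a l‖ ^ 2 ≤ C₁ * N := by
      have h1 := (hlow s hs _).trans hgN
      have h2 : κ ^ 2 * ∑ l ∈ s, ‖a l‖ ^ 2 ≤ ∑ l ∈ s, ‖a l * avgSymbol δ (l - m)‖ ^ 2 := by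
        rw [Finset.mul_sum]
        refine Finset.sum_le_sum fun l hl => ?_
        rw [norm_mul, mul_pow, mul_comm]
        gcongr
        refine hκle _ (hgap l (mem_insert_of_mem _ (hs hl)) m (mem_insert _ _) ?_)
        rintro rfl
        exact hms hl
      rw [hC₁, div_mul_eq_mul_div, le_div_iff₀ (by positivity)]
      calc (∑ l ∈ s, ‖a l‖ ^ 2) * (c * κ ^ 2) = c * (κ ^ 2 * ∑ l ∈ s, ‖a l‖ ^ 2) := by ring
        _ ≤ _ := (mul_le_mul_of_nonneg_left h2 hc.le).trans h1
    -- The term at `m` is the full sum minus the sum over `s`; the latter is controlled by the upper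
    -- Ingham inequality and the coefficients already estimated.
    have ham : T₂ * ‖a m‖ ^ 2 ≤ (2 + 2 * (C * C₁)) * N := by
      have h1 : T₂ * ‖a m‖ ^ 2 = ∫ t in (0 : ℝ)..T₂, ‖f t + -trigSum s a t‖ ^ 2 := by
        have : ∀ t : ℝ, ‖f t + -trigSum s a t‖ ^ 2 = ‖a m‖ ^ 2 := by
          intro t
          rw [hf, trigSum, trigSum, Finset.sum_insert hms, add_neg_cancel_right, norm_mul_exp]
        simp only [this]
        simp
      rw [h1]
      refine (integral_norm_sq_add_le hfc (continuous_trigSum s a).neg hT₂.le).trans ?_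
      simp only [Pi.neg_apply, norm_neg]
      calc _ ≤ 2 * N + 2 * (C * (C₁ * N)) := by
            gcongr
            exact (hup s hs a).trans (by gcongr)
        _ = _ := by ring
    rw [Finset.sum_insert hms, hC₂, add_mul, add_comm]
    refine add_le_add hs1 ?_
    rw [div_mul_eq_mul_div, le_div_iff₀ hT₂, mul_comm]
    exact ham
  refine ⟨C₂⁻¹, by positivity, fun s hs a => ?_⟩
  rw [inv_mul_le_iff₀ hC₂0]
  by_cases hms : m ∈ s
  · have := main (s.erase m) (fun l hl => by
      have hl' := Finset.mem_erase.1 (Finset.mem_coe.1 hl)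
      exact (mem_insert_iff.1 (hs hl'.2)).resolve_left hl'.1) a
    rwa [Finset.insert_erase hms] at this
  -- If `m` is absent, it is adjoined with coefficient zero.
  · have := main s (fun l hl => by
      refine (mem_insert_iff.1 (hs hl)).resolve_left ?_
      rintro rfl
      exact hms hl) (fun l => if l = m then 0 else a l)
    have hne : ∀ l ∈ s, l ≠ m := by
      rintro l hl rfl
      exact hms hl
    have e1 : ∑ l ∈ insert m s, ‖(if l = m then 0 else a l : ℂ)‖ ^ 2 = ∑ l ∈ s, ‖a l‖ ^ 2 := by
      rw [Finset.sum_insert hms, if_pos rfl]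
      simp only [norm_zero, ne_eq, OfNat.ofNat_ne_zero, not_false_eq_true, zero_pow, zero_add]
      exact Finset.sum_congr rfl fun l hl => by rw [if_neg (hne l hl)]
    have e2 : ∀ t, trigSum (insert m s) (fun l => if l = m then 0 else a l) t = trigSum s a t := by
      intro t
      rw [trigSum, Finset.sum_insert hms, if_pos rfl, zero_mul, zero_add]
      exact Finset.sum_congr rfl fun l hl => by rw [if_neg (hne l hl)]
    simp only [e1, e2] at this
    exact this

theorem InghamBelow.union_finite {A S : Set ℝ} {γ T₁ : ℝ} (h : InghamBelow A T₁) (hγ : 0 < γ)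
    (hT₁ : 0 < T₁) (hS : S.Finite) (hgap : HasGap (S ∪ A) γ) :
    ∀ T₂, T₁ < T₂ → InghamBelow (S ∪ A) T₂ := by
  induction S, hS using Set.Finite.induction_on with
  | empty =>
    intro T₂ hT
    rw [empty_union]
    exact h.mono_right hT₁.le hT.le
  | @insert m S _ _ ih =>
    intro T₂ hT
    rw [insert_union] at hgap ⊢
    have hgap' := hgap.mono (subset_insert m _) le_rfl
    by_cases hm : m ∈ S ∪ A
    · rw [insert_eq_of_mem hm]
      exact ih hgap' T₂ hT
    -- The extra time can be divided among the insertions because each needs only an arbitrarily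
    -- small amount.
    · obtain ⟨T, hT1, hT2⟩ := exists_between hT
      exact (ih hgap' T hT1).insert_point hγ (hT₁.trans hT1) hT2 hgap hm

/-- Ingham's inequality with an asymptotic gap. -/
theorem inghamBelow_of_asymptotic_gap {A S : Set ℝ} {γ γ₁ T : ℝ} (hγ : 0 < γ) (hA : HasGap A γ)
    (hS : S.Finite) (hγ₁ : 0 < γ₁) (hAS : HasGap (A \ S) γ₁) (hT : 2 * Real.pi / γ₁ < T) :
    InghamBelow A T := by
  have hp := Real.pi_pos
  obtain ⟨T₁, h1, h2⟩ := exists_between hT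
  have e : (A ∩ S) ∪ (A \ S) = A := inter_union_sdiff A S
  have := (inghamBelow_of_hasGap hγ₁ hAS h1).union_finite (S := A ∩ S) hγ
    (lt_trans (by positivity) h1) (hS.inter_of_right A) (by rwa [e]) T h2
  rwa [e] at this

/-! ### Biorthogonal families of exponentials -/

theorem continuous_exp_line (m : ℝ) : Continuous fun t : ℝ => Complex.exp (Complex.I * m * t) := by
  fun_prop

theorem norm_exp_line (m t : ℝ) : ‖Complex.exp (Complex.I * m * t)‖ = 1 := by
  simpa using norm_mul_exp m t 1

theorem memLp_exp_line (m T : ℝ) :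
    MemLp (fun t : ℝ => Complex.exp (Complex.I * m * t)) 2 (volume.restrict (Icc 0 T)) :=
  MemLp.of_bound (continuous_exp_line m).aestronglyMeasurable 1
    (Filter.Eventually.of_forall fun t => (norm_exp_line m t).le)

/-- The exponential `e^{imt}` in `L²(0, T)`. -/
noncomputable def expL2 (T m : ℝ) : Lp ℂ 2 (volume.restrict (Icc (0 : ℝ) T)) :=
  (memLp_exp_line m T).toLp _

theorem inner_expL2 (T m : ℝ) (q : Lp ℂ 2 (volume.restrict (Icc (0 : ℝ) T))) :
    inner ℂ (expL2 T m) q = ∫ t in Icc (0 : ℝ) T, Complex.exp (Complex.I * ↑(-m) * t) * q t := by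
  rw [L2.inner_def]
  refine integral_congr_ae ?_
  filter_upwards [(memLp_exp_line m T).coeFn_toLp] with t ht
  rw [expL2, ht, RCLike.inner_apply, mul_comm]
  congr 1
  rw [← Complex.exp_conj]
  simp

theorem norm_sq_sum_expL2 {T : ℝ} (hT : 0 ≤ T) (s : Finset ℝ) (a : ℝ → ℂ) :
    ‖∑ l ∈ s, a l • expL2 T l‖ ^ 2 = ∫ t in (0 : ℝ)..T, ‖trigSum s a t‖ ^ 2 := by
  have h : ((∑ l ∈ s, a l • expL2 T l : Lp ℂ 2 (volume.restrict (Icc (0 : ℝ) T))) : ℝ → ℂ)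
      =ᵐ[volume.restrict (Icc (0 : ℝ) T)] trigSum s a := by
    have h1 : ∀ᵐ t ∂(volume.restrict (Icc (0 : ℝ) T)), ∀ l ∈ s,
        (a l • expL2 T l : Lp ℂ 2 (volume.restrict (Icc (0 : ℝ) T))) t
          = a l * Complex.exp (Complex.I * l * t) := by
      rw [Filter.eventually_all_finset]
      intro l _
      filter_upwards [(memLp_exp_line l T).coeFn_toLp, Lp.coeFn_smul (a l) (expL2 T l)] with t h1 h2
      rw [h2, Pi.smul_apply, expL2, h1, smul_eq_mul]
    filter_upwards [h1, Lp.coeFn_finsetSum s (fun l => a l • expL2 T l)] with t h1 h2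
    rw [h2, Finset.sum_apply]
    exact Finset.sum_congr rfl h1
  have h2 : ((‖∑ l ∈ s, a l • expL2 T l‖ ^ 2 : ℝ) : ℂ)
      = ((∫ t in (0 : ℝ)..T, ‖trigSum s a t‖ ^ 2 : ℝ) : ℂ) := by
    have := inner_self_eq_norm_sq_to_K (𝕜 := ℂ) (∑ l ∈ s, a l • expL2 T l)
    rw [Complex.ofReal_pow]
    refine this.symm.trans ?_
    rw [L2.inner_def, intervalIntegral.integral_of_le hT, ← integral_Icc_eq_integral_Ioc,
      ← integral_complex_ofReal]
    refine integral_congr_ae ?_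
    filter_upwards [h] with t ht
    rw [ht, inner_self_eq_norm_sq_to_K]
    simp
  exact_mod_cast h2

/-- The component `v` of `e^{ilt}` orthogonal to the closed span of the other exponentials, divided
by `‖v‖²`, is biorthogonal and has norm `1/‖v‖`. Ingham's inequality bounds `‖v‖²` below by `c`,
uniformly in `l`. -/
theorem InghamBelow.exists_biorthogonal {A : Set ℝ} {T : ℝ} (h : InghamBelow A T) (hT : 0 ≤ T) :
    ∃ C > 0, ∃ q : ℝ → Lp ℂ 2 (volume.restrict (Icc (0 : ℝ) T)), ∀ l ∈ A, ‖q l‖ ≤ C ∧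
      ∀ m ∈ A, ∫ t in Icc (0 : ℝ) T, Complex.exp (Complex.I * ↑(-m) * t) * q l t
        = if m = l then 1 else 0 := by
  obtain ⟨c, hc, h⟩ := h
  have key : ∀ l ∈ A, ∃ q : Lp ℂ 2 (volume.restrict (Icc (0 : ℝ) T)), ‖q‖ ≤ (Real.sqrt c)⁻¹ ∧
      ∀ m ∈ A, inner ℂ (expL2 T m) q = if m = l then 1 else 0 := by
    intro l hl
    set W : Submodule ℂ (Lp ℂ 2 (volume.restrict (Icc (0 : ℝ) T))) :=
      Submodule.span ℂ (expL2 T '' (A \ {l})) with hW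
    set V := W.topologicalClosure with hV
    have hVc : IsClosed (V : Set (Lp ℂ 2 (volume.restrict (Icc (0 : ℝ) T)))) :=
      W.isClosed_topologicalClosure
    have : CompleteSpace V := hVc.completeSpace_coe
    -- The difference is a finite exponential sum with coefficient one at `l`, so that its
    -- coefficients have square sum at least one.
    have hspan : ∀ w ∈ W, c ≤ ‖expL2 T l - w‖ ^ 2 := by
      intro w hw
      rw [hW, Finsupp.mem_span_image_iff_linearCombination] at hw
      obtain ⟨b, hb, rfl⟩ := hw
      rw [Finsupp.mem_supported] at hb
      have hlb : l ∉ b.support := fun h => (hb h).2 rfl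
      have hsub : (↑(insert l b.support) : Set ℝ) ⊆ A := by
        intro m hm
        rcases Finset.mem_insert.1 (Finset.mem_coe.1 hm) with rfl | hm
        · exact hl
        · exact (hb hm).1
      have h1 := h (insert l b.support) hsub (fun m => if m = l then 1 else -b m)
      rw [← norm_sq_sum_expL2 hT, Finset.sum_insert hlb, Finset.sum_insert hlb, if_pos rfl,
        one_smul] at h1
      have h2 : expL2 T l - Finsupp.linearCombination ℂ (expL2 T) b = expL2 T l +
          ∑ m ∈ b.support, (if m = l then 1 else -b m : ℂ) • expL2 T m := by
        rw [sub_eq_add_neg, Finsupp.linearCombination_apply, Finsupp.sum,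
          ← Finset.sum_neg_distrib]
        congr 1
        refine Finset.sum_congr rfl fun m hm => ?_
        have hml : m ≠ l := fun h => hlb (h ▸ hm)
        rw [if_neg hml, neg_smul]
      rw [h2]
      refine le_trans ?_ h1
      have : 0 ≤ ∑ m ∈ b.support, ‖(if m = l then 1 else -b m : ℂ)‖ ^ 2 :=
        Finset.sum_nonneg fun m _ => sq_nonneg _
      rw [norm_one]
      nlinarith
    have hclos : ∀ w ∈ V, c ≤ ‖expL2 T l - w‖ ^ 2 := by
      intro w hw
      have hcl : IsClosed {w | c ≤ ‖expL2 T l - w‖ ^ 2} :=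
        isClosed_le continuous_const (by fun_prop)
      exact closure_minimal hspan hcl hw
    set v := expL2 T l - V.starProjection (expL2 T l) with hv
    have hvV : ∀ w ∈ V, inner ℂ w v = 0 := fun w hw =>
      (Submodule.mem_orthogonal V v).1 (V.sub_starProjection_mem_orthogonal _) w hw
    have hvc : c ≤ ‖v‖ ^ 2 := hclos _ (V.starProjection_apply_mem _)
    have hv0 : 0 < ‖v‖ := by
      rcases (norm_nonneg v).eq_or_lt with h0 | h0
      · rw [← h0] at hvc
        norm_num at hvc
        linarith
      · exact h0
    have hv0' : (‖v‖ : ℂ) ^ 2 ≠ 0 := pow_ne_zero 2 (Complex.ofReal_ne_zero.2 hv0.ne')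
    refine ⟨((‖v‖ : ℂ) ^ 2)⁻¹ • v, ?_, fun m hm => ?_⟩
    · rw [norm_smul, norm_inv, norm_pow, Complex.norm_real, norm_norm]
      have : (‖v‖ ^ 2)⁻¹ * ‖v‖ = ‖v‖⁻¹ := by field_simp
      rw [this]
      refine inv_anti₀ (Real.sqrt_pos.2 hc) ?_
      exact Real.sqrt_le_left hv0.le |>.2 hvc
    · rw [inner_smul_right]
      split_ifs with hml
      · subst hml
        have : expL2 T m = v + V.starProjection (expL2 T m) := by rw [hv, sub_add_cancel]
        rw [this, inner_add_left, hvV _ (V.starProjection_apply_mem _), add_zero,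
          inner_self_eq_norm_sq_to_K]
        exact inv_mul_cancel₀ hv0'
      · rw [hvV, mul_zero]
        exact W.le_topologicalClosure (Submodule.subset_span ⟨m, ⟨hm, hml⟩, rfl⟩)
  choose! q hq using key
  refine ⟨(Real.sqrt c)⁻¹, inv_pos.2 (Real.sqrt_pos.2 hc), q, fun l hl => ⟨(hq l hl).1, fun m hm => ?_⟩⟩
  rw [← inner_expL2]
  exact (hq l hl).2 m hm

/-! ### Operators between periodic Sobolev spaces -/

theorem freqNorm_eq_norm (k : ℤ × ℤ) : freqNorm k = ‖((k.1 : ℝ) + (k.2 : ℝ) * Complex.I : ℂ)‖ := by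
  rw [Complex.norm_add_mul_I, freqNorm]

theorem freqNorm_add_le (j k : ℤ × ℤ) : freqNorm (j + k) ≤ freqNorm j + freqNorm k := by
  rw [freqNorm_eq_norm, freqNorm_eq_norm, freqNorm_eq_norm]
  refine le_trans (le_of_eq ?_) (norm_add_le _ _)
  congr 1
  push_cast [Prod.fst_add, Prod.snd_add]
  ring

theorem abs_fst_le_freqNorm (k : ℤ × ℤ) : |(k.1 : ℝ)| ≤ freqNorm k := by
  rw [freqNorm]
  exact Real.abs_le_sqrt (by nlinarith [sq_nonneg (k.2 : ℝ)])

theorem abs_snd_le_freqNorm (k : ℤ × ℤ) : |(k.2 : ℝ)| ≤ freqNorm k := by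
  rw [freqNorm]
  exact Real.abs_le_sqrt (by nlinarith [sq_nonneg (k.1 : ℝ)])

theorem freqNorm_neg_fst (k₁ k₂ : ℤ) : freqNorm (-k₁, k₂) = freqNorm (k₁, k₂) := by
  simp [freqNorm]

theorem sobolevWeight_add_le {s : ℝ} (hs : 0 ≤ s) (j k : ℤ × ℤ) :
    sobolevWeight s (j + k) ≤ sobolevWeight s j * sobolevWeight s k := by
  have hj := freqNorm_nonneg j
  have hk := freqNorm_nonneg k
  rw [sobolevWeight, sobolevWeight, sobolevWeight, ← Real.mul_rpow (by linarith) (by linarith)]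
  refine Real.rpow_le_rpow (by linarith [freqNorm_nonneg (j + k)]) ?_ hs
  nlinarith [freqNorm_add_le j k]

namespace SobolevSpace

variable {s s' : ℝ}

theorem ext_coeff {u v : SobolevSpace s} (h : ∀ k, u.coeff k = v.coeff k) : u = v :=
  Subtype.ext (funext h)

theorem norm_sq' (u : SobolevSpace s) :
    ‖u‖ ^ 2 = (2 * Real.pi) ^ 2 * ∑' k, (sobolevWeight s k * ‖u.coeff k‖) ^ 2 := by
  have h : ∀ k, (sobolevWeight s k * ‖u.coeff k‖) ^ 2
      = (1 + freqNorm k) ^ (2 * s) * ‖u.coeff k‖ ^ 2 := fun k => by rw [mul_pow, sobolevWeight_sq]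
  simp only [h]
  exact u.norm_sq

theorem summable_coeff' (u : SobolevSpace s) :
    Summable fun k => (sobolevWeight s k * ‖u.coeff k‖) ^ 2 := by
  simp only [mul_pow, sobolevWeight_sq]
  exact u.summable_coeff

/-- The element with given Fourier coefficients. -/
def ofCoeff (a : ℤ × ℤ → ℂ) (h : Summable fun k => (sobolevWeight s k * ‖a k‖) ^ 2) :
    SobolevSpace s :=
  ⟨a, by
    have h' : Summable fun k => (1 + freqNorm k) ^ (2 * s) * ‖a k‖ ^ 2 := by
      simpa only [mul_pow, sobolevWeight_sq] using h
    exact h'⟩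

theorem coeff_add (u v : SobolevSpace s) (k : ℤ × ℤ) :
    (u + v).coeff k = u.coeff k + v.coeff k := rfl

theorem weight_mul_coeff_le_norm (u : SobolevSpace s) (k : ℤ × ℤ) :
    2 * Real.pi * (sobolevWeight s k * ‖u.coeff k‖) ≤ ‖u‖ := by
  refine abs_le_of_sq_le_sq' ?_ (norm_nonneg _) |>.2
  rw [norm_sq', mul_pow]
  gcongr
  exact u.summable_coeff'.le_tsum k fun _ _ => sq_nonneg _

/-- The Fourier coefficient `û(k)` as a continuous linear functional. -/
noncomputable def coeffCLM (s : ℝ) (k : ℤ × ℤ) : SobolevSpace s →L[ℂ] ℂ :=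
  LinearMap.mkContinuous
    { toFun := fun u => u.coeff k
      map_add' := fun _ _ => rfl
      map_smul' := fun _ _ => rfl } ((2 * Real.pi * sobolevWeight s k)⁻¹) fun u => by
    have h := mul_pos Real.two_pi_pos (sobolevWeight_pos s k)
    rw [inv_mul_eq_div, le_div_iff₀ h]
    refine le_trans (le_of_eq ?_) (u.weight_mul_coeff_le_norm k)
    change ‖u.coeff k‖ * _ = _
    ring

theorem coeffCLM_apply (k : ℤ × ℤ) (u : SobolevSpace s) : coeffCLM s k u = u.coeff k := rfl

theorem summable_weightedShift (m : ℤ × ℤ → ℂ) {σ : ℤ × ℤ → ℤ × ℤ} (hσ : σ.Injective) {M : ℝ}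
    (hM : ∀ k, ‖m k‖ * sobolevWeight s' k ≤ M * sobolevWeight s (σ k)) (u : SobolevSpace s) :
    (∀ k, (sobolevWeight s' k * ‖m k * u.coeff (σ k)‖) ^ 2
      ≤ M ^ 2 * (sobolevWeight s (σ k) * ‖u.coeff (σ k)‖) ^ 2) ∧
    Summable fun k => (sobolevWeight s' k * ‖m k * u.coeff (σ k)‖) ^ 2 := by
  have hle : ∀ k, (sobolevWeight s' k * ‖m k * u.coeff (σ k)‖) ^ 2
      ≤ M ^ 2 * (sobolevWeight s (σ k) * ‖u.coeff (σ k)‖) ^ 2 := by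
    intro k
    have := (sobolevWeight_pos s' k).le
    rw [← mul_pow]
    refine pow_le_pow_left₀ (by positivity) ?_ 2
    calc sobolevWeight s' k * ‖m k * u.coeff (σ k)‖
        = ‖m k‖ * sobolevWeight s' k * ‖u.coeff (σ k)‖ := by rw [norm_mul]; ring
      _ ≤ M * sobolevWeight s (σ k) * ‖u.coeff (σ k)‖ :=
          mul_le_mul_of_nonneg_right (hM k) (norm_nonneg _)
      _ = _ := by ring
  exact ⟨hle, Summable.of_nonneg_of_le (fun k => sq_nonneg _) hle
    ((u.summable_coeff'.comp_injective hσ).mul_left (M ^ 2))⟩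

/-- The operator `u ↦ ∑ m(k) û(σ k) e^{i k·x}` from `H^s` to `H^{s'}`. -/
noncomputable def weightedShift (s s' : ℝ) (m : ℤ × ℤ → ℂ) {σ : ℤ × ℤ → ℤ × ℤ}
    (hσ : σ.Injective) {M : ℝ} (hM0 : 0 ≤ M)
    (hM : ∀ k, ‖m k‖ * sobolevWeight s' k ≤ M * sobolevWeight s (σ k)) :
    SobolevSpace s →L[ℂ] SobolevSpace s' :=
  LinearMap.mkContinuous
    { toFun := fun u => ofCoeff (fun k => m k * u.coeff (σ k)) (summable_weightedShift m hσ hM u).2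
      map_add' := fun u v => ext_coeff fun k => mul_add _ _ _
      map_smul' := fun c u => ext_coeff fun k => mul_left_comm _ _ _ } M fun u => by
    refine abs_le_of_sq_le_sq' ?_ (by positivity) |>.2
    change ‖(ofCoeff (fun k => m k * u.coeff (σ k))
      (summable_weightedShift m hσ hM u).2 : SobolevSpace s')‖ ^ 2 ≤ _
    obtain ⟨hle, hsum⟩ := summable_weightedShift m hσ hM u
    rw [norm_sq', mul_pow M, norm_sq', mul_left_comm]
    refine mul_le_mul_of_nonneg_left ?_ (sq_nonneg _)
    rw [← tsum_mul_left]
    exact hsum.tsum_le_tsum_of_inj σ hσ (fun _ _ => by positivity) hle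
      (u.summable_coeff'.mul_left _)

theorem norm_weightedShift_le (m : ℤ × ℤ → ℂ) {σ : ℤ × ℤ → ℤ × ℤ}
    (hσ : σ.Injective) {M : ℝ} (hM0 : 0 ≤ M)
    (hM : ∀ k, ‖m k‖ * sobolevWeight s' k ≤ M * sobolevWeight s (σ k)) :
    ‖weightedShift s s' m hσ hM0 hM‖ ≤ M :=
  LinearMap.mkContinuous_norm_le _ hM0 _

end SobolevSpace

/-! ### Fourier coefficients of smooth functions on the circle -/

/-- Integration by parts; the boundary terms cancel by periodicity. Iteration gives decay of every
order. -/
theorem integral_exp_mul_deriv_of_periodic {f : ℝ → ℂ} (hf : ContDiff ℝ ∞ f)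
    (hp : Function.Periodic f (2 * Real.pi)) {n : ℤ} (hn : n ≠ 0) :
    ‖∫ x in (0 : ℝ)..(2 * Real.pi), Complex.exp (Complex.I * n * x) * f x‖ * |(n : ℝ)|
      = ‖∫ x in (0 : ℝ)..(2 * Real.pi), Complex.exp (Complex.I * n * x) * deriv f x‖ := by
  have hn' : (n : ℂ) ≠ 0 := Int.cast_ne_zero.2 hn
  have hu : ∀ x : ℝ, HasDerivAt (fun x : ℝ => Complex.exp (Complex.I * n * x))
      (Complex.exp (Complex.I * n * x) * (Complex.I * n)) x := by
    intro x
    have h1 : HasDerivAt (fun x : ℝ => Complex.I * n * (x : ℂ)) (Complex.I * n) x := by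
      simpa using (Complex.ofRealCLM.hasDerivAt (x := x)).const_mul (Complex.I * n)
    exact h1.cexp
  have hd : Continuous (deriv f) := hf.continuous_deriv (by simp)
  have h := intervalIntegral.integral_mul_deriv_eq_deriv_mul (a := 0) (b := 2 * Real.pi)
    (fun x _ => hu x) (fun x _ => ((hf.differentiable (by simp)) x).hasDerivAt)
    (Continuous.intervalIntegrable (by fun_prop) _ _) (hd.intervalIntegrable _ _)
  have e1 : Complex.exp (Complex.I * n * ((2 * Real.pi : ℝ) : ℂ)) = 1 := by
    rw [Complex.exp_eq_one_iff]
    exact ⟨n, by push_cast; ring⟩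
  have e2 : f (2 * Real.pi) = f 0 := by simpa using hp 0
  rw [e1, e2, Complex.ofReal_zero, mul_zero, Complex.exp_zero, sub_self, zero_sub] at h
  rw [h, norm_neg]
  have e3 : ∀ x : ℝ, Complex.exp (Complex.I * n * x) * (Complex.I * n) * f x
      = Complex.I * n * (Complex.exp (Complex.I * n * x) * f x) := fun x => by ring
  simp only [e3]
  rw [intervalIntegral.integral_const_mul, norm_mul, norm_mul, Complex.norm_I, one_mul, mul_comm,
    ← Complex.ofReal_intCast, Complex.norm_real, Real.norm_eq_abs]

theorem exists_decay_of_periodic (N : ℕ) : ∀ {f : ℝ → ℂ}, ContDiff ℝ ∞ f →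
    Function.Periodic f (2 * Real.pi) → ∃ C, ∀ n : ℤ, n ≠ 0 →
      ‖∫ x in (0 : ℝ)..(2 * Real.pi), Complex.exp (Complex.I * n * x) * f x‖ * |(n : ℝ)| ^ N ≤ C := by
  induction N with
  | zero =>
    intro f _ _
    refine ⟨∫ x in (0 : ℝ)..(2 * Real.pi), ‖f x‖, fun n _ => ?_⟩
    rw [pow_zero, mul_one]
    refine (intervalIntegral.norm_integral_le_integral_norm Real.two_pi_pos.le).trans_eq ?_
    congr 1
    funext x
    rw [norm_mul, show Complex.I * n * x = ((n * x : ℝ) : ℂ) * Complex.I by push_cast; ring,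
      Complex.norm_exp_ofReal_mul_I, one_mul]
  | succ N ih =>
    intro f hf hp
    have hp' : Function.Periodic (deriv f) (2 * Real.pi) := by
      intro x
      rw [← deriv_comp_add_const]
      congr 1
      funext y
      exact hp y
    obtain ⟨C, hC⟩ := ih (contDiff_infty_iff_deriv.1 hf).2 hp'
    refine ⟨C, fun n hn => ?_⟩
    rw [pow_succ', ← mul_assoc, integral_exp_mul_deriv_of_periodic hf hp hn]
    exact hC n hn

/-- The Fourier coefficient `(2π)⁻¹ ∫ e^{-imx} g(x) dx`. -/
noncomputable def circCoeff (g : Circ → ℝ) (m : ℤ) : ℂ :=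
  ((2 * Real.pi : ℝ) : ℂ)⁻¹ * ∫ x : Circ, fourier (-m) x * (g x : ℂ)

namespace IsBump

variable {g : Circ → ℝ}

theorem continuous (hg : IsBump g) : Continuous g :=
  isQuotientMap_quot_mk.continuous_iff.2 hg.smooth.continuous

theorem circCoeff_zero (hg : IsBump g) : circCoeff g 0 = ((2 * Real.pi : ℝ) : ℂ)⁻¹ := by
  simp only [circCoeff, neg_zero, fourier_zero, one_mul]
  rw [integral_complex_ofReal, hg.integral_eq_one, Complex.ofReal_one, mul_one]

theorem norm_circCoeff_le (hg : IsBump g) (m : ℤ) : ‖circCoeff g m‖ ≤ (2 * Real.pi)⁻¹ := by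
  have hp := Real.pi_pos
  rw [circCoeff, norm_mul, norm_inv, Complex.norm_real, Real.norm_eq_abs,
    abs_of_pos Real.two_pi_pos]
  refine mul_le_of_le_one_right (by positivity) ?_
  rw [← hg.integral_eq_one]
  refine (norm_integral_le_integral_norm _).trans_eq ?_
  congr 1
  funext x
  rw [norm_mul, fourier_apply, Circle.norm_coe, one_mul, Complex.norm_real, Real.norm_eq_abs,
    abs_of_nonneg (hg.nonneg x)]

theorem circCoeff_neg (g : Circ → ℝ) (m : ℤ) :
    circCoeff g (-m) = (starRingEnd ℂ) (circCoeff g m) := by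
  rw [circCoeff, circCoeff, map_mul, ← integral_conj, map_inv₀, Complex.conj_ofReal]
  congr 2
  funext x
  rw [map_mul, Complex.conj_ofReal, ← fourier_neg]

theorem norm_circCoeff (g : Circ → ℝ) (m : ℤ) : ‖circCoeff g m‖ = (2 * Real.pi)⁻¹ *
    ‖∫ x in (0 : ℝ)..(2 * Real.pi), Complex.exp (Complex.I * ↑(-m) * x) * (g x : ℂ)‖ := by
  rw [circCoeff, norm_mul, norm_inv, Complex.norm_real, Real.norm_eq_abs,
    abs_of_pos Real.two_pi_pos]
  congr 2
  have := AddCircle.intervalIntegral_preimage (2 * Real.pi) 0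
    (fun x : Circ => fourier (-m) x * (g x : ℂ))
  rw [← this, zero_add]
  congr 1
  funext x
  have hp : (Real.pi : ℂ) ≠ 0 := Complex.ofReal_ne_zero.2 Real.pi_ne_zero
  rw [fourier_coe_apply]
  congr 2
  push_cast
  field_simp

theorem summable_circCoeff (hg : IsBump g) {s : ℝ} (hs : 0 ≤ s) :
    Summable fun m : ℤ => ‖circCoeff g m‖ * (1 + |(m : ℝ)|) ^ s := by
  have hf : ContDiff ℝ ∞ fun x : ℝ => ((g x : ℝ) : ℂ) := Complex.ofRealCLM.contDiff.comp hg.smooth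
  have hper : Function.Periodic (fun x : ℝ => ((g x : ℝ) : ℂ)) (2 * Real.pi) := by
    intro x
    simp only [AddCircle.coe_add_period]
  -- Decay of order `N ≥ s + 2` absorbs the weight and leaves the summable factor `|m|⁻²`.
  obtain ⟨N, hN⟩ := exists_nat_ge (s + 2)
  obtain ⟨C, hC⟩ := exists_decay_of_periodic N hf hper
  have hsum : Summable fun m : ℤ => (C * 2 ^ s) * |(m : ℝ)| ^ (-2 : ℝ) :=
    (Real.summable_abs_int_rpow (by norm_num)).mul_left _
  refine Summable.of_norm_bounded_eventually hsum ?_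
  have hfin : {m : ℤ | m = 0}.Finite := by simp
  filter_upwards [hfin.compl_mem_cofinite] with m hm
  have hm0 : m ≠ 0 := hm
  have hm1 : (1 : ℝ) ≤ |(m : ℝ)| := by
    rw [← Int.cast_abs]
    exact_mod_cast Int.one_le_abs hm0
  have hmp : 0 < |(m : ℝ)| := by linarith
  have h1 := hC (-m) (neg_ne_zero.2 hm0)
  set J := ‖∫ x in (0 : ℝ)..(2 * Real.pi), Complex.exp (Complex.I * ↑(-m) * x) * (g x : ℂ)‖ with hJ
  have hc : ‖circCoeff g m‖ ≤ J := by
    rw [norm_circCoeff]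
    refine mul_le_of_le_one_left (norm_nonneg _) (inv_le_one_of_one_le₀ ?_)
    linarith [Real.pi_gt_three]
  rw [Int.cast_neg, abs_neg] at h1
  have hw : (1 + |(m : ℝ)|) ^ s ≤ 2 ^ s * |(m : ℝ)| ^ s := by
    rw [← Real.mul_rpow (by norm_num) hmp.le]
    exact Real.rpow_le_rpow (by linarith) (by linarith) hs
  have hpow : |(m : ℝ)| ^ s ≤ |(m : ℝ)| ^ N * |(m : ℝ)| ^ (-2 : ℝ) := by
    rw [← Real.rpow_natCast, ← Real.rpow_add hmp]
    exact Real.rpow_le_rpow_of_exponent_le hm1 (by linarith)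
  have hJ0 : 0 ≤ J := norm_nonneg _
  rw [Real.norm_eq_abs, abs_of_nonneg (by positivity)]
  calc ‖circCoeff g m‖ * (1 + |(m : ℝ)|) ^ s
      ≤ J * (2 ^ s * (|(m : ℝ)| ^ N * |(m : ℝ)| ^ (-2 : ℝ))) := by
        gcongr
        exact hw.trans (by gcongr)
    _ = (J * |(m : ℝ)| ^ N) * 2 ^ s * |(m : ℝ)| ^ (-2 : ℝ) := by ring
    _ ≤ _ := by gcongr

end IsBump

/-! ### The control operator on Sobolev spaces -/

theorem expMode_swap (k : ℤ × ℤ) (p : Torus) : expMode k.swap p.swap = expMode k p := by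
  simp only [expMode, Prod.fst_swap, Prod.snd_swap, mul_comm]

theorem integrable_mode_mul {w : Torus → ℂ} (hw : Continuous w) {φ : Torus → ℂ}
    (hφ : Integrable φ) : Integrable fun p => w p * φ p := by
  obtain ⟨C, hC⟩ := (isCompact_univ (X := Torus)).exists_bound_of_continuousOn hw.continuousOn
  exact hφ.bdd_mul (c := C) hw.aestronglyMeasurable (Filter.Eventually.of_forall fun p => hC p (mem_univ p))

/-- The operator `G₁` removes the mean in `x`, and multiplication by a function of `y` commutes with
this. The mean contributes only to the coefficients with `k₁ = 0`, where it cancels the main term by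
Fubini. -/
theorem integral_mode_opG₁ {g : Circ → ℝ} (hg : Continuous g) {φ : Torus → ℂ}
    (hφ : Integrable φ) (k : ℤ × ℤ) :
    Integrable (fun p : Torus => expMode (-k) p * ((g p.2 : ℂ) * opG₁ φ p)) ∧
    ∫ p : Torus, expMode (-k) p * ((g p.2 : ℂ) * opG₁ φ p) = if k.1 = 0 then 0 else
      ((2 * Real.pi : ℝ) : ℂ)⁻¹ * ∫ p : Torus, expMode (-k) p * (g p.2 : ℂ) * φ p := by
  have h0 : ((2 * Real.pi : ℝ) : ℂ) ≠ 0 := Complex.ofReal_ne_zero.2 Real.two_pi_pos.ne'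
  set c : ℂ := ((2 * Real.pi : ℝ) : ℂ)⁻¹ with hc
  have hφ' : Integrable φ ((volume : Measure Circ).prod volume) := hφ
  set Ψ : Circ → ℂ := fun y => ∫ x' : Circ, φ (x', y) with hΨ
  have hΨi : Integrable Ψ := hφ'.integral_prod_right
  have hgi : Integrable fun y : Circ => (fourier (-k.2) y * (g y : ℂ)) * Ψ y := by
    have hw : Continuous fun y : Circ => fourier (-k.2) y * (g y : ℂ) := by fun_prop
    obtain ⟨C, hC⟩ := (isCompact_univ (X := Circ)).exists_bound_of_continuousOn hw.continuousOn
    exact hΨi.bdd_mul (c := C) hw.aestronglyMeasurable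
      (Filter.Eventually.of_forall fun p => hC p (mem_univ p))
  have hfi : Integrable fun x : Circ => (fourier (-k.1) x : ℂ) :=
    (map_continuous (fourier (-k.1))).integrable_of_hasCompactSupport
      (HasCompactSupport.of_compactSpace _)
  have hw : Continuous fun p : Torus => expMode (-k) p * (g p.2 : ℂ) := by
    have := continuous_expMode (-k)
    fun_prop
  have hi1 : Integrable fun p : Torus => expMode (-k) p * (g p.2 : ℂ) * φ p :=
    integrable_mode_mul hw hφ
  have hi2 : Integrable fun p : Torus =>
      fourier (-k.1) p.1 * ((fourier (-k.2) p.2 * (g p.2 : ℂ)) * Ψ p.2) := hfi.mul_prod hgi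
  have hsplit : ∀ p : Torus, expMode (-k) p * ((g p.2 : ℂ) * opG₁ φ p)
      = c * (expMode (-k) p * (g p.2 : ℂ) * φ p)
        - c ^ 2 * (fourier (-k.1) p.1 * ((fourier (-k.2) p.2 * (g p.2 : ℂ)) * Ψ p.2)) := by
    intro p
    simp only [opG₁, expMode, hΨ, hc, Prod.fst_neg, Prod.snd_neg, one_div, inv_pow]
    ring
  simp only [hsplit]
  refine ⟨(hi1.const_mul c).sub (hi2.const_mul _), ?_⟩
  rw [integral_sub (hi1.const_mul c) (hi2.const_mul _), integral_const_mul, integral_const_mul]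
  have h2 : ∫ p : Torus, fourier (-k.1) p.1 * ((fourier (-k.2) p.2 * (g p.2 : ℂ)) * Ψ p.2)
      = (∫ x : Circ, fourier (-k.1) x) * ∫ y : Circ, (fourier (-k.2) y * (g y : ℂ)) * Ψ y :=
    integral_prod_mul (fun x : Circ => fourier (-k.1) x)
      (fun y : Circ => (fourier (-k.2) y * (g y : ℂ)) * Ψ y)
  rw [h2, integral_fourier_circ]
  by_cases hk : k.1 = 0
  · rw [if_pos hk, if_pos (by rw [hk, neg_zero])]
    have h3 : ∫ p : Torus, expMode (-k) p * (g p.2 : ℂ) * φ p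
        = ∫ y : Circ, (fourier (-k.2) y * (g y : ℂ)) * Ψ y := by
      rw [show (volume : Measure Torus) = (volume : Measure Circ).prod volume from rfl,
        integral_prod_symm _ hi1]
      congr 1
      funext y
      rw [hΨ, ← integral_const_mul]
      congr 1
      funext x
      simp [expMode, hk]
    rw [h3, hc]
    field_simp
    ring
  · rw [if_neg hk, if_neg (by simpa using hk), zero_mul, mul_zero, sub_zero]

/-- Exchanging the two coordinates reduces this to `G₁`. -/
theorem integral_mode_opG₂ {g : Circ → ℝ} (hg : Continuous g) {φ : Torus → ℂ}
    (hφ : Integrable φ) (k : ℤ × ℤ) :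
    Integrable (fun p : Torus => expMode (-k) p * ((g p.1 : ℂ) * opG₂ φ p)) ∧
    ∫ p : Torus, expMode (-k) p * ((g p.1 : ℂ) * opG₂ φ p) = if k.2 = 0 then 0 else
      ((2 * Real.pi : ℝ) : ℂ)⁻¹ * ∫ p : Torus, expMode (-k) p * (g p.1 : ℂ) * φ p := by
  have hφ' : Integrable (fun p : Torus => φ p.swap) := Integrable.swap (μ := volume) (ν := volume) hφ
  obtain ⟨h1, h2⟩ := integral_mode_opG₁ hg hφ' k.swap
  have e : ∀ p : Torus, expMode (-k) p * ((g p.1 : ℂ) * opG₂ φ p)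
      = expMode (-k.swap) p.swap * ((g p.swap.2 : ℂ) * opG₁ (fun p => φ p.swap) p.swap) := by
    intro p
    rw [show -k.swap = (-k).swap from rfl, expMode_swap]
    simp only [opG₁, opG₂, Prod.snd_swap, Prod.swap_swap, Prod.swap_prod_mk]
  simp only [e]
  constructor
  · exact Integrable.swap (μ := volume) (ν := volume) h1
  · have hs : ∀ f : Torus → ℂ, ∫ p : Torus, f p.swap = ∫ p : Torus, f p := fun f =>
      integral_prod_swap (μ := (volume : Measure Circ)) (ν := (volume : Measure Circ)) f
    rw [hs (fun p => expMode (-k.swap) p * ((g p.2 : ℂ) * opG₁ (fun p => φ p.swap) p)), h2,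
      Prod.fst_swap, ← hs]
    simp only [Prod.swap_swap, Prod.snd_swap, show -k.swap = (-k).swap from rfl, expMode_swap]

/-- Integration against `w` is the `L²` inner product with its conjugate, hence passes through the
`L²` series. -/
theorem SobolevSpace.hasSum_integral_mul_toL2 {s : ℝ} (hs : 0 ≤ s) (u : SobolevSpace s)
    {w : Torus → ℂ} (hw : Continuous w) :
    HasSum (fun j => u.coeff j * ∫ p : Torus, w p * expMode j p) (∫ p : Torus, w p * u.toL2 p) := by
  obtain ⟨C, hC⟩ := (isCompact_univ (X := Torus)).exists_bound_of_continuousOn hw.continuousOn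
  have hm : MemLp (fun p => (starRingEnd ℂ) (w p)) 2 (volume : Measure Torus) :=
    MemLp.of_bound (Complex.continuous_conj.comp hw).aestronglyMeasurable C
      (Filter.Eventually.of_forall fun p => by
        rw [RCLike.norm_conj]
        exact hC p (mem_univ p))
  have hin : ∀ φ : Lp ℂ 2 (volume : Measure Torus),
      inner ℂ (hm.toLp _) φ = ∫ p : Torus, w p * φ p := by
    intro φ
    rw [L2.inner_def]
    refine integral_congr_ae ?_
    filter_upwards [hm.coeFn_toLp] with p hp
    rw [hp, RCLike.inner_apply, RCLike.conj_conj, mul_comm]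
  have h := (u.summable_toL2 hs).hasSum.mapL (innerSL ℂ (hm.toLp _))
  simp only [map_smul, smul_eq_mul, innerSL_apply_apply, hin] at h
  have e : ∀ j, ∫ p : Torus, w p * modeL2 j p = ∫ p : Torus, w p * expMode j p := by
    intro j
    refine integral_congr_ae ?_
    filter_upwards [(memLp_expMode j).coeFn_toLp] with p hp
    rw [modeL2, hp]
  simp only [e] at h
  exact h

theorem integral_snd_mul_expMode (g : Circ → ℝ) (j k : ℤ × ℤ) :
    ∫ p : Torus, expMode (-k) p * (g p.2 : ℂ) * expMode j p =
      if j.1 = k.1 then ((2 * Real.pi : ℝ) : ℂ) ^ 2 * circCoeff g (k.2 - j.2) else 0 := by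
  have h0 : ((2 * Real.pi : ℝ) : ℂ) ≠ 0 := Complex.ofReal_ne_zero.2 Real.two_pi_pos.ne'
  have e : ∀ p : Torus, expMode (-k) p * (g p.2 : ℂ) * expMode j p
      = fourier (j.1 - k.1) p.1 * (fourier (-(k.2 - j.2)) p.2 * (g p.2 : ℂ)) := by
    intro p
    rw [mul_right_comm, expMode_neg_mul, expMode, Prod.fst_sub, Prod.snd_sub, neg_sub, mul_assoc]
  simp only [e]
  have h2 : ∫ p : Torus, fourier (j.1 - k.1) p.1 * (fourier (-(k.2 - j.2)) p.2 * (g p.2 : ℂ))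
      = (∫ x : Circ, fourier (j.1 - k.1) x) *
        ∫ y : Circ, fourier (-(k.2 - j.2)) y * (g y : ℂ) :=
    integral_prod_mul (fun x : Circ => fourier (j.1 - k.1) x)
      (fun y : Circ => fourier (-(k.2 - j.2)) y * (g y : ℂ))
  rw [h2, integral_fourier_circ]
  by_cases h : j.1 = k.1
  · rw [if_pos (sub_eq_zero.2 h), if_pos h, circCoeff]
    field_simp
  · rw [if_neg (fun h' => h (sub_eq_zero.1 h')), if_neg h, zero_mul]

theorem integral_fst_mul_expMode (g : Circ → ℝ) (j k : ℤ × ℤ) :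
    ∫ p : Torus, expMode (-k) p * (g p.1 : ℂ) * expMode j p =
      if j.2 = k.2 then ((2 * Real.pi : ℝ) : ℂ) ^ 2 * circCoeff g (k.1 - j.1) else 0 := by
  have h := integral_snd_mul_expMode g j.swap k.swap
  have hs : ∀ f : Torus → ℂ, ∫ p : Torus, f p.swap = ∫ p : Torus, f p := fun f =>
    integral_prod_swap (μ := (volume : Measure Circ)) (ν := (volume : Measure Circ)) f
  rw [← hs] at h
  simpa only [Prod.snd_swap, Prod.fst_swap, show -k.swap = (-k).swap from rfl, expMode_swap] using h

/-- The Fourier coefficients of `g₂ G₁ u`. -/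
theorem hasSum_opG₁ {s : ℝ} (hs : 0 ≤ s) (u : SobolevSpace s) {g : Circ → ℝ} (hg : Continuous g)
    (k : ℤ × ℤ) :
    HasSum (fun m : ℤ => (if k.1 = 0 then 0 else ((2 * Real.pi : ℝ) : ℂ)⁻¹ * circCoeff g m) *
        u.coeff (k.1, k.2 - m))
      (((2 * Real.pi : ℝ) ^ 2 : ℂ)⁻¹ *
        ∫ p : Torus, expMode (-k) p * ((g p.2 : ℂ) * opG₁ u.toL2 p)) := by
  have h0 : ((2 * Real.pi : ℝ) : ℂ) ≠ 0 := Complex.ofReal_ne_zero.2 Real.two_pi_pos.ne'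
  have hφ : Integrable (u.toL2 : Torus → ℂ) := (Lp.memLp u.toL2).integrable (by norm_num)
  rw [(integral_mode_opG₁ hg hφ k).2]
  by_cases hk : k.1 = 0
  · simp only [if_pos hk, zero_mul, mul_zero]
    exact hasSum_zero
  · simp only [if_neg hk]
    have hw : Continuous fun p : Torus => expMode (-k) p * (g p.2 : ℂ) := by
      have := continuous_expMode (-k)
      fun_prop
    have h := u.hasSum_integral_mul_toL2 hs hw
    simp only [integral_snd_mul_expMode] at h
    have hinj : Function.Injective fun m : ℤ => ((k.1, k.2 - m) : ℤ × ℤ) := by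
      intro m m' h
      simpa using h
    rw [← hinj.hasSum_iff] at h
    · have h' := h.mul_left ((((2 * Real.pi : ℝ) ^ 2 : ℂ)⁻¹ * ((2 * Real.pi : ℝ) : ℂ)⁻¹))
      rw [mul_assoc] at h'
      refine h'.congr_fun ?_
      intro m
      simp only [Function.comp_apply, if_true, sub_sub_cancel]
      field_simp
    · rintro ⟨j₁, j₂⟩ hj
      rw [if_neg, mul_zero]
      rintro rfl
      exact hj ⟨k.2 - j₂, by simp⟩

/-- The Fourier coefficients of `g₁ G₂ u`. -/
theorem hasSum_opG₂ {s : ℝ} (hs : 0 ≤ s) (u : SobolevSpace s) {g : Circ → ℝ} (hg : Continuous g)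
    (k : ℤ × ℤ) :
    HasSum (fun m : ℤ => (if k.2 = 0 then 0 else ((2 * Real.pi : ℝ) : ℂ)⁻¹ * circCoeff g m) *
        u.coeff (k.1 - m, k.2))
      (((2 * Real.pi : ℝ) ^ 2 : ℂ)⁻¹ *
        ∫ p : Torus, expMode (-k) p * ((g p.1 : ℂ) * opG₂ u.toL2 p)) := by
  have h0 : ((2 * Real.pi : ℝ) : ℂ) ≠ 0 := Complex.ofReal_ne_zero.2 Real.two_pi_pos.ne'
  have hφ : Integrable (u.toL2 : Torus → ℂ) := (Lp.memLp u.toL2).integrable (by norm_num)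
  rw [(integral_mode_opG₂ hg hφ k).2]
  by_cases hk : k.2 = 0
  · simp only [if_pos hk, zero_mul, mul_zero]
    exact hasSum_zero
  · simp only [if_neg hk]
    have hw : Continuous fun p : Torus => expMode (-k) p * (g p.1 : ℂ) := by
      have := continuous_expMode (-k)
      fun_prop
    have h := u.hasSum_integral_mul_toL2 hs hw
    simp only [integral_fst_mul_expMode] at h
    have hinj : Function.Injective fun m : ℤ => ((k.1 - m, k.2) : ℤ × ℤ) := by
      intro m m' h
      simpa using h
    rw [← hinj.hasSum_iff] at h
    · have h' := h.mul_left ((((2 * Real.pi : ℝ) ^ 2 : ℂ)⁻¹ * ((2 * Real.pi : ℝ) : ℂ)⁻¹))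
      rw [mul_assoc] at h'
      refine h'.congr_fun ?_
      intro m
      simp only [Function.comp_apply, if_true, sub_sub_cancel]
      field_simp
    · rintro ⟨j₁, j₂⟩ hj
      rw [if_neg, mul_zero]
      rintro rfl
      exact hj ⟨k.1 - j₁, by simp⟩

theorem torusCoeff_opG {s : ℝ} (u : SobolevSpace s) {g₁ g₂ : Circ → ℝ}
    (hg₁ : Continuous g₁) (hg₂ : Continuous g₂) (k : ℤ × ℤ) :
    torusCoeff (opG g₁ g₂ u.toL2) k =
      ((2 * Real.pi : ℝ) ^ 2 : ℂ)⁻¹ *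
        (∫ p : Torus, expMode (-k) p * ((g₂ p.2 : ℂ) * opG₁ u.toL2 p)) +
      ((2 * Real.pi : ℝ) ^ 2 : ℂ)⁻¹ *
        ∫ p : Torus, expMode (-k) p * ((g₁ p.1 : ℂ) * opG₂ u.toL2 p) := by
  have hφ : Integrable (u.toL2 : Torus → ℂ) := (Lp.memLp u.toL2).integrable (by norm_num)
  rw [torusCoeff, ← mul_add, ← integral_add (integral_mode_opG₁ hg₂ hφ k).1
    (integral_mode_opG₂ hg₁ hφ k).1]
  simp only [opG, mul_add]

/-- The control operator is bounded on `H^s`, `s ≥ 0`. -/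
theorem exists_controlOp {s : ℝ} (hs : 0 ≤ s) {g₁ g₂ : Circ → ℝ} (hg₁ : IsBump g₁)
    (hg₂ : IsBump g₂) : ∃ G : SobolevSpace s →L[ℂ] SobolevSpace s,
      ∀ u k, (G u).coeff k = torusCoeff (opG g₁ g₂ u.toL2) k := by
  have hcn : ‖((2 * Real.pi : ℝ) : ℂ)⁻¹‖ ≤ 1 := by
    rw [norm_inv, Complex.norm_real, Real.norm_eq_abs, abs_of_pos Real.two_pi_pos]
    exact inv_le_one_of_one_le₀ (by linarith [Real.pi_gt_three])
  have hbound : ∀ (P : Prop) [Decidable P] (g : Circ → ℝ) (m : ℤ),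
      ‖(if P then 0 else ((2 * Real.pi : ℝ) : ℂ)⁻¹ * circCoeff g m : ℂ)‖ ≤ ‖circCoeff g m‖ := by
    intro P _ g m
    split_ifs
    · simp
    · rw [norm_mul]
      exact mul_le_of_le_one_left (norm_nonneg _) hcn
  have hw1 : ∀ m : ℤ, sobolevWeight s (0, m) = (1 + |(m : ℝ)|) ^ s := by
    intro m
    simp [sobolevWeight, freqNorm, Real.sqrt_sq_eq_abs]
  have hw2 : ∀ m : ℤ, sobolevWeight s (m, 0) = (1 + |(m : ℝ)|) ^ s := by
    intro m
    simp [sobolevWeight, freqNorm, Real.sqrt_sq_eq_abs]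
  have hA : ∀ (m : ℤ) (k : ℤ × ℤ),
      ‖(if k.1 = 0 then 0 else ((2 * Real.pi : ℝ) : ℂ)⁻¹ * circCoeff g₂ m : ℂ)‖ *
        sobolevWeight s k ≤ ‖circCoeff g₂ m‖ * (1 + |(m : ℝ)|) ^ s *
          sobolevWeight s (k.1, k.2 - m) := by
    intro m k
    have h := sobolevWeight_add_le hs (k.1, k.2 - m) (0, m)
    rw [Prod.mk_add_mk, add_zero, sub_add_cancel, hw1] at h
    have := (sobolevWeight_pos s k).le
    calc _ ≤ ‖circCoeff g₂ m‖ * sobolevWeight s k := by gcongr; exact hbound _ _ _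
      _ ≤ ‖circCoeff g₂ m‖ * (sobolevWeight s (k.1, k.2 - m) * (1 + |(m : ℝ)|) ^ s) := by gcongr
      _ = _ := by ring
  have hB : ∀ (m : ℤ) (k : ℤ × ℤ),
      ‖(if k.2 = 0 then 0 else ((2 * Real.pi : ℝ) : ℂ)⁻¹ * circCoeff g₁ m : ℂ)‖ *
        sobolevWeight s k ≤ ‖circCoeff g₁ m‖ * (1 + |(m : ℝ)|) ^ s *
          sobolevWeight s (k.1 - m, k.2) := by
    intro m k
    have h := sobolevWeight_add_le hs (k.1 - m, k.2) (m, 0)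
    rw [Prod.mk_add_mk, add_zero, sub_add_cancel, hw2] at h
    have := (sobolevWeight_pos s k).le
    calc _ ≤ ‖circCoeff g₁ m‖ * sobolevWeight s k := by gcongr; exact hbound _ _ _
      _ ≤ ‖circCoeff g₁ m‖ * (sobolevWeight s (k.1 - m, k.2) * (1 + |(m : ℝ)|) ^ s) := by gcongr
      _ = _ := by ring
  have hiA : ∀ m : ℤ, Function.Injective fun k : ℤ × ℤ => (k.1, k.2 - m) := by
    intro m k k' h
    simpa [Prod.ext_iff] using h
  have hiB : ∀ m : ℤ, Function.Injective fun k : ℤ × ℤ => (k.1 - m, k.2) := by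
    intro m k k' h
    simpa [Prod.ext_iff] using h
  -- Each Fourier mode of `g₂` acts as a frequency shift. Submultiplicativity of the weight bounds
  -- its norm by `|ĝ₂(m)|(1 + |m|)^s`, so the sum over modes converges in operator norm; `B` does
  -- the same for `g₁`.
  let A : ℤ → SobolevSpace s →L[ℂ] SobolevSpace s := fun m =>
    SobolevSpace.weightedShift s s _ (hiA m) (by positivity) (hA m)
  let B : ℤ → SobolevSpace s →L[ℂ] SobolevSpace s := fun m =>
    SobolevSpace.weightedShift s s _ (hiB m) (by positivity) (hB m)
  have hAs : Summable A := Summable.of_norm_bounded (hg₂.summable_circCoeff hs) fun m =>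
    SobolevSpace.norm_weightedShift_le _ _ _ _
  have hBs : Summable B := Summable.of_norm_bounded (hg₁.summable_circCoeff hs) fun m =>
    SobolevSpace.norm_weightedShift_le _ _ _ _
  refine ⟨∑' m, A m + ∑' m, B m, fun u k => ?_⟩
  have happ : ∀ {F : ℤ → SobolevSpace s →L[ℂ] SobolevSpace s}, Summable F →
      HasSum (fun m => (F m u).coeff k) (((∑' m, F m) u).coeff k) := by
    intro F hF
    exact (hF.hasSum.mapL (ContinuousLinearMap.apply ℂ (SobolevSpace s) u)).mapL
      (SobolevSpace.coeffCLM s k)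
  rw [torusCoeff_opG u hg₁.continuous hg₂.continuous, add_apply,
    SobolevSpace.coeff_add]
  congr 1
  · exact (happ hAs).unique (hasSum_opG₁ hs u hg₂.continuous k)
  · exact (happ hBs).unique (hasSum_opG₂ hs u hg₁.continuous k)

/-! ### Scalar equations -/

theorem hasDerivAt_exp_line (a x : ℝ) : HasDerivAt (fun x : ℝ => Complex.exp (Complex.I * a * x))
    (Complex.I * a * Complex.exp (Complex.I * a * x)) x := by
  have h1 : HasDerivAt (fun x : ℝ => Complex.I * a * (x : ℂ)) (Complex.I * a) x := by
    simpa using (Complex.ofRealCLM.hasDerivAt (x := x)).const_mul (Complex.I * a)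
  rw [mul_comm (Complex.I * a)]
  exact h1.cexp

theorem integral_exp_line (a x y : ℝ) :
    ∫ t in x..y, Complex.I * a * Complex.exp (Complex.I * a * t)
      = Complex.exp (Complex.I * a * y) - Complex.exp (Complex.I * a * x) :=
  intervalIntegral.integral_eq_sub_of_hasDerivAt (fun t _ => hasDerivAt_exp_line a t)
    (Continuous.intervalIntegrable (by fun_prop) _ _)

theorem integral_mul_primitive_swap {p g : ℝ → ℂ} {t : ℝ} (ht : 0 ≤ t) (hp : Continuous p)
    (hg : IntegrableOn g (Icc 0 t)) :
    ∫ σ in (0 : ℝ)..t, p σ * ∫ τ in (0 : ℝ)..σ, g τ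
      = ∫ τ in (0 : ℝ)..t, g τ * ∫ σ in τ..t, p σ := by
  have hg' : Integrable g (volume.restrict (Ioc 0 t)) := hg.mono_set Ioc_subset_Icc_self
  have hp' : Integrable p (volume.restrict (Ioc 0 t)) :=
    hp.integrableOn_Icc.mono_set Ioc_subset_Icc_self
  have hK : MeasurableSet {z : ℝ × ℝ | z.2 ≤ z.1} := measurableSet_le measurable_snd measurable_fst
  have hi : Integrable (fun z : ℝ × ℝ => ({z : ℝ × ℝ | z.2 ≤ z.1}).indicator
      (fun z => p z.1 * g z.2) z)
      ((volume.restrict (Ioc 0 t)).prod (volume.restrict (Ioc 0 t))) :=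
    (hp'.mul_prod hg').indicator hK
  have hswap := integral_integral_swap (f := fun σ τ => ({z : ℝ × ℝ | z.2 ≤ z.1}).indicator
      (fun z => p z.1 * g z.2) (σ, τ)) hi
  rw [intervalIntegral.integral_of_le ht, intervalIntegral.integral_of_le ht]
  convert hswap using 1
  · refine setIntegral_congr_fun measurableSet_Ioc fun σ hσ => ?_
    have e : ∀ τ, ({z : ℝ × ℝ | z.2 ≤ z.1}).indicator (fun z => p z.1 * g z.2) (σ, τ)
        = (Iic σ).indicator (fun τ => p σ * g τ) τ := by
      intro τ
      simp only [indicator, mem_ofPred_eq, mem_Iic]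
    simp only [e]
    rw [setIntegral_indicator measurableSet_Iic, Ioc_inter_Iic, min_eq_right hσ.2,
      integral_const_mul, intervalIntegral.integral_of_le hσ.1.le]
  · refine setIntegral_congr_fun measurableSet_Ioc fun τ hτ => ?_
    have e : ∀ σ, ({z : ℝ × ℝ | z.2 ≤ z.1}).indicator (fun z => p z.1 * g z.2) (σ, τ)
        = (Ici τ).indicator (fun σ => g τ * p σ) σ := by
      intro σ
      simp only [indicator, mem_ofPred_eq, mem_Ici, mul_comm]
    have e2 : Ioc 0 t ∩ Ici τ = Icc τ t := by
      ext x
      simp only [mem_inter_iff, mem_Ioc, mem_Ici, mem_Icc]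
      constructor
      · rintro ⟨⟨_, h1⟩, h2⟩
        exact ⟨h2, h1⟩
      · rintro ⟨h1, h2⟩
        exact ⟨⟨hτ.1.trans_le h1, h2⟩, h1⟩
    simp only [e]
    rw [setIntegral_indicator measurableSet_Ici, e2, integral_const_mul,
      intervalIntegral.integral_of_le hτ.2, integral_Icc_eq_integral_Ioc]

/-- Duhamel's formula for a scalar linear equation with integrable forcing. -/
theorem duhamel_scalar (a : ℝ) (z : ℂ) {f : ℝ → ℂ} {t : ℝ} (ht : 0 ≤ t)
    (hf : IntegrableOn f (Icc 0 t)) :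
    Complex.exp (Complex.I * a * t) *
        (z + ∫ τ in (0 : ℝ)..t, Complex.exp (Complex.I * ↑(-a) * τ) * f τ)
      = z + ∫ σ in (0 : ℝ)..t, (Complex.I * a * (Complex.exp (Complex.I * a * σ) *
        (z + ∫ τ in (0 : ℝ)..σ, Complex.exp (Complex.I * ↑(-a) * τ) * f τ)) + f σ) := by
  set g : ℝ → ℂ := fun τ => Complex.exp (Complex.I * ↑(-a) * τ) * f τ with hgdef
  have hg : IntegrableOn g (Icc 0 t) :=
    hf.bdd_mul (c := 1) (continuous_exp_line (-a)).aestronglyMeasurable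
      (Filter.Eventually.of_forall fun x => (norm_exp_line (-a) x).le)
  have hcancel : ∀ τ : ℝ, Complex.exp (Complex.I * a * τ) * g τ = f τ := by
    intro τ
    rw [hgdef]
    dsimp only
    rw [← mul_assoc, ← Complex.exp_add, show Complex.I * a * τ + Complex.I * ↑(-a) * τ = 0 by
      push_cast; ring, Complex.exp_zero, one_mul]
  have hfi : IntervalIntegrable f volume 0 t :=
    (intervalIntegrable_iff_integrableOn_Icc_of_le ht).2 hf
  have hgi : IntervalIntegrable g volume 0 t :=
    (intervalIntegrable_iff_integrableOn_Icc_of_le ht).2 hg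
  have hprim : ContinuousOn (fun σ => ∫ τ in (0 : ℝ)..σ, g τ) (uIcc 0 t) :=
    intervalIntegral.continuousOn_primitive_interval (by rwa [uIcc_of_le ht])
  set p : ℝ → ℂ := fun σ => Complex.I * a * Complex.exp (Complex.I * a * σ) with hpdef
  have hp : Continuous p := by fun_prop
  have e : ∀ σ : ℝ, Complex.I * a * (Complex.exp (Complex.I * a * σ) *
      (z + ∫ τ in (0 : ℝ)..σ, g τ)) + f σ = (p σ * z + p σ * ∫ τ in (0 : ℝ)..σ, g τ) + f σ := by
    intro σ
    rw [hpdef]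
    ring
  simp only [e]
  have i1 : IntervalIntegrable (fun σ => p σ * z) volume 0 t :=
    (hp.mul continuous_const).intervalIntegrable _ _
  have i2 : IntervalIntegrable (fun σ => p σ * ∫ τ in (0 : ℝ)..σ, g τ) volume 0 t :=
    (hp.continuousOn.mul hprim).intervalIntegrable
  rw [intervalIntegral.integral_add (i1.add i2) hfi, intervalIntegral.integral_add i1 i2,
    intervalIntegral.integral_mul_const, integral_exp_line, integral_mul_primitive_swap ht hp hg]
  -- After the exchange of integrals the inner one is explicit, and its lower endpoint gives `-f`,
  -- cancelling the forcing term.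
  have e3 : ∀ τ, g τ * ∫ σ in τ..t, p σ = Complex.exp (Complex.I * a * t) * g τ - f τ := by
    intro τ
    rw [hpdef, integral_exp_line, ← hcancel τ]
    ring
  simp only [e3]
  rw [intervalIntegral.integral_sub (hgi.const_mul _) hfi, intervalIntegral.integral_const_mul]
  simp only [Complex.ofReal_zero, mul_zero, Complex.exp_zero]
  ring

/-- Uniqueness without Gronwall: the integrating factor `e^{-iat}` turns the solution into a
function with zero derivative and value zero at `0`. -/
theorem eq_zero_of_eq_integral (a : ℝ) {d : ℝ → ℂ} {T : ℝ} (hT : 0 ≤ T)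
    (hd : ContinuousOn d (Icc 0 T))
    (h : ∀ t ∈ Icc 0 T, d t = ∫ τ in (0 : ℝ)..t, Complex.I * a * d τ) : ∀ t ∈ Icc 0 T, d t = 0 := by
  -- Extension by the endpoint values makes the primitive differentiable on the whole line,
  -- endpoints included.
  set e : ℝ → ℂ := IccExtend hT ((Icc 0 T).domRestrict d) with he
  have hec : Continuous e := (continuousOn_iff_continuous_domRestrict.1 hd).Icc_extend'
  have hed : ∀ t ∈ Icc 0 T, e t = d t := fun t ht => IccExtend_of_mem hT _ ht
  set D : ℝ → ℂ := fun t => ∫ τ in (0 : ℝ)..t, Complex.I * a * e τ with hD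
  have hDd : ∀ t ∈ Icc 0 T, D t = d t := by
    intro t ht
    rw [h t ht]
    refine intervalIntegral.integral_congr fun τ hτ => ?_
    rw [uIcc_of_le ht.1] at hτ
    rw [hed τ ⟨hτ.1, hτ.2.trans ht.2⟩]
  have hDder : ∀ t, HasDerivAt D (Complex.I * a * e t) t := fun t =>
    (continuous_const.mul hec).integral_hasStrictDerivAt 0 t |>.hasDerivAt
  have hEder : ∀ t ∈ Icc 0 T,
      HasDerivAt (fun t : ℝ => Complex.exp (Complex.I * ↑(-a) * t) * D t) 0 t := by
    intro t ht
    refine ((hasDerivAt_exp_line (-a) t).mul (hDder t)).congr_deriv ?_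
    rw [hed t ht, hDd t ht]
    push_cast
    ring
  have hconst := constant_of_has_deriv_right_zero
    (f := fun t => Complex.exp (Complex.I * ↑(-a) * t) * D t)
    (fun t ht => (hEder t ht).continuousAt.continuousWithinAt)
    (fun t ht => (hEder t (Ico_subset_Icc_self ht)).hasDerivWithinAt)
  intro t ht
  have h1 := hconst t ht
  have h0 : D 0 = 0 := by simp [hD]
  simp only [h0, mul_zero] at h1
  rw [← hDd t ht]
  exact (mul_eq_zero.1 h1).resolve_left (Complex.exp_ne_zero _)

/-! ### The group generated by `∂ₓ𝓛` -/

/-- The unitary group with symbol `e^{iλ_k t}`. -/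
noncomputable def dispersiveGroup (b : ℤ × ℤ → ℝ) (s t : ℝ) :
    SobolevSpace s →L[ℂ] SobolevSpace s :=
  SobolevSpace.weightedShift s s (fun k => Complex.exp (Complex.I * eigenvalue b k * t))
    (σ := id) Function.injective_id zero_le_one fun k => by
      rw [norm_exp_line, id]

theorem coeff_dispersiveGroup (b : ℤ × ℤ → ℝ) (s t : ℝ) (u : SobolevSpace s) (k : ℤ × ℤ) :
    (dispersiveGroup b s t u).coeff k = Complex.exp (Complex.I * eigenvalue b k * t) * u.coeff k :=
  rfl

theorem norm_dispersiveGroup_le (b : ℤ × ℤ → ℝ) (s t : ℝ) (u : SobolevSpace s) :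
    ‖dispersiveGroup b s t u‖ ≤ ‖u‖ := by
  have h := (dispersiveGroup b s t).le_of_opNorm_le
    (SobolevSpace.norm_weightedShift_le _ _ _ _) u
  rwa [one_mul] at h

/-- The squared norm of the difference is a series of continuous functions dominated by four times
the series for `‖u‖²`, up to the common factor. -/
theorem continuous_dispersiveGroup_apply (b : ℤ × ℤ → ℝ) {s : ℝ} (u : SobolevSpace s) :
    Continuous fun t => dispersiveGroup b s t u := by
  rw [continuous_iff_continuousAt]
  intro t₀
  have hc : Continuous fun t => ‖dispersiveGroup b s t u - dispersiveGroup b s t₀ u‖ ^ 2 := by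
    simp only [SobolevSpace.norm_sq']
    refine continuous_const.mul (continuous_tsum
      (u := fun k => 4 * (sobolevWeight s k * ‖u.coeff k‖) ^ 2) (fun k => ?_)
      (u.summable_coeff'.mul_left 4) fun k t => ?_)
    · have h : ∀ t, (dispersiveGroup b s t u - dispersiveGroup b s t₀ u).coeff k
          = Complex.exp (Complex.I * eigenvalue b k * t) * u.coeff k
            - Complex.exp (Complex.I * eigenvalue b k * t₀) * u.coeff k := fun _ => rfl
      simp only [h]
      fun_prop
    · have h : (dispersiveGroup b s t u - dispersiveGroup b s t₀ u).coeff k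
          = Complex.exp (Complex.I * eigenvalue b k * t) * u.coeff k
            - Complex.exp (Complex.I * eigenvalue b k * t₀) * u.coeff k := rfl
      have hw := (sobolevWeight_pos s k).le
      have h2 : ‖(dispersiveGroup b s t u - dispersiveGroup b s t₀ u).coeff k‖
          ≤ 2 * ‖u.coeff k‖ := by
        rw [h]
        refine (norm_sub_le _ _).trans_eq ?_
        rw [norm_mul, norm_mul, norm_exp_line, norm_exp_line]
        ring
      rw [Real.norm_eq_abs, abs_of_nonneg (sq_nonneg _)]
      calc _ ≤ (sobolevWeight s k * (2 * ‖u.coeff k‖)) ^ 2 := by gcongr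
        _ = _ := by ring
  have h0 := (hc.tendsto t₀)
  simp only [sub_self, norm_zero, ne_eq, OfNat.ofNat_ne_zero, not_false_eq_true, zero_pow] at h0
  rw [ContinuousAt, tendsto_iff_norm_sub_tendsto_zero]
  have h1 := (Real.continuous_sqrt.tendsto 0).comp h0
  rw [Real.sqrt_zero] at h1
  refine h1.congr fun t => ?_
  rw [Function.comp_apply, Real.sqrt_sq (norm_nonneg _)]

/-- Strong continuity and the uniform bound by one on the operators give joint continuity, needed to
move a measurable or continuous curve by the group. -/
theorem continuous_dispersiveGroup (b : ℤ × ℤ → ℝ) (s : ℝ) :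
    Continuous fun p : ℝ × SobolevSpace s => dispersiveGroup b s p.1 p.2 := by
  rw [continuous_iff_continuousAt]
  rintro ⟨t₀, u₀⟩
  rw [ContinuousAt, tendsto_iff_norm_sub_tendsto_zero]
  have h1 : Filter.Tendsto (fun p : ℝ × SobolevSpace s => ‖p.2 - u₀‖ +
      ‖dispersiveGroup b s p.1 u₀ - dispersiveGroup b s t₀ u₀‖) (nhds (t₀, u₀)) (nhds 0) := by
    have hc : Continuous fun p : ℝ × SobolevSpace s => ‖p.2 - u₀‖ +
        ‖dispersiveGroup b s p.1 u₀ - dispersiveGroup b s t₀ u₀‖ := by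
      have := (continuous_dispersiveGroup_apply b u₀).comp (continuous_fst (X := ℝ) (Y := SobolevSpace s))
      exact (continuous_snd.sub continuous_const).norm.add (this.sub continuous_const).norm
    have := hc.tendsto (t₀, u₀)
    simpa using this
  refine squeeze_zero (fun _ => norm_nonneg _) (fun p => ?_) h1
  have : dispersiveGroup b s p.1 p.2 - dispersiveGroup b s t₀ u₀
      = dispersiveGroup b s p.1 (p.2 - u₀)
        + (dispersiveGroup b s p.1 u₀ - dispersiveGroup b s t₀ u₀) := by
    rw [map_sub]
    abel
  dsimp only
  rw [this]
  exact (norm_add_le _ _).trans (add_le_add_left (norm_dispersiveGroup_le b s _ _) _)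

/-- This makes `∂ₓ𝓛` bounded from `H^s` to `H^{s-r}`. The symbol bound covers large frequencies; the
finitely many others are absorbed in the constant. -/
theorem IsSymbolOfOrder.exists_eigenvalue_le {b : ℤ × ℤ → ℝ} {r : ℝ} (hb : IsSymbolOfOrder b r)
    (hr : 1 ≤ r) : ∃ M, 0 ≤ M ∧ ∀ k, |eigenvalue b k| ≤ M * sobolevWeight r k := by
  obtain ⟨C, hC, N₀, hN₀, h⟩ := hb
  have hfin : {k : ℤ × ℤ | freqNorm k < N₀}.Finite := by
    obtain ⟨N, hN⟩ := exists_nat_ge N₀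
    refine ((finite_Icc (-(N : ℤ)) N).prod (finite_Icc (-(N : ℤ)) N)).subset fun k hk => ?_
    have hk' : freqNorm k < N₀ := hk
    have h1 := (abs_fst_le_freqNorm k).trans (hk'.le.trans hN)
    have h2 := (abs_snd_le_freqNorm k).trans (hk'.le.trans hN)
    rw [abs_le] at h1 h2
    exact ⟨⟨by exact_mod_cast h1.1, by exact_mod_cast h1.2⟩,
      ⟨by exact_mod_cast h2.1, by exact_mod_cast h2.2⟩⟩
  have hw1 : ∀ k, 1 ≤ sobolevWeight r k := fun k =>
    Real.one_le_rpow (by linarith [freqNorm_nonneg k]) (by linarith)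
  have hM0 : 0 ≤ ∑ k ∈ hfin.toFinset, |eigenvalue b k| :=
    Finset.sum_nonneg fun _ _ => abs_nonneg _
  refine ⟨C + ∑ k ∈ hfin.toFinset, |eigenvalue b k|, by positivity, fun k => ?_⟩
  have hw := hw1 k
  rcases lt_or_ge (freqNorm k) N₀ with hk | hk
  · have := Finset.single_le_sum (f := fun k => |eigenvalue b k|) (fun _ _ => abs_nonneg _)
      (hfin.mem_toFinset.2 hk)
    nlinarith
  · have hk0 := freqNorm_nonneg k
    have h1 : |eigenvalue b k| ≤ C * sobolevWeight r k := by
      rw [eigenvalue, abs_mul]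
      calc |(k.1 : ℝ)| * |b k| ≤ (1 + freqNorm k) * (C * (1 + freqNorm k) ^ (r - 1)) := by
            gcongr
            · exact (abs_fst_le_freqNorm k).trans (by linarith)
            · refine (h k hk).trans ?_
              gcongr
              linarith
        _ = C * ((1 + freqNorm k) ^ (r - 1) * (1 + freqNorm k)) := by ring
        _ = C * sobolevWeight r k := by
            rw [sobolevWeight]
            nth_rewrite 2 [← Real.rpow_one (1 + freqNorm k)]
            rw [← Real.rpow_add (by linarith), sub_add_cancel]
    nlinarith

theorem sobolevWeight_sub_mul (s r : ℝ) (k : ℤ × ℤ) :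
    sobolevWeight r k * sobolevWeight (s - r) k = sobolevWeight s k := by
  rw [sobolevWeight, sobolevWeight, sobolevWeight, ← Real.rpow_add (by linarith [freqNorm_nonneg k]),
    add_sub_cancel]

/-! ### Well-posedness of the forced equation -/

theorem SobolevSpace.coeff_intervalIntegral {s : ℝ} {φ : ℝ → SobolevSpace s} {x y : ℝ}
    (hφ : IntervalIntegrable φ volume x y) (k : ℤ × ℤ) :
    (∫ τ in x..y, φ τ).coeff k = ∫ τ in x..y, (φ τ).coeff k :=
  ((coeffCLM s k).intervalIntegral_comp_comm hφ).symm

theorem aestronglyMeasurable_neg_flow {E : Type*} [NormedAddCommGroup E] {Φ : ℝ → E → E}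
    (hΦ : Continuous fun p : ℝ × E => Φ p.1 p.2) {μ : Measure ℝ} {f : ℝ → E}
    (hf : AEStronglyMeasurable f μ) : AEStronglyMeasurable (fun τ => Φ (-τ) (f τ)) μ :=
  hΦ.comp_aestronglyMeasurable (f := fun τ => (-τ, f τ))
    (continuous_neg.aestronglyMeasurable.prodMk hf)

theorem integrableOn_dispersiveGroup (b : ℤ × ℤ → ℝ) {s : ℝ} {A : Set ℝ}
    {f : ℝ → SobolevSpace s} (hf : IntegrableOn f A) :
    IntegrableOn (fun τ => dispersiveGroup b s (-τ) (f τ)) A :=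
  Integrable.mono hf (aestronglyMeasurable_neg_flow (Φ := fun t u => dispersiveGroup b s t u)
      (continuous_dispersiveGroup b s) hf.aestronglyMeasurable)
    (Filter.Eventually.of_forall fun τ => norm_dispersiveGroup_le b s (-τ) (f τ))

theorem continuousOn_flow {E : Type*} [NormedAddCommGroup E] {Φ : ℝ → E → E}
    (hΦ : Continuous fun p : ℝ × E => Φ p.1 p.2) {A : Set ℝ} {w : ℝ → E}
    (hw : ContinuousOn w A) : ContinuousOn (fun t => Φ t (w t)) A :=
  hΦ.comp_continuousOn (continuousOn_id.prodMk hw)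

theorem continuousOn_dispersiveGroup (b : ℤ × ℤ → ℝ) {s : ℝ} {A : Set ℝ}
    {w : ℝ → SobolevSpace s} (hw : ContinuousOn w A) :
    ContinuousOn (fun t => dispersiveGroup b s t (w t)) A :=
  continuousOn_flow (Φ := fun t u => dispersiveGroup b s t u) (continuous_dispersiveGroup b s) hw

/-- The solution is given by Duhamel's formula in `H^s`, and the equation is checked in `H^{s-r}`.
Coefficient functionals commute with the Bochner integral, so both the equation and uniqueness
reduce to scalar equations, one for each frequency. -/
theorem exists_unique_solution {b : ℤ × ℤ → ℝ} {r : ℝ} (hr : 1 ≤ r) (hb : IsSymbolOfOrder b r)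
    {s T : ℝ} (hT : 0 ≤ T) {g₁ g₂ : Circ → ℝ} (G : SobolevSpace s →L[ℂ] SobolevSpace s)
    (hG : ∀ u k, (G u).coeff k = torusCoeff (opG g₁ g₂ u.toL2) k)
    {h : ℝ → SobolevSpace s} (hh : IntegrableOn h (Icc 0 T)) (u₀ : SobolevSpace s) :
    ∃ u : ℝ → SobolevSpace s, IsSolution b r g₁ g₂ T h u₀ u ∧
      (∀ v, IsSolution b r g₁ g₂ T h u₀ v → EqOn v u (Icc 0 T)) ∧
      ∀ k, (u T).coeff k = Complex.exp (Complex.I * eigenvalue b k * T) * (u₀.coeff k +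
        ∫ τ in Icc 0 T, Complex.exp (Complex.I * ↑(-eigenvalue b k) * τ) * (G (h τ)).coeff k) := by
  have hGh : IntegrableOn (fun τ => G (h τ)) (Icc 0 T) := G.integrable_comp hh
  set φ : ℝ → SobolevSpace s := fun τ => dispersiveGroup b s (-τ) (G (h τ)) with hφdef
  have hφ : IntegrableOn φ (Icc 0 T) := integrableOn_dispersiveGroup b hGh
  have hsub : ∀ {E : Type} [NormedAddCommGroup E] {f : ℝ → E}, IntegrableOn f (Icc 0 T) →
      ∀ t ∈ Icc 0 T, IntervalIntegrable f volume 0 t := fun hf t ht =>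
    (intervalIntegrable_iff_integrableOn_Icc_of_le ht.1).2
      (hf.mono_set (Icc_subset_Icc_right ht.2))
  set w : ℝ → SobolevSpace s := fun t => u₀ + ∫ τ in (0 : ℝ)..t, φ τ with hw
  have hwc : ContinuousOn w (Icc 0 T) := by
    have := intervalIntegral.continuousOn_primitive_interval (f := φ) (μ := volume) (a := 0) (b := T)
      (by rwa [uIcc_of_le hT])
    rw [uIcc_of_le hT] at this
    exact continuousOn_const.add this
  set u : ℝ → SobolevSpace s := fun t => dispersiveGroup b s t (w t) with hu
  have huc : ContinuousOn u (Icc 0 T) := continuousOn_dispersiveGroup b hwc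
  have hcoeff : ∀ t ∈ Icc 0 T, ∀ k, (u t).coeff k
      = Complex.exp (Complex.I * eigenvalue b k * t) * (u₀.coeff k +
        ∫ τ in (0 : ℝ)..t, Complex.exp (Complex.I * ↑(-eigenvalue b k) * τ) *
          (G (h τ)).coeff k) := by
    intro t ht k
    rw [hu]
    dsimp only
    rw [coeff_dispersiveGroup, hw]
    dsimp only
    rw [SobolevSpace.coeff_add, SobolevSpace.coeff_intervalIntegral (hsub hφ t ht)]
    congr 3
    funext τ
    rw [hφdef]
    dsimp only
    rw [coeff_dispersiveGroup]
    congr 2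
    push_cast
    ring
  obtain ⟨M, hM0, hM⟩ := hb.exists_eigenvalue_le hr
  let D : SobolevSpace s →L[ℂ] SobolevSpace (s - r) :=
    SobolevSpace.weightedShift s (s - r) (fun k => Complex.I * eigenvalue b k) (σ := id)
      Function.injective_id hM0 fun k => by
        rw [norm_mul, Complex.norm_I, one_mul, Complex.norm_real, Real.norm_eq_abs, id,
          ← sobolevWeight_sub_mul s r k, ← mul_assoc]
        exact mul_le_mul_of_nonneg_right (hM k) (sobolevWeight_pos _ k).le
  let ι : SobolevSpace s →L[ℂ] SobolevSpace (s - r) :=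
    SobolevSpace.weightedShift s (s - r) (fun _ => 1) (σ := id)
      Function.injective_id zero_le_one fun k => by
        rw [norm_one, one_mul, one_mul, id, ← sobolevWeight_sub_mul s r k]
        exact le_mul_of_one_le_left (sobolevWeight_pos _ k).le
          (Real.one_le_rpow (by linarith [freqNorm_nonneg k]) (by linarith))
  have hD : ∀ v k, (D v).coeff k = Complex.I * eigenvalue b k * v.coeff k := fun _ _ => rfl
  have hι : ∀ v k, (ι v).coeff k = v.coeff k := fun v k => one_mul _
  have hF : IntegrableOn (fun τ => D (u τ) + ι (G (h τ))) (Icc 0 T) :=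
    ((D.continuous.comp_continuousOn huc).integrableOn_Icc).add (ι.integrable_comp hGh)
  have hFc : ∀ τ k, (D (u τ) + ι (G (h τ))).coeff k
      = Complex.I * eigenvalue b k * (u τ).coeff k + (G (h τ)).coeff k := by
    intro τ k
    rw [SobolevSpace.coeff_add, hD, hι]
  have hGk : ∀ k, IntegrableOn (fun τ => (G (h τ)).coeff k) (Icc 0 T) := fun k =>
    (SobolevSpace.coeffCLM s k).integrable_comp hGh
  have hsol : ∀ t ∈ Icc 0 T, ∀ k, (u t).coeff k = u₀.coeff k +
      ∫ τ in (0 : ℝ)..t, (Complex.I * eigenvalue b k * (u τ).coeff k + (G (h τ)).coeff k) := by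
    intro t ht k
    rw [hcoeff t ht k, duhamel_scalar _ _ ht.1 ((hGk k).mono_set (Icc_subset_Icc_right ht.2))]
    congr 1
    refine intervalIntegral.integral_congr fun τ hτ => ?_
    rw [uIcc_of_le ht.1] at hτ
    rw [hcoeff τ ⟨hτ.1, hτ.2.trans ht.2⟩ k]
  refine ⟨u, ⟨huc, ?_, fun τ => D (u τ) + ι (G (h τ)), ?_, hsub hF T ⟨hT, le_rfl⟩, ?_⟩, ?_, ?_⟩
  · refine SobolevSpace.ext_coeff fun k => ?_
    rw [hcoeff 0 ⟨le_rfl, hT⟩ k]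
    simp
  · refine Filter.Eventually.of_forall fun t _ k => ?_
    rw [hFc, hG]
  · intro t ht k
    rw [SobolevSpace.coeff_intervalIntegral (hsub hF t ht), hsol t ht k]
    simp only [hFc]
  -- The forcing cancels in the difference of two solutions, leaving the homogeneous scalar
  -- equation.
  · rintro v ⟨hvc, -, Fv, hFv, hFvi, hveq⟩ t₁ ht₁
    refine SobolevSpace.ext_coeff fun k => sub_eq_zero.1 ?_
    have hkc : ∀ {z : ℝ → SobolevSpace s}, ContinuousOn z (Icc 0 T) →
        ContinuousOn (fun t => (z t).coeff k) (Icc 0 T) := fun hz =>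
      (SobolevSpace.coeffCLM s k).continuous.comp_continuousOn hz
    refine eq_zero_of_eq_integral (eigenvalue b k) (d := fun t => (v t).coeff k - (u t).coeff k) hT
      ((hkc hvc).sub (hkc huc)) (fun t ht => ?_) t₁ ht₁
    have hcu : IntegrableOn (fun τ => (u τ).coeff k) (Icc 0 T) := (hkc huc).integrableOn_Icc
    have hcv : IntegrableOn (fun τ => (v τ).coeff k) (Icc 0 T) := (hkc hvc).integrableOn_Icc
    have hFvi' : IntervalIntegrable Fv volume 0 t :=
      hFvi.mono_set (by
        rw [uIcc_of_le ht.1, uIcc_of_le hT]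
        exact Icc_subset_Icc_right ht.2)
    have h1 : ∫ τ in (0 : ℝ)..t, (Fv τ).coeff k
        = ∫ τ in (0 : ℝ)..t, (Complex.I * eigenvalue b k * (v τ).coeff k + (G (h τ)).coeff k) := by
      rw [intervalIntegral.integral_of_le ht.1, intervalIntegral.integral_of_le ht.1,
        ← integral_Ioc_eq_integral_Ioo.symm, ← integral_Ioc_eq_integral_Ioo.symm]
      refine setIntegral_congr_ae measurableSet_Ioo ?_
      filter_upwards [hFv] with τ hτ hτm
      rw [hτ ⟨hτm.1, hτm.2.trans_le ht.2⟩ k, hG]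
    rw [hveq t ht k, hsol t ht k, SobolevSpace.coeff_intervalIntegral hFvi', h1,
      add_sub_add_left_eq_sub, ← intervalIntegral.integral_sub
        (((hsub hcv t ht).const_mul _).add (hsub (hGk k) t ht))
        (((hsub hcu t ht).const_mul _).add (hsub (hGk k) t ht))]
    congr 1
    funext τ
    ring
  · intro k
    rw [hcoeff T ⟨hT, le_rfl⟩ k, intervalIntegral.integral_of_le hT, integral_Icc_eq_integral_Ioc]

/-! ### The spectrum -/

/-- A frequency with a new eigenvalue could be adjoined to `J`, against maximality. Thus a gap on
`J` is a gap for the whole spectrum. -/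
theorem IsDistinctIndexSet.image_eq_range {b : ℤ × ℤ → ℝ} {J : Set (ℤ × ℤ)}
    (hJ : IsDistinctIndexSet b J) : eigenvalue b '' J = range (eigenvalue b) := by
  refine (image_subset_range _ _).antisymm ?_
  rintro _ ⟨k, rfl⟩
  by_contra hk
  have hkJ : k ∉ J := fun h => hk (mem_image_of_mem _ h)
  exact hkJ (hJ.2 ((injOn_insert hkJ).2 ⟨hJ.1, hk⟩) (subset_insert k J) (mem_insert k J))

theorem hasGap_of_lt_spectralGap {b : ℤ × ℤ → ℝ} {A : Set (ℤ × ℤ)} {γ : NNReal}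
    (h : (γ : ℝ≥0∞) < spectralGap b A) : HasGap (eigenvalue b '' A) γ := by
  rintro _ ⟨k, hk, rfl⟩ _ ⟨k', hk', rfl⟩ hne
  have hkk : k ≠ k' := fun h => hne (congrArg _ h)
  have h1 : spectralGap b A ≤ ENNReal.ofReal |eigenvalue b k - eigenvalue b k'| :=
    (iInf₂_le k hk).trans ((iInf₂_le k' hk').trans (iInf_le _ hkk))
  have h2 := (h.trans_le h1).le
  rw [← ENNReal.ofReal_coe_nnreal] at h2
  exact (ENNReal.ofReal_le_ofReal_iff (abs_nonneg _)).1 h2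

theorem inghamBelow_spectrum {b : ℤ × ℤ → ℝ} {J : Set (ℤ × ℤ)} (hJ : IsDistinctIndexSet b J)
    (hγ : 0 < spectralGap b J) {T : ℝ} (hT0 : 0 < T)
    (hT : ENNReal.ofReal (2 * Real.pi) / asymptoticGap b J < ENNReal.ofReal T) :
    InghamBelow (range (eigenvalue b)) T := by
  have hp := Real.two_pi_pos
  have h2p : ENNReal.ofReal (2 * Real.pi) ≠ 0 := by simpa using Real.pi_pos
  have hT' : ENNReal.ofReal T ≠ 0 := by simpa using hT0
  -- The rearrangement is valid also for an infinite asymptotic gap, because `2π` is nonzero and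
  -- finite.
  have h1 : ENNReal.ofReal (2 * Real.pi) / ENNReal.ofReal T < asymptoticGap b J := by
    rw [ENNReal.div_lt_iff (Or.inr h2p) (Or.inr ENNReal.ofReal_ne_top)] at hT
    rw [ENNReal.div_lt_iff (Or.inl hT') (Or.inl ENNReal.ofReal_ne_top),
      mul_comm (asymptoticGap b J)]
    exact hT
  rw [← ENNReal.ofReal_div_of_pos hT0] at h1
  simp only [asymptoticGap, lt_iSup_iff] at h1
  obtain ⟨S, hSJ, hS, h2⟩ := h1
  obtain ⟨γ₁, h3, h4⟩ := ENNReal.lt_iff_exists_nnreal_btwn.1 h2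
  obtain ⟨γ, h5, h6⟩ := ENNReal.lt_iff_exists_nnreal_btwn.1 hγ
  have hγ0 : (0 : ℝ) < γ := by exact_mod_cast h5
  have hγ₁ : 2 * Real.pi / T < γ₁ := by
    rw [← ENNReal.ofReal_coe_nnreal] at h3
    exact (ENNReal.ofReal_lt_ofReal_iff_of_nonneg (by positivity)).1 h3
  have hγ₁0 : (0 : ℝ) < γ₁ := lt_trans (by positivity) hγ₁
  have hgap := hasGap_of_lt_spectralGap h6
  rw [hJ.image_eq_range] at hgap
  refine inghamBelow_of_asymptotic_gap hγ0 hgap (hS.image (eigenvalue b)) hγ₁0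
    ((hasGap_of_lt_spectralGap h4).mono ?_ le_rfl) ?_
  · rw [← hJ.image_eq_range]
    rintro _ ⟨⟨k, hk, rfl⟩, hkS⟩
    exact mem_image_of_mem _ ⟨hk, fun h => hkS (mem_image_of_mem _ h)⟩
  · rw [div_lt_iff₀ hγ₁0]
    rw [div_lt_iff₀ hT0] at hγ₁
    linarith

/-! ### Square integrable functions with prescribed Fourier coefficients -/

theorem SobolevSpace.hasSum_modes {s : ℝ} (u : SobolevSpace s) :
    HasSum (fun k => (scaleFactor s k * u.coeff k) •
      (isometryl2 s).symm (lp.single 2 k (1 : ℂ))) u := by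
  have h := lp.hasSum_single (p := 2) (by norm_num) (isometryl2 s u)
  have h' := h.mapL ((isometryl2 s).symm.toContinuousLinearEquiv : _ →L[ℂ] SobolevSpace s)
  have e : ((isometryl2 s).symm.toContinuousLinearEquiv : _ →L[ℂ] SobolevSpace s)
      (isometryl2 s u) = u := (isometryl2 s).symm_apply_apply u
  rw [e] at h'
  refine h'.congr_fun fun k => ?_
  have e2 : lp.single 2 k ((isometryl2 s u : lp (fun _ : ℤ × ℤ => ℂ) 2) k)
      = (scaleFactor s k * u.coeff k) • (lp.single 2 k (1 : ℂ) : lp (fun _ : ℤ × ℤ => ℂ) 2) := by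
    rw [← lp.single_smul, smul_eq_mul, mul_one]
    rfl
  rw [e2, map_smul]
  rfl

/-- The function is an almost everywhere limit of its finite Fourier sums, which are measurable. -/
theorem aestronglyMeasurable_of_coeff {s : ℝ} {μ : Measure ℝ} {h : ℝ → SobolevSpace s}
    {a : ℤ × ℤ → ℝ → ℂ} (ha : ∀ k, AEStronglyMeasurable (a k) μ)
    (hh : ∀ᵐ τ ∂μ, ∀ k, (h τ).coeff k = a k τ) : AEStronglyMeasurable h μ := by
  refine aestronglyMeasurable_of_tendsto_ae Filter.atTop
    (f := fun (F : Finset (ℤ × ℤ)) τ => ∑ k ∈ F, (scaleFactor s k * a k τ) •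
      (SobolevSpace.isometryl2 s).symm (lp.single 2 k (1 : ℂ))) (fun F => ?_) ?_
  · refine Finset.aestronglyMeasurable_fun_sum F fun k _ => ?_
    exact ((ha k).const_mul _).smul_const _
  · filter_upwards [hh] with τ hτ
    have := (h τ).hasSum_modes
    simp only [hτ] at this
    exact this

theorem enorm_sq_sobolev {s : ℝ} (u : SobolevSpace s) :
    ‖u‖ₑ ^ 2 = ENNReal.ofReal ((2 * Real.pi) ^ 2) *
      ∑' k, ENNReal.ofReal ((sobolevWeight s k * ‖u.coeff k‖) ^ 2) := by
  rw [← ENNReal.ofReal_tsum_of_nonneg (fun _ => sq_nonneg _) u.summable_coeff',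
    ← ENNReal.ofReal_mul (sq_nonneg _), ← u.norm_sq', ENNReal.ofReal_pow (norm_nonneg _),
    ofReal_norm]

/-- By Tonelli the integral of the squared norm is the weighted sum of `|ψ̂(k)|² ‖q_k‖²`. Only the
uniform bound on the `q_k` is used, with no orthogonality in time; finiteness also shows that almost
every time slice lies in `H^s`. -/
theorem exists_memLp_of_modes {s : ℝ} {μ : Measure ℝ} (ψ : SobolevSpace s)
    (q : ℤ × ℤ → Lp ℂ 2 μ) {C : ℝ} (hC : 0 ≤ C) (hq : ∀ k, ‖q k‖ ≤ C) :
    ∃ h : ℝ → SobolevSpace s, MemLp h 2 μ ∧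
      (∀ᵐ τ ∂μ, ∀ k, (h τ).coeff k = ψ.coeff k * q k τ) ∧
      eLpNorm h 2 μ ≤ ENNReal.ofReal (C * ‖ψ‖) := by
  classical
  have hterm : ∀ k (τ : ℝ), ENNReal.ofReal ((sobolevWeight s k * ‖ψ.coeff k * q k τ‖) ^ 2)
      = ENNReal.ofReal ((sobolevWeight s k * ‖ψ.coeff k‖) ^ 2) * ‖q k τ‖ₑ ^ 2 := by
    intro k τ
    rw [norm_mul, ← mul_assoc, mul_pow, ENNReal.ofReal_mul (sq_nonneg _),
      ENNReal.ofReal_pow (norm_nonneg _), ofReal_norm]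
  have heL : ∀ {E : Type} [NormedAddCommGroup E] (f : ℝ → E),
      eLpNorm f 2 μ ^ 2 = ∫⁻ τ, ‖f τ‖ₑ ^ 2 ∂μ := by
    intro E _ f
    have := eLpNorm_nnreal_pow_eq_lintegral (f := f) (μ := μ) (p := 2) (by norm_num)
    simpa using this
  have hqint : ∀ k, ∫⁻ τ, ‖q k τ‖ₑ ^ 2 ∂μ ≤ ENNReal.ofReal (C ^ 2) := by
    intro k
    rw [← heL, ENNReal.ofReal_pow hC]
    gcongr
    rw [← Lp.enorm_def, ← ofReal_norm]
    exact ENNReal.ofReal_le_ofReal (hq k)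
  have hqm : ∀ k, AEMeasurable (fun τ => ‖q k τ‖ₑ ^ 2) μ := fun k =>
    (Lp.aestronglyMeasurable (q k)).enorm.pow_const 2
  set W : ℝ≥0∞ := ∑' k, ENNReal.ofReal ((sobolevWeight s k * ‖ψ.coeff k‖) ^ 2) with hW
  have hWtop : W ≠ ⊤ := by
    rw [hW, ← ENNReal.ofReal_tsum_of_nonneg (fun _ => sq_nonneg _) ψ.summable_coeff']
    exact ENNReal.ofReal_ne_top
  have hint : ∫⁻ τ, ∑' k, ENNReal.ofReal ((sobolevWeight s k * ‖ψ.coeff k * q k τ‖) ^ 2) ∂μ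
      ≤ W * ENNReal.ofReal (C ^ 2) := by
    simp only [hterm]
    rw [lintegral_tsum fun k => (hqm k).const_mul _, hW, ← ENNReal.tsum_mul_right]
    refine ENNReal.tsum_le_tsum fun k => ?_
    rw [lintegral_const_mul'' _ (hqm k)]
    gcongr
    exact hqint k
  have hae : ∀ᵐ τ ∂μ, Summable fun k => (sobolevWeight s k * ‖ψ.coeff k * q k τ‖) ^ 2 := by
    have hm : AEMeasurable (fun τ => ∑' k,
        ENNReal.ofReal ((sobolevWeight s k * ‖ψ.coeff k * q k τ‖) ^ 2)) μ := by
      simp only [hterm]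
      exact AEMeasurable.tsum fun k => (hqm k).const_mul _
    have hne := ae_lt_top' hm (ne_top_of_le_ne_top
      (ENNReal.mul_ne_top hWtop ENNReal.ofReal_ne_top) hint)
    filter_upwards [hne] with τ hτ
    have := ENNReal.summable_toReal hτ.ne
    simpa only [ENNReal.toReal_ofReal (sq_nonneg _)] using this
  -- The value zero is used only on the null set of times at which the series diverges.
  set h : ℝ → SobolevSpace s := fun τ =>
    if hs : Summable fun k => (sobolevWeight s k * ‖ψ.coeff k * q k τ‖) ^ 2 then
      SobolevSpace.ofCoeff (fun k => ψ.coeff k * q k τ) hs else 0 with hh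
  have hcoeff : ∀ᵐ τ ∂μ, ∀ k, (h τ).coeff k = ψ.coeff k * q k τ := by
    filter_upwards [hae] with τ hτ k
    rw [hh]
    dsimp only
    rw [dif_pos hτ]
    rfl
  have hmeas : AEStronglyMeasurable h μ :=
    aestronglyMeasurable_of_coeff (fun k => (Lp.aestronglyMeasurable (q k)).const_mul _) hcoeff
  have hnorm : eLpNorm h 2 μ ≤ ENNReal.ofReal (C * ‖ψ‖) := by
    have h2 : eLpNorm h 2 μ ^ 2 ≤ ENNReal.ofReal (C * ‖ψ‖) ^ 2 := by
      have e : ∫⁻ τ, ‖h τ‖ₑ ^ 2 ∂μ = ENNReal.ofReal ((2 * Real.pi) ^ 2) *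
          ∫⁻ τ, ∑' k, ENNReal.ofReal ((sobolevWeight s k * ‖ψ.coeff k * q k τ‖) ^ 2) ∂μ := by
        rw [← lintegral_const_mul' _ _ ENNReal.ofReal_ne_top]
        refine lintegral_congr_ae ?_
        filter_upwards [hcoeff] with τ hτ
        rw [enorm_sq_sobolev]
        simp only [hτ]
      rw [heL, e, ENNReal.ofReal_mul hC, mul_pow (ENNReal.ofReal C), ofReal_norm, enorm_sq_sobolev, ← hW,
        ← ENNReal.ofReal_pow hC]
      calc _ ≤ ENNReal.ofReal ((2 * Real.pi) ^ 2) * (W * ENNReal.ofReal (C ^ 2)) := by gcongr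
        _ = _ := by ring
    exact (ENNReal.pow_le_pow_left_iff two_ne_zero).1 h2
  exact ⟨h, ⟨hmeas, hnorm.trans_lt ENNReal.ofReal_lt_top⟩, hcoeff, hnorm⟩

/-! ### Solving the moment problem on each eigenspace -/

theorem eigenvalue_fst_zero (b : ℤ × ℤ → ℝ) (k₂ : ℤ) : eigenvalue b (0, k₂) = 0 := by
  simp [eigenvalue]

/-- On an eigenspace of `∂ₓ𝓛` the control operator couples only the frequencies `(± k₁, k₂)`. -/
theorem torusCoeff_opG_eigenspace {b : ℤ × ℤ → ℝ} (hspec : EvenOddSpectrum b) {s : ℝ}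
    (hs : 0 ≤ s) {g₁ g₂ : Circ → ℝ} (hg₁ : IsBump g₁) (hg₂ : IsBump g₂) (ψ : ℤ × ℤ → ℂ)
    (k : ℤ × ℤ) (χ : SobolevSpace s)
    (hχ : ∀ j, χ.coeff j = if eigenvalue b j = eigenvalue b k then ψ j else 0) :
    torusCoeff (opG g₁ g₂ χ.toL2) k =
      (if k.1 = 0 then 0 else ((2 * Real.pi : ℝ) : ℂ)⁻¹ ^ 2 * ψ k) +
      (if k.2 = 0 then 0 else ((2 * Real.pi : ℝ) : ℂ)⁻¹ ^ 2 * ψ k +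
        if k.1 = 0 then 0 else ((2 * Real.pi : ℝ) : ℂ)⁻¹ * circCoeff g₁ (2 * k.1) *
          ψ (-k.1, k.2)) := by
  obtain ⟨k₁, k₂⟩ := k
  rw [torusCoeff_opG χ hg₁.continuous hg₂.continuous]
  congr 1
  · refine (hasSum_opG₁ hs χ hg₂.continuous (k₁, k₂)).unique ?_
    by_cases hk : k₁ = 0
    · simp only [hk, if_true, zero_mul]
      exact hasSum_zero
    · simp only [if_neg hk]
      -- In a column with `k₁ ≠ 0` the eigenvalue occurs only at `k₂`, so only the zeroth mode of
      -- `g₂` survives.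
      have h := hasSum_single (f := fun m : ℤ => ((2 * Real.pi : ℝ) : ℂ)⁻¹ * circCoeff g₂ m *
        χ.coeff (k₁, k₂ - m)) 0 (fun m hm => by
          rw [hχ, if_neg, mul_zero]
          rw [hspec.unique_snd k₁ k₂ hk]
          omega)
      simp only [sub_zero, hχ, if_true, hg₂.circCoeff_zero, ← sq] at h
      simpa only [hχ] using h
  · refine (hasSum_opG₂ hs χ hg₁.continuous (k₁, k₂)).unique ?_
    by_cases hk : k₂ = 0
    · simp only [hk, if_true, zero_mul]
      exact hasSum_zero
    · simp only [if_neg hk]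
      -- In a row with `k₂ ≠ 0` the eigenvalue occurs only at `±k₁`, which selects the modes `0` and
      -- `2k₁` of `g₁`.
      have hz : ∀ m ∉ ({0, 2 * k₁} : Finset ℤ),
          ((2 * Real.pi : ℝ) : ℂ)⁻¹ * circCoeff g₁ m * χ.coeff (k₁ - m, k₂) = 0 := by
        intro m hm
        simp only [Finset.mem_insert, Finset.mem_singleton, not_or] at hm
        rw [hχ, if_neg, mul_zero]
        rw [hspec.unique_fst k₁ k₂ hk]
        omega
      have h := hasSum_sum_of_ne_finset_zero (L := SummationFilter.unconditional ℤ) hz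
      convert h using 1
      by_cases hk1 : k₁ = 0
      · subst hk1
        simp [hχ, hg₁.circCoeff_zero, sq]
      · have hne : (0 : ℤ) ≠ 2 * k₁ := by omega
        rw [Finset.sum_pair hne, if_neg hk1, sub_zero, hχ, if_pos rfl, hχ,
          show k₁ - 2 * k₁ = -k₁ by ring, ← hspec.even_fst, if_pos rfl, hg₁.circCoeff_zero, ← sq]

/-- On the axes, away from the origin, the equation is `c²ψ = d` with `c = 1/(2π)`. Elsewhere `k`
and its reflection `(-k₁, k₂)` form a 2×2 system with diagonal entries `2c²` and conjugate
off-diagonal entries of modulus at most `c²`. Diagonal dominance makes it uniformly invertible,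
whatever `g₁` is. -/
theorem exists_control_profile {s : ℝ} {g₁ : Circ → ℝ} (hg₁ : IsBump g₁) (d : SobolevSpace s)
    (hd : d.coeff (0, 0) = 0) :
    ∃ ψ : SobolevSpace s, ‖ψ‖ ≤ 8 * Real.pi ^ 2 * ‖d‖ ∧ ∀ k : ℤ × ℤ,
      (if k.1 = 0 then 0 else ((2 * Real.pi : ℝ) : ℂ)⁻¹ ^ 2 * ψ.coeff k) +
      (if k.2 = 0 then 0 else ((2 * Real.pi : ℝ) : ℂ)⁻¹ ^ 2 * ψ.coeff k +
        if k.1 = 0 then 0 else ((2 * Real.pi : ℝ) : ℂ)⁻¹ * circCoeff g₁ (2 * k.1) *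
          ψ.coeff (-k.1, k.2)) = d.coeff k := by
  set c : ℝ := (2 * Real.pi)⁻¹ with hc
  have hc0 : 0 < c := inv_pos.2 Real.two_pi_pos
  have hcC : ((2 * Real.pi : ℝ) : ℂ)⁻¹ = (c : ℂ) := by rw [hc, Complex.ofReal_inv]
  have hcC0 : (c : ℂ) ≠ 0 := Complex.ofReal_ne_zero.2 hc0.ne'
  let γ : ℤ → ℂ := fun n => circCoeff g₁ (2 * n)
  have hγ : ∀ n, ‖γ n‖ ≤ c := fun n => hg₁.norm_circCoeff_le _
  -- The determinant of the 2×2 block.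
  let Δ : ℤ → ℝ := fun n => 4 * c ^ 4 - c ^ 2 * ‖γ n‖ ^ 2
  have hΔ : ∀ n, 3 * c ^ 4 ≤ Δ n := by
    intro n
    have := pow_le_pow_left₀ (norm_nonneg _) (hγ n) 2
    have h2 : c ^ 2 * ‖γ n‖ ^ 2 ≤ c ^ 2 * c ^ 2 := by gcongr
    simp only [Δ]
    nlinarith
  have hΔ0 : ∀ n, 0 < Δ n := fun n => lt_of_lt_of_le (by positivity) (hΔ n)
  -- Cramer's rule: `m₁` multiplies `d(k)` and `m₂` multiplies `d(-k₁, k₂)`. Both are bounded by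
  -- `c⁻² = 4π²`, whence the factor `8π²`.
  let m₁ : ℤ × ℤ → ℂ := fun k =>
    if k.1 = 0 ∨ k.2 = 0 then ((c ^ 2)⁻¹ : ℝ) else (2 * c ^ 2 / Δ k.1 : ℝ)
  let m₂ : ℤ × ℤ → ℂ := fun k =>
    if k.1 = 0 ∨ k.2 = 0 then 0 else -(c * γ k.1 / (Δ k.1 : ℝ))
  have hm₁ : ∀ k, ‖m₁ k‖ * sobolevWeight s k ≤ (c ^ 2)⁻¹ * sobolevWeight s (id k) := by
    intro k
    refine mul_le_mul_of_nonneg_right ?_ (sobolevWeight_pos s k).le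
    simp only [m₁]
    split_ifs
    · rw [Complex.norm_real, Real.norm_eq_abs, abs_of_pos (by positivity)]
    · have h0 := hΔ0 k.1
      rw [Complex.norm_real, Real.norm_eq_abs, abs_of_pos (by positivity), div_le_iff₀ h0,
        inv_mul_eq_div, le_div_iff₀ (by positivity)]
      have := hΔ k.1
      nlinarith [pow_pos hc0 4]
  have hm₂ : ∀ k : ℤ × ℤ, ‖m₂ k‖ * sobolevWeight s k
      ≤ (c ^ 2)⁻¹ * sobolevWeight s (-k.1, k.2) := by
    intro k
    rw [show sobolevWeight s (-k.1, k.2) = sobolevWeight s k by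
      rw [sobolevWeight, sobolevWeight, freqNorm_neg_fst]]
    refine mul_le_mul_of_nonneg_right ?_ (sobolevWeight_pos s k).le
    simp only [m₂]
    split_ifs
    · rw [norm_zero]
      positivity
    · have h0 := hΔ0 k.1
      rw [norm_neg, norm_div, norm_mul, Complex.norm_real, Complex.norm_real, Real.norm_eq_abs,
        Real.norm_eq_abs, abs_of_pos hc0, abs_of_pos h0, div_le_iff₀ h0, inv_mul_eq_div (c ^ 2),
        le_div_iff₀ (by positivity)]
      have h1 := hΔ k.1
      have h2 : c * ‖γ k.1‖ * c ^ 2 ≤ c * c * c ^ 2 := by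
        gcongr
        exact hγ _
      nlinarith [pow_pos hc0 4]
  have hσ : Function.Injective fun k : ℤ × ℤ => (-k.1, k.2) := by
    intro k k' h
    simpa [Prod.ext_iff] using h
  have hci : 0 ≤ (c ^ 2)⁻¹ := by positivity
  let M₁ := SobolevSpace.weightedShift s s m₁ (σ := id) Function.injective_id hci hm₁
  let M₂ := SobolevSpace.weightedShift s s m₂ hσ hci hm₂
  refine ⟨M₁ d + M₂ d, ?_, ?_⟩
  · have h1 := M₁.le_of_opNorm_le (SobolevSpace.norm_weightedShift_le _ _ hci hm₁) d
    have h2 := M₂.le_of_opNorm_le (SobolevSpace.norm_weightedShift_le _ _ hci hm₂) d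
    have h3 : (c ^ 2)⁻¹ = 4 * Real.pi ^ 2 := by
      rw [hc, inv_pow, inv_inv]
      ring
    rw [h3] at h1 h2
    exact (norm_add_le _ _).trans (by linarith)
  · rintro ⟨k₁, k₂⟩
    have hψ : ∀ k : ℤ × ℤ, (M₁ d + M₂ d).coeff k
        = m₁ k * d.coeff k + m₂ k * d.coeff (-k.1, k.2) := fun _ => rfl
    simp only [hψ, hcC]
    by_cases h1 : k₁ = 0
    · subst h1
      by_cases h2 : k₂ = 0
      -- At the origin the left side vanishes identically, so the hypothesis on `d` is needed.
      · subst h2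
        simp [hd]
      · simp only [m₁, m₂, if_neg h2, true_or, if_true]
        push_cast
        field_simp
        ring
    · by_cases h2 : k₂ = 0
      · simp only [m₁, m₂, if_neg h1, h2, or_true, if_true]
        push_cast
        field_simp
        ring
      · have hΔn : Δ (-k₁) = Δ k₁ := by
          simp only [Δ, γ, mul_neg, IsBump.circCoeff_neg, RCLike.norm_conj]
        have hγn : γ (-k₁) = (starRingEnd ℂ) (γ k₁) := by
          simp only [γ, mul_neg, IsBump.circCoeff_neg]
        have hΔC : ((Δ k₁ : ℝ) : ℂ) ≠ 0 := Complex.ofReal_ne_zero.2 (hΔ0 k₁).ne'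
        have hmc : γ k₁ * (starRingEnd ℂ) (γ k₁) = ((‖γ k₁‖ ^ 2 : ℝ) : ℂ) := by
          rw [Complex.mul_conj, Complex.normSq_eq_norm_sq]
        have hΔe : ((Δ k₁ : ℝ) : ℂ) = 4 * c ^ 4 - c ^ 2 * (γ k₁ * (starRingEnd ℂ) (γ k₁)) := by
          rw [hmc]
          simp only [Δ]
          push_cast
          ring
        have e1 : ¬ (k₁ = 0 ∨ k₂ = 0) := by tauto
        have e2 : ¬ (-k₁ = 0 ∨ k₂ = 0) := by
          rw [neg_eq_zero]
          exact e1
        simp only [m₁, m₂, if_neg h1, if_neg h2, if_neg e1, if_neg e2, neg_neg, hΔn, hγn]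
        change _ + (_ + (c : ℂ) * γ k₁ * _) = _
        push_cast
        field_simp
        rw [hΔe]
        ring

end TorusControl

open TorusControl in
theorem theorem1p1 (b : ℤ × ℤ → ℝ) (r : ℝ) (hr : 1 ≤ r) (hb : TorusControl.IsSymbolOfOrder b r)
    (hspec : TorusControl.EvenOddSpectrum b)
    (J : Set (ℤ × ℤ)) (hJ : TorusControl.IsDistinctIndexSet b J)
    (hγ : 0 < TorusControl.spectralGap b J)
    (s : ℝ) (hs : 0 ≤ s) (T : ℝ)
    (hT : ENNReal.ofReal (2 * Real.pi) / TorusControl.asymptoticGap b J < ENNReal.ofReal T)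
    (g₁ : TorusControl.Circ → ℝ) (hg₁ : TorusControl.IsBump g₁) :
    ∃ ν : ℝ, 0 < ν ∧
      ∀ g₂ : TorusControl.Circ → ℝ, TorusControl.IsBump g₂ →
      ∀ u₀ u₁ : TorusControl.SobolevSpace s, u₀.coeff (0, 0) = u₁.coeff (0, 0) →
        ∃ h : ℝ → TorusControl.SobolevSpace s,
          MemLp h 2 (volume.restrict (Icc 0 T)) ∧
          (∃ u : ℝ → TorusControl.SobolevSpace s,
            TorusControl.IsSolution b r g₁ g₂ T h u₀ u ∧
            (∀ v : ℝ → TorusControl.SobolevSpace s,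
              TorusControl.IsSolution b r g₁ g₂ T h u₀ v → EqOn v u (Icc 0 T)) ∧
            u T = u₁) ∧
          eLpNorm h 2 (volume.restrict (Icc 0 T)) ≤ ENNReal.ofReal (ν * (‖u₀‖ + ‖u₁‖)) := by
  have hp := Real.two_pi_pos
  have hT0 : 0 < T := by
    have h := pos_of_gt hT
    simpa using h
  obtain ⟨C, hC, q, hq⟩ :=
    (inghamBelow_spectrum hJ hγ hT0 hT).exists_biorthogonal hT0.le
  -- The first factor bounds the biorthogonal family, the second inverts the control operator on the
  -- eigenspaces; neither involves `g₂`.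
  refine ⟨C * (8 * Real.pi ^ 2), by positivity, fun g₂ hg₂ u₀ u₁ h00 => ?_⟩
  obtain ⟨G, hG⟩ := exists_controlOp hs hg₁ hg₂
  set d : SobolevSpace s := dispersiveGroup b s (-T) u₁ - u₀ with hd
  have hdc : ∀ k, d.coeff k
      = Complex.exp (Complex.I * eigenvalue b k * ↑(-T)) * u₁.coeff k - u₀.coeff k := fun _ => rfl
  -- The group fixes the mean because the eigenvalue at the origin is zero.
  have hd0 : d.coeff (0, 0) = 0 := by
    rw [hdc, eigenvalue_fst_zero]
    simp [h00]
  have hdn : ‖d‖ ≤ ‖u₀‖ + ‖u₁‖ := by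
    refine (norm_sub_le _ _).trans ?_
    rw [add_comm]
    gcongr
    exact norm_dispersiveGroup_le b s (-T) u₁
  obtain ⟨ψ, hψn, hψ⟩ := exists_control_profile hg₁ d hd0
  obtain ⟨h, hhL, hhc, hhn⟩ := exists_memLp_of_modes (μ := volume.restrict (Icc 0 T)) ψ
    (fun k => q (eigenvalue b k)) hC.le (fun k => (hq _ ⟨k, rfl⟩).1)
  have hhi : IntegrableOn h (Icc 0 T) := hhL.integrable (by norm_num)
  obtain ⟨u, hu, huniq, huT⟩ := exists_unique_solution hr hb hT0.le G hG hhi u₀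
  refine ⟨h, hhL, ⟨u, hu, huniq, SobolevSpace.ext_coeff fun k => ?_⟩, hhn.trans ?_⟩
  · set e : ℝ → ℂ := fun τ => Complex.exp (Complex.I * ↑(-eigenvalue b k) * τ) with he
    have hei : IntegrableOn (fun τ => e τ • h τ) (Icc 0 T) := by
      refine Integrable.mono hhi ((continuous_exp_line _).aestronglyMeasurable.smul
        hhi.aestronglyMeasurable) (Filter.Eventually.of_forall fun τ => ?_)
      rw [norm_smul, he, norm_exp_line, one_mul]
    have hL : ∀ (L : SobolevSpace s →L[ℂ] ℂ),
        ∫ τ in Icc 0 T, e τ * L (h τ) = L (∫ τ in Icc 0 T, e τ • h τ) := by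
      intro L
      rw [← L.integral_comp_comm hei]
      simp only [map_smul, smul_eq_mul]
    set χ : SobolevSpace s := ∫ τ in Icc 0 T, e τ • h τ with hχdef
    -- By biorthogonality the integral against `e^{-iλ_k τ}` projects `ψ` onto the eigenspace of
    -- `λ_k`.
    have hχ : ∀ j, χ.coeff j = if eigenvalue b j = eigenvalue b k then ψ.coeff j else 0 := by
      intro j
      refine (hL (SobolevSpace.coeffCLM s j)).symm.trans ?_
      have h1 : ∫ τ in Icc 0 T, e τ * SobolevSpace.coeffCLM s j (h τ)
          = ∫ τ in Icc 0 T, ψ.coeff j * (e τ * q (eigenvalue b j) τ) := by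
        refine integral_congr_ae ?_
        filter_upwards [hhc] with τ hτ
        rw [SobolevSpace.coeffCLM_apply, hτ j]
        ring
      rw [h1, integral_const_mul, he, (hq _ ⟨j, rfl⟩).2 _ ⟨k, rfl⟩]
      by_cases hjk : eigenvalue b j = eigenvalue b k
      · rw [if_pos hjk, if_pos hjk.symm, mul_one]
      · rw [if_neg hjk, if_neg (Ne.symm hjk), mul_zero]
    -- The operator `G` passes through the time integral, so the moment is a coefficient of `G χ`,
    -- which `ψ` was chosen to match.
    have hmom : ∫ τ in Icc 0 T, e τ * (G (h τ)).coeff k = d.coeff k := by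
      refine (hL ((SobolevSpace.coeffCLM s k).comp G)).trans ?_
      change (G χ).coeff k = _
      rw [hG, torusCoeff_opG_eigenspace hspec hs hg₁ hg₂ ψ.coeff k χ hχ, hψ]
    rw [huT k, hmom, hdc, add_sub_cancel, ← mul_assoc, ← Complex.exp_add,
      show Complex.I * eigenvalue b k * T + Complex.I * eigenvalue b k * ↑(-T) = 0 by
        push_cast; ring, Complex.exp_zero, one_mul]
  · refine ENNReal.ofReal_le_ofReal ?_
    rw [mul_assoc C]
    gcongr
    exact hψn.trans (by gcongr)
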